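/- Let $p>3$ be a prime, $f\ge 1$, $K=\mathbf Q_{p^f}$ the unramified extension of $\mathbf Q_p$ of degree $f$ with ring of integers $\mathcal O_K$ and residue field $k=\mathbf F_{p^f}$, and let $\mathbf F$ be a finite field containing $k$. Let $\alpha$ generate $k$ over $\mathbf F_p$, let $\zeta$ generate the quadratic extension $k_2$ of $k$, and write $[\cdot]$ for the Teichmüller lift. Let $G$ be one of the following two groups, with the topology coming from the $p$-adic one, and let $A_i,B_i,C_i$ ($0\le i\le f-1$) be the classes in $G$ of the given elements. (a) ($\mathrm{GL}_2$-case) $G=I_1/Z_1$, where $I_1=\begin{pmatrix}1+p\mathcal O_K&\mathcal O_K\\p\mathcal O_K&1+p\mathcal O_K\end{pmatrix}\subset \mathrm{GL}_2(K)$ and $Z_1$ is its subgroup of scalar matrices; $$A_i=\begin{pmatrix}1&[\alpha^i]\\0&1\end{pmatrix},\quad B_i=\begin{pmatrix}1&0\\ [\alpha^i]p&1\end{pmatrix},\quad C_i=\begin{pmatrix}1+[\alpha^i]p&0\\0&(1+[\alpha^i]p)^{-1}\end{pmatrix}.$$ For $g\in G$ put $\omega(g)=\min\{v_p(a-1),\,v_p(b)+\tfrac12,\,v_p(c)-\tfrac12,\,v_p(d-1)\}$,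 where $\begin{pmatrix}a&b\\c&d\end{pmatrix}\in I_1$ is the unique representative of $g$ of determinant $1$. (b) (quaternion case) $G=U_1/Z_1$, where $D$ is the quaternion algebra over $K$ of invariant $1/2$, with maximal order $\mathcal O_D=W(k_2)\oplus W(k_2)\Pi$, $\Pi^2=p$, $\Pi x=\sigma(x)\Pi$ for $x\in W(k_2)$ (here $W(k_2)$ is the ring of Witt vectors of $k_2$, and $\sigma$ is the lift of the Frobenius $x\mapsto x^{p^f}$ of $k_2$), and $U_1=1+\Pi\mathcal O_D$, $Z_1=1+p\mathcal O_K$; $$A_i=1+[\alpha^i]\Pi,\quad B_i=1+[\alpha^i][\zeta]\Pi,\quad C_i=1+[\alpha^i][\zeta]p.$$ For $g\in G$ put $\omega(g)=v_p(u-1)$, where $u\in U_1$ is the unique representative of $g$ of reduced norm $1$ and $v_p$ is the valuation of $D$ with $v_p(p)=1$. Let $\mathbf F[\![G]\!]=\varprojlim_N\mathbf F[G/N]$ ($N$ running over the open normal subgroups of $G$) be the completed group ring, with its inverse limit topology, and let $(g_1,\dots,g_{3f})=(A_0,\dots,A_{f-1},B_0,\dots,B_{f-1},C_0,\dots,C_{f-1})$.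 For $\underline x\in\mathbf Z_{\ge0}^{3f}$ put $z^{\underline x}=(g_1-1)^{x_1}\cdots(g_{3f}-1)^{x_{3f}}$. Then, in both cases, every element of $\mathbf F[\![G]\!]$ has a unique expansion as a convergent sum $\sum_{\underline x\ge0}c_{\underline x}z^{\underline x}$ with $c_{\underline x}\in\mathbf F$; the ring $\mathbf F[\![G]\!]$ is local, with a unique maximal left ideal $\mathfrak m_G$, which is two-sided; and, with $$\nu\Big(\sum_{\underline x\ge0}c_{\underline x}z^{\underline x}\Big)=2\inf\Big\{\sum_{i=1}^{3f}x_i\,\omega(g_i)\;:\;c_{\underline x}\ne0\Big\}\in[0,\infty],$$ one has, for every integer $j\ge0$, $$\mathfrak m_G^j=\{x\in\mathbf F[\![G]\!]:\nu(x)\ge j\}.$$ -/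

import Mathlib

open scoped ENNReal

noncomputable section

/-! ## The completed group ring of a topological group -/

/-- The compatible families in `∏ F[G/N]`, with `N` running over the open normal subgroups of `G`:
the inverse limit of the group rings `F[G/N]` along the projections `G/N → G/M` for `N ≤ M`. -/
def completedGroupSubalgebra (F : Type*) [Field F] (G : Type*) [Group G] [TopologicalSpace G] :
    Subalgebra F (∀ N : OpenNormalSubgroup G, MonoidAlgebra F (G ⧸ (N : Subgroup G))) where
  carrier := {x | ∀ (N M : OpenNormalSubgroup G) (h : (N : Subgroup G) ≤ (M : Subgroup G)),
    MonoidAlgebra.mapDomainAlgHom F F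
      (QuotientGroup.map (N : Subgroup G) (M : Subgroup G) (MonoidHom.id G) h) (x N) = x M}
  mul_mem' := by
    intro x y hx hy N M h
    rw [Pi.mul_apply, map_mul, hx N M h, hy N M h, Pi.mul_apply]
  add_mem' := by
    intro x y hx hy N M h
    rw [Pi.add_apply, map_add, hx N M h, hy N M h, Pi.add_apply]
  algebraMap_mem' := by
    intro r N M h
    rw [Pi.algebraMap_apply, AlgHom.commutes, Pi.algebraMap_apply]

/-- The completed group ring `F⟦G⟧`. -/
def CompletedGroupRing (F : Type*) [Field F] (G : Type*) [Group G] [TopologicalSpace G] : Type _ :=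
  completedGroupSubalgebra F G

namespace CompletedGroupRing

variable (F : Type*) [Field F] {G : Type*} [Group G] [TopologicalSpace G]

instance : Ring (CompletedGroupRing F G) :=
  inferInstanceAs (Ring (completedGroupSubalgebra F G))

instance : Algebra F (CompletedGroupRing F G) :=
  inferInstanceAs (Algebra F (completedGroupSubalgebra F G))

/-- The inverse limit topology, every `F[G/N]` being discrete. -/
instance : TopologicalSpace (CompletedGroupRing F G) :=
  ⨅ N : OpenNormalSubgroup G,
    TopologicalSpace.induced (fun x : completedGroupSubalgebra F G => x.1 N) ⊥

/-- The group element `g`, as an element of `F⟦G⟧`. -/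
def of (g : G) : CompletedGroupRing F G :=
  ⟨fun _ => MonoidAlgebra.of F _ (QuotientGroup.mk g), by
    intro N M h
    simp [MonoidAlgebra.of_apply]
    rfl⟩

variable {d : ℕ}

/-- `z^x = (g_1 - 1)^{x_1} ⋯ (g_d - 1)^{x_d}`, the factors multiplied in this order. -/
def monomial (g : Fin d → G) (x : Fin d → ℕ) : CompletedGroupRing F G :=
  (List.ofFn fun i => (of F (g i) - 1) ^ x i).prod

variable {F}

/-- `y = ∑ₓ cₓ z^x`, a convergent (infinite) sum in `F⟦G⟧`. -/
def IsExpansion (g : Fin d → G) (c : (Fin d → ℕ) → F) (y : CompletedGroupRing F G) : Prop :=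
  HasSum (fun x => c x • monomial F g x) y

/-- `ν = 2 w̄`, where `w̄ (∑ₓ cₓ z^x) = inf {∑ᵢ xᵢ ω(gᵢ) : cₓ ≠ 0}`. -/
def nu (ω : G → ℝ≥0∞) (g : Fin d → G) (y : CompletedGroupRing F G) : ℝ≥0∞ :=
  2 * ⨅ (c : (Fin d → ℕ) → F) (_ : IsExpansion g c y) (x : Fin d → ℕ) (_ : c x ≠ 0),
    ∑ i, (x i : ℝ≥0∞) * ω (g i)

end CompletedGroupRing

/-! ## The ring of integers `O_K = W(k)` of the unramified extension `K` of `ℚ_p`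

For a finite field `k` with `p ^ f` elements, `WittVector p k` is the ring of integers of `K`, the
unramified extension of `ℚ_p` of degree `f`, and `WittVector.teichmuller` is the Teichmüller lift.
-/

/-- The `p`-adic topology. -/
instance WittVector.padicTopology (p : ℕ) [Fact p.Prime] (k : Type*) [CommRing k] :
    TopologicalSpace (WittVector p k) :=
  (Ideal.span {(p : WittVector p k)}).adicTopology

/-- The `p`-adic valuation, with `v_p(p) = 1` and `v_p(0) = ∞`. -/
def WittVector.vp {p : ℕ} [Fact p.Prime] {k : Type*} [CommRing k] (x : WittVector p k) : ℝ≥0∞ :=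
  (emultiplicity (p : WittVector p k) x : ℕ∞)

theorem WittVector.isUnit_of_eq_one_add {p : ℕ} [Fact p.Prime] {k : Type*} [Field k] [CharP k p]
    {x : WittVector p k} (h : ∃ y, x = 1 + p * y) : IsUnit x := by
  obtain ⟨y, rfl⟩ := h
  apply WittVector.isUnit_of_coeff_zero_ne_zero
  have : WittVector.constantCoeff (1 + (p : WittVector p k) * y) = 1 := by
    rw [map_add, map_mul, map_one, map_natCast, CharP.cast_eq_zero, zero_mul, add_zero]
  rw [← WittVector.constantCoeff_apply, this]
  exact one_ne_zero

/-! ## The group `I₁ / Z₁` -/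

namespace Iwahori

variable (p : ℕ) [Fact p.Prime] (k : Type*) [Field k]

/-- The pro-`p` Iwahori subgroup of `GL₂(K)` (contained in `GL₂(O_K)`). -/
def I₁ : Subgroup (GL (Fin 2) (WittVector p k)) where
  carrier := {u | (p : WittVector p k) ∣ u 0 0 - 1 ∧ (p : WittVector p k) ∣ u 1 0 ∧
    (p : WittVector p k) ∣ u 1 1 - 1}
  one_mem' := by simp
  mul_mem' := by
    rintro u v ⟨⟨a, ha⟩, ⟨c, hc⟩, ⟨d, hd⟩⟩ ⟨⟨a', ha'⟩, ⟨c', hc'⟩, ⟨d', hd'⟩⟩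
    rw [sub_eq_iff_eq_add] at ha hd ha' hd'
    simp only [Set.mem_ofPred_eq, Units.val_mul, Matrix.mul_apply, Fin.sum_univ_two, ha, hc, hd, ha',
      hc', hd']
    exact ⟨⟨p * a * a' + a + a' + u 0 1 * c', by ring⟩,
      ⟨c * (p * a' + 1) + (p * d + 1) * c', by ring⟩,
      ⟨c * v 0 1 + p * d * d' + d + d', by ring⟩⟩
  inv_mem' := by
    rintro u ⟨⟨a, ha⟩, ⟨c, hc⟩, ⟨d, hd⟩⟩
    rw [sub_eq_iff_eq_add] at ha hd
    have h : (u : Matrix (Fin 2) (Fin 2) (WittVector p k)) * (u⁻¹ : GL (Fin 2) (WittVector p k)) = 1 :=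
      by rw [← Units.val_mul, mul_inv_cancel]; rfl
    have h00 := congrFun (congrFun h 0) 0
    have h10 := congrFun (congrFun h 1) 0
    have h11 := congrFun (congrFun h 1) 1
    simp only [Matrix.mul_apply, Fin.sum_univ_two, ha, hc, hd, Matrix.one_apply_eq,
      Matrix.one_apply_ne (show (1 : Fin 2) ≠ 0 by decide)] at h00 h10 h11
    set w := (u⁻¹ : GL (Fin 2) (WittVector p k))
    have e10 : w 1 0 = p * (-(c * w 0 0) - d * w 1 0) := by linear_combination h10
    exact ⟨⟨-(a * w 0 0) - u 0 1 * (-(c * w 0 0) - d * w 1 0), by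
        linear_combination h00 - u 0 1 * e10⟩, ⟨_, e10⟩,
      ⟨-(c * w 0 1) - d * w 1 1, by linear_combination h11⟩⟩

/-- The scalar matrices in `I₁`. -/
def Z₁ : Subgroup (I₁ p k) :=
  (Units.map (Matrix.scalar (Fin 2) : WittVector p k →+* _).toMonoidHom).range.subgroupOf (I₁ p k)

instance : (Z₁ p k).Normal := by
  constructor
  rintro z ⟨c, hc⟩ g
  have : g * z * g⁻¹ = z := by
    rw [mul_inv_eq_iff_eq_mul]
    apply Subtype.ext
    apply Units.ext
    have hz : ((z : GL (Fin 2) (WittVector p k)) : Matrix (Fin 2) (Fin 2) (WittVector p k)) =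
        Matrix.scalar (Fin 2) (c : WittVector p k) := congrArg Units.val hc.symm
    simp only [Subgroup.coe_mul, Units.val_mul, hz]
    exact ((Matrix.scalar_commute _ (fun r => Commute.all _ r) _).eq).symm
  rw [this]
  exact ⟨c, hc⟩

/-- The topological group `G = I₁ / Z₁`, with the quotient of the `p`-adic topology. -/
abbrev G : Type _ := I₁ p k ⧸ Z₁ p k

variable {p k}

/-- The `p`-valuation: `ω(g)` is read off from the representative `(a, b; c, d)` of `g` in `I₁` that
has determinant `1`, as `min {v_p(a - 1), v_p(b) + 1/2, v_p(c) - 1/2, v_p(d - 1)}`. The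
representative is unique for `p > 2`, so that the supremum runs over one element. -/
def omega (g : G p k) : ℝ≥0∞ :=
  ⨆ (u : I₁ p k) (_ : QuotientGroup.mk u = g) (_ : Matrix.GeneralLinearGroup.det u.1 = 1),
    min (min (WittVector.vp (u.1 0 0 - 1)) (WittVector.vp (u.1 0 1) + 1 / 2))
      (min (WittVector.vp (u.1 1 0) - 1 / 2) (WittVector.vp (u.1 1 1 - 1)))

/-- The class in `G` of the matrix `M` in `I₁`. -/
def ofMatrix (M : Matrix (Fin 2) (Fin 2) (WittVector p k)) (h : IsUnit M.det)
    (h₀ : (p : WittVector p k) ∣ M 0 0 - 1) (h₁ : (p : WittVector p k) ∣ M 1 0)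
    (h₂ : (p : WittVector p k) ∣ M 1 1 - 1) : G p k :=
  QuotientGroup.mk ⟨Matrix.GeneralLinearGroup.mk'' M h, h₀, h₁, h₂⟩

/-- The class in `G` of the matrix `(1, [a]; 0, 1)`. -/
def A (a : k) : G p k :=
  ofMatrix !![1, WittVector.teichmuller p a; 0, 1]
    (by simp [Matrix.det_fin_two]) (by simp) (by simp) (by simp)

/-- The class in `G` of the matrix `(1, 0; [a] p, 1)`. -/
def B (a : k) : G p k :=
  ofMatrix !![1, 0; WittVector.teichmuller p a * p, 1]
    (by simp [Matrix.det_fin_two]) (by simp) (by simp) (by simp)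

variable [CharP k p]

/-- `1 + [a] p` as a unit of `O_K`. -/
def oneAdd (a : k) : (WittVector p k)ˣ :=
  (WittVector.isUnit_of_eq_one_add (x := 1 + WittVector.teichmuller p a * (p : WittVector p k))
    ⟨WittVector.teichmuller p a, by rw [mul_comm]⟩).unit

theorem coe_oneAdd (a : k) :
    (oneAdd a : WittVector p k) = 1 + WittVector.teichmuller p a * (p : WittVector p k) := rfl

theorem dvd_inv_oneAdd_sub_one (a : k) :
    (p : WittVector p k) ∣ (((oneAdd a)⁻¹ : (WittVector p k)ˣ) : WittVector p k) - 1 := by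
  refine ⟨-((oneAdd a)⁻¹ : (WittVector p k)ˣ) * WittVector.teichmuller p a, ?_⟩
  have h2 := Units.inv_mul (oneAdd (p := p) a)
  rw [coe_oneAdd] at h2
  linear_combination h2

/-- The class in `G` of the matrix `(1 + [a] p, 0; 0, (1 + [a] p)⁻¹)`. -/
def C (a : k) : G p k :=
  ofMatrix !![(oneAdd a : WittVector p k), 0; 0, ((oneAdd a)⁻¹ : (WittVector p k)ˣ)]
    (by simp [Matrix.det_fin_two]) (by simp [coe_oneAdd]) (by simp)
    (by simpa using dvd_inv_oneAdd_sub_one a)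

/-- The family `A_0, …, A_{f-1}, B_0, …, B_{f-1}, C_0, …, C_{f-1}`. -/
def basis (f : ℕ) (α : k) : Fin (f + f + f) → G p k :=
  Fin.append (Fin.append (fun i : Fin f => A (α ^ (i : ℕ))) (fun i : Fin f => B (α ^ (i : ℕ))))
    (fun i : Fin f => C (α ^ (i : ℕ)))

end Iwahori

/-! ## The maximal order `O_D` of the quaternion algebra and the group `U₁ / Z₁`

Let `k₂` be the quadratic extension of the finite field `k`, so that `W(k₂)` is the ring of integers
of the unramified quadratic extension of `K`. Then `O_D = W(k₂) ⊕ W(k₂) Π`, where `Π ^ 2 = p` and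
`Π a = σ(a) Π` for `a` in `W(k₂)`, with `σ` the lift of the Frobenius of `k₂` over `k`. This is the
maximal order of the quaternion division algebra `D` over `K`. -/

/-- The automorphism `σ` of `W(k₂)` over `W(k)` that lifts `x ↦ x ^ #k`. -/
def wittSigma (p : ℕ) [Fact p.Prime] (k k₂ : Type*) [Field k] [Fintype k] [Field k₂]
    [Algebra k k₂] : WittVector p k₂ →+* WittVector p k₂ :=
  WittVector.map (FiniteField.frobeniusAlgHom k k₂ : k₂ →+* k₂)

theorem wittSigma_wittSigma {p : ℕ} [Fact p.Prime] {k k₂ : Type*} [Field k] [Fintype k] [Field k₂]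
    [Algebra k k₂] [Algebra.IsQuadraticExtension k k₂] (x : WittVector p k₂) :
    wittSigma p k k₂ (wittSigma p k k₂ x) = x := by
  ext n
  have : Module.Finite k k₂ := Module.finite_of_finrank_pos
    (by rw [Algebra.IsQuadraticExtension.finrank_eq_two k k₂]; norm_num)
  have : Finite k₂ := Module.finite_of_finite k
  have := Fintype.ofFinite k₂
  have hc : Fintype.card k₂ = Fintype.card k ^ 2 := by
    rw [Module.card_eq_pow_finrank (K := k), Algebra.IsQuadraticExtension.finrank_eq_two k k₂]
  simp only [wittSigma, WittVector.map_coeff, RingHom.coe_coe, FiniteField.frobeniusAlgHom_apply]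
  rw [← pow_mul, ← pow_two, ← hc, FiniteField.pow_card]

/-- The order `O_D`; the element `⟨a, b⟩` is `a + b Π`. -/
@[ext]
structure QuaternionOrder (p : ℕ) [Fact p.Prime] (k k₂ : Type*) [Field k] [Fintype k] [Field k₂]
    [Algebra k k₂] where
  fst : WittVector p k₂
  snd : WittVector p k₂

namespace QuaternionOrder

variable {p : ℕ} [Fact p.Prime] {k k₂ : Type*} [Field k] [Fintype k] [Field k₂]
  [Algebra k k₂]

local notation "OD" => QuaternionOrder p k k₂

instance : Zero OD := ⟨⟨0, 0⟩⟩
instance : One OD := ⟨⟨1, 0⟩⟩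
instance : Add OD := ⟨fun x y => ⟨x.fst + y.fst, x.snd + y.snd⟩⟩
instance : Neg OD := ⟨fun x => ⟨-x.fst, -x.snd⟩⟩
instance : Mul OD := ⟨fun x y =>
  ⟨x.fst * y.fst + p * (x.snd * wittSigma p k k₂ y.snd),
    x.fst * y.snd + x.snd * wittSigma p k k₂ y.fst⟩⟩

@[simp] theorem zero_fst : (0 : OD).fst = 0 := rfl
@[simp] theorem zero_snd : (0 : OD).snd = 0 := rfl
@[simp] theorem one_fst : (1 : OD).fst = 1 := rfl
@[simp] theorem one_snd : (1 : OD).snd = 0 := rfl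
@[simp] theorem add_fst (x y : OD) : (x + y).fst = x.fst + y.fst := rfl
@[simp] theorem add_snd (x y : OD) : (x + y).snd = x.snd + y.snd := rfl
@[simp] theorem neg_fst (x : OD) : (-x).fst = -x.fst := rfl
@[simp] theorem neg_snd (x : OD) : (-x).snd = -x.snd := rfl
@[simp] theorem mul_fst (x y : OD) :
    (x * y).fst = x.fst * y.fst + p * (x.snd * wittSigma p k k₂ y.snd) := rfl
@[simp] theorem mul_snd (x y : OD) :
    (x * y).snd = x.fst * y.snd + x.snd * wittSigma p k k₂ y.fst := rfl

instance [Algebra.IsQuadraticExtension k k₂] : Ring OD where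
  add_assoc _ _ _ := by ext1 <;> simp [add_assoc]
  zero_add _ := by ext1 <;> simp
  add_zero _ := by ext1 <;> simp
  add_comm _ _ := by ext1 <;> simp [add_comm]
  neg_add_cancel _ := by ext1 <;> simp
  mul_assoc _ _ _ := by
    ext1 <;> simp only [mul_fst, mul_snd, map_add, map_mul, map_natCast, wittSigma_wittSigma] <;> ring
  one_mul _ := by ext1 <;> simp
  mul_one _ := by ext1 <;> simp
  zero_mul _ := by ext1 <;> simp
  mul_zero _ := by ext1 <;> simp
  left_distrib _ _ _ := by
    ext1 <;> simp only [mul_fst, mul_snd, add_fst, add_snd, map_add] <;> ring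
  right_distrib _ _ _ := by
    ext1 <;> simp only [mul_fst, mul_snd, add_fst, add_snd] <;> ring
  nsmul := nsmulRec
  zsmul := zsmulRec

/-- The `p`-adic topology of `O_D ≅ W(k₂) × W(k₂)`. -/
instance : TopologicalSpace OD :=
  TopologicalSpace.induced (fun x => (x.fst, x.snd)) inferInstance

/-- The reduced norm `a σ(a) - p b σ(b)` of `a + b Π`. -/
def nrd (x : OD) : WittVector p k₂ :=
  x.fst * wittSigma p k k₂ x.fst - p * (x.snd * wittSigma p k k₂ x.snd)

variable (p k k₂)

/-- The uniformizer `Π`, a square root of `p`. -/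
def Pi : OD := ⟨0, 1⟩

@[simp] theorem Pi_fst : (Pi p k k₂).fst = 0 := rfl
@[simp] theorem Pi_snd : (Pi p k k₂).snd = 1 := rfl

theorem wittSigma_map_algebraMap (c : WittVector p k) :
    wittSigma p k k₂ (WittVector.map (algebraMap k k₂) c) = WittVector.map (algebraMap k k₂) c := by
  ext n
  simp [wittSigma, WittVector.map_coeff]

variable [Algebra.IsQuadraticExtension k k₂]

/-- The inclusion of `W(k₂)` into `O_D`. -/
def incl : WittVector p k₂ →+* OD where
  toFun a := ⟨a, 0⟩
  map_one' := rfl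
  map_zero' := rfl
  map_mul' _ _ := by ext1 <;> simp
  map_add' _ _ := by ext1 <;> simp

@[simp] theorem incl_fst (a : WittVector p k₂) : (incl p k k₂ a).fst = a := rfl
@[simp] theorem incl_snd (a : WittVector p k₂) : (incl p k k₂ a).snd = 0 := rfl

/-- The inclusion of `O_K = W(k)` into `O_D`. -/
def inclK : WittVector p k →+* OD :=
  (incl p k k₂).comp (WittVector.map (algebraMap k k₂))

theorem Pi_mul_Pi : Pi p k k₂ * Pi p k k₂ = (p : OD) := by
  rw [← map_natCast (incl p k k₂)]
  ext1 <;> simp [-map_natCast]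

theorem Pi_mul_incl (a : WittVector p k₂) :
    Pi p k k₂ * incl p k k₂ a = incl p k k₂ (wittSigma p k k₂ a) * Pi p k k₂ := by
  ext1 <;> simp

theorem inclK_comm (c : WittVector p k) (x : OD) :
    inclK p k k₂ c * x = x * inclK p k k₂ c := by
  ext1 <;> simp [inclK, wittSigma_map_algebraMap, mul_comm]

/-- The valuation of `O_D` with `v_p(p) = 1`, that is `v_p(Π) = 1/2`. -/
def vp (x : OD) : ℝ≥0∞ := ((emultiplicity (Pi p k k₂) x : ℕ∞) : ℝ≥0∞) / 2

/-- The group `U₁ = 1 + Π O_D`. -/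
def U₁ : Subgroup (OD)ˣ where
  carrier := {u | ∃ x : OD, (u : OD) = 1 + Pi p k k₂ * x}
  one_mem' := ⟨0, by simp⟩
  mul_mem' := by
    rintro u v ⟨x, hx⟩ ⟨y, hy⟩
    exact ⟨x + y + x * (Pi p k k₂ * y), by rw [Units.val_mul, hx, hy]; noncomm_ring⟩
  inv_mem' := by
    rintro u ⟨x, hx⟩
    refine ⟨-(x * (u⁻¹ : (OD)ˣ)), ?_⟩
    have h := Units.mul_inv u
    rw [hx, add_mul, one_mul] at h
    rw [mul_neg, ← mul_assoc, ← sub_eq_add_neg, ← h]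
    simp

/-- The central subgroup `Z₁ = 1 + p O_K` of `U₁`, as the intersection of `U₁` with the units of
`O_K`. -/
def Z₁ : Subgroup (U₁ p k k₂) :=
  (Units.map (inclK p k k₂).toMonoidHom).range.subgroupOf (U₁ p k k₂)

instance : (Z₁ p k k₂).Normal := by
  constructor
  rintro z ⟨c, hc⟩ g
  have : g * z * g⁻¹ = z := by
    rw [mul_inv_eq_iff_eq_mul]
    apply Subtype.ext
    apply Units.ext
    have hz : ((z : (OD)ˣ) : OD) = inclK p k k₂ c := congrArg Units.val hc.symm
    simp only [Subgroup.coe_mul, Units.val_mul, hz]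
    exact (inclK_comm p k k₂ _ _).symm
  rw [this]
  exact ⟨c, hc⟩

/-- The topological group `G = U₁ / Z₁`, with the quotient of the `p`-adic topology. -/
abbrev G : Type _ := U₁ p k k₂ ⧸ Z₁ p k k₂

variable {p k k₂}

/-- The `p`-valuation: `ω(g) = v_p(u - 1)` for the representative `u` of `g` in `U₁` that has
reduced norm `1`. The representative is unique for `p > 2`, so that the supremum runs over one
element. -/
def omega (g : G p k k₂) : ℝ≥0∞ :=
  ⨆ (u : U₁ p k k₂) (_ : QuotientGroup.mk u = g) (_ : nrd (u.1 : OD) = 1),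
    vp p k k₂ ((u.1 : OD) - 1)

theorem isUnit_one_add_Pi_mul [CharP k₂ p] {y : OD} (h : ∃ x, y = 1 + Pi p k k₂ * x) :
    IsUnit y := by
  obtain ⟨x, rfl⟩ := h
  set y : OD := 1 + Pi p k k₂ * x with hy
  have h1 : y.fst = 1 + p * wittSigma p k k₂ x.snd := by simp [hy]
  have hs : wittSigma p k k₂ (nrd y) = nrd y := by
    simp only [nrd, map_sub, map_mul, map_natCast, wittSigma_wittSigma]
    ring
  have hN : IsUnit (nrd y) := by
    apply WittVector.isUnit_of_eq_one_add
    refine ⟨wittSigma p k k₂ x.snd + x.snd + p * wittSigma p k k₂ x.snd * x.snd -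
      y.snd * wittSigma p k k₂ y.snd, ?_⟩
    rw [nrd, h1]
    simp only [map_add, map_mul, map_one, map_natCast, wittSigma_wittSigma]
    ring
  obtain ⟨n, hn⟩ := hN
  set m : WittVector p k₂ := ((n⁻¹ : (WittVector p k₂)ˣ) : WittVector p k₂)
  have hm : m * nrd y = 1 := by rw [← hn]; exact Units.inv_mul n
  have hms : wittSigma p k k₂ m = m := by
    have h2 := congrArg (wittSigma p k k₂) hm
    rw [map_mul, hs, map_one] at h2
    calc wittSigma p k k₂ m = wittSigma p k k₂ m * (m * nrd y) := by rw [hm, mul_one]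
      _ = m * (wittSigma p k k₂ m * nrd y) := by ring
      _ = m := by rw [h2, mul_one]
  rw [nrd] at hm
  let w : OD := ⟨m * wittSigma p k k₂ y.fst, -(m * y.snd)⟩
  refine ⟨⟨y, w, ?_, ?_⟩, rfl⟩
  · ext1
    · simp only [w, mul_fst, map_neg, map_mul, hms, one_fst]
      linear_combination hm
    · simp only [w, mul_snd, map_mul, hms, wittSigma_wittSigma, one_snd]
      ring
  · ext1
    · simp only [w, mul_fst, one_fst]
      linear_combination hm
    · simp only [w, mul_snd, one_snd]
      ring

/-- The class in `G` of the element `y` of `1 + Π O_D`. -/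
def mkG [CharP k₂ p] (y : OD) (h : ∃ x, y = 1 + Pi p k k₂ * x) : G p k k₂ :=
  QuotientGroup.mk ⟨(isUnit_one_add_Pi_mul h).unit, h⟩

variable [CharP k₂ p]

/-- The class in `G` of `1 + [a] Π`. -/
def A (a : k) : G p k k₂ :=
  mkG (1 + inclK p k k₂ (WittVector.teichmuller p a) * Pi p k k₂)
    ⟨inclK p k k₂ (WittVector.teichmuller p a), by rw [inclK_comm]⟩

/-- The class in `G` of `1 + [a] [ζ] Π`. -/
def B (ζ : k₂) (a : k) : G p k k₂ :=
  mkG (1 + inclK p k k₂ (WittVector.teichmuller p a) * incl p k k₂ (WittVector.teichmuller p ζ) *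
      Pi p k k₂)
    ⟨inclK p k k₂ (WittVector.teichmuller p a) *
      incl p k k₂ (wittSigma p k k₂ (WittVector.teichmuller p ζ)), by
        rw [← mul_assoc, ← inclK_comm, mul_assoc, mul_assoc, Pi_mul_incl, wittSigma_wittSigma]⟩

/-- The class in `G` of `1 + [a] [ζ] p`. -/
def C (ζ : k₂) (a : k) : G p k k₂ :=
  mkG (1 + inclK p k k₂ (WittVector.teichmuller p a) * incl p k k₂ (WittVector.teichmuller p ζ) *
      (p : OD))
    ⟨Pi p k k₂ * (inclK p k k₂ (WittVector.teichmuller p a) *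
      incl p k k₂ (WittVector.teichmuller p ζ)), by
        rw [← (Nat.cast_commute p _).eq, ← Pi_mul_Pi, mul_assoc]⟩

/-- The family `A_0, …, A_{f-1}, B_0, …, B_{f-1}, C_0, …, C_{f-1}`. -/
def basis (f : ℕ) (α : k) (ζ : k₂) : Fin (f + f + f) → G p k k₂ :=
  Fin.append (Fin.append (fun i : Fin f => A (α ^ (i : ℕ))) (fun i : Fin f => B ζ (α ^ (i : ℕ))))
    (fun i : Fin f => C ζ (α ^ (i : ℕ)))

end QuaternionOrder

end

noncomputable section

/-! ## Straightening words in an algebra with weighted generators -/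

namespace WeightedWords

variable {F A : Type*} [Field F] [Ring A] [Algebra F A] {d : ℕ}

/-! Both groups are instances of one construction. An element of `I₁` or `U₁` is X + YΠ with Π² = p,
Πr = σ(r)Π and X ≡ 1 mod p, over R = W(k) × W(k) with σ the swap, respectively R = W(k₂) with σ the
lift of Frobenius (`IsTwistedUnitGroup`). Modulo the centre it is filtered by the conditions p^⌈n/2⌉
∣ X - σ(X) and p^⌊n/2⌋ ∣ Y. Commutators raise the level by one (`commutator_mem`). Leading
coefficients identify the graded pieces with R/p for odd n and with its σ = -1 part for even n. A
p-th power raises the level of a generator by two and keeps its leading coefficient; for p = 3 this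
would fail for A_i and B_i. As the A_i, B_i give an 𝔽_p-basis of the odd pieces and the C_i one of
the even pieces, exponents are found digit by digit in base p: every class modulo level 2m + 1 and
the centre is an ordered product of powers g_i^{x_i} with unique x_i < p^m (`existsUnique_exponent`,
`IsTwistedBasis.isOrderedBasis`).

Put z_i = g_i - 1, of weight 1 for A_i, B_i and 2 for C_i. In F[G/N m] one has z_i^{p^m} = 0, so the
ordered monomials with exponents below p^m span, and by counting they form a basis; passing to the
limit gives the unique expansions. An element u of N 1 is modulo N m a product of p-th powers, so u
- 1 has weight at least p. Hence z_i z_j - z_j z_i is a combination of single letters of weight w_i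
+ w_j plus terms of larger weight, provided p ≥ 5 (`commRel`). Sorting a word therefore only creates
words that are shorter or heavier, so words and ordered monomials span the same weight filtration,
which is thus multiplicative (`wordSpan_eq_monSpan`).

Elements of weight 0 have nonzero constant term and are invertible, so weight at least 1 defines the
maximal ideal 𝔪, and multiplicativity puts 𝔪^j in weight at least j. Conversely each C_i is a
commutator modulo N 1, which gives C_i - 1 ∈ 𝔪² (`of_sub_one_mem_pow`). Splitting an infinite
expansion by its last letter writes it as a finite sum of terms y_i z_i, and induction on j finishes
(`mem_pow_of_weight`). -/

/-- The weight of a word. -/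
def wordWeight (w : Fin d → ℕ) (l : List (Fin d)) : ℕ := (l.map w).sum

/-- The weight of an exponent. -/
def wt (w : Fin d → ℕ) (x : Fin d → ℕ) : ℕ := ∑ i, x i * w i

/-- The ordered monomial `z_1^{x_1} ⋯ z_d^{x_d}`. -/
def mon {A : Type*} [Monoid A] {d : ℕ} (z : Fin d → A) (x : Fin d → ℕ) : A :=
  (List.ofFn fun i => z i ^ x i).prod

/-- The span of the words of weight at least `j`. -/
def wordSpan (F : Type*) [Field F] [Algebra F A] (z : Fin d → A) (w : Fin d → ℕ) (j : ℕ) :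
    Submodule F A :=
  Submodule.span F {a | ∃ l : List (Fin d), j ≤ wordWeight w l ∧ (l.map z).prod = a}

/-- The span of the ordered monomials of weight at least `j`. -/
def monSpan (F : Type*) [Field F] [Algebra F A] (z : Fin d → A) (w : Fin d → ℕ) (j : ℕ) :
    Submodule F A :=
  Submodule.span F {a | ∃ x : Fin d → ℕ, j ≤ wt w x ∧ mon z x = a}

variable {z : Fin d → A} {w : Fin d → ℕ}

theorem wordWeight_append (l m : List (Fin d)) :
    wordWeight w (l ++ m) = wordWeight w l + wordWeight w m := by
  simp [wordWeight]

theorem wordWeight_cons (i : Fin d) (m : List (Fin d)) :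
    wordWeight w (i :: m) = w i + wordWeight w m := by
  simp [wordWeight]

theorem wordWeight_perm {l m : List (Fin d)} (h : l.Perm m) : wordWeight w l = wordWeight w m :=
  (h.map w).sum_eq

theorem prod_mem_wordSpan {j : ℕ} {l : List (Fin d)} (h : j ≤ wordWeight w l) :
    (l.map z).prod ∈ wordSpan F z w j :=
  Submodule.subset_span ⟨l, h, rfl⟩

theorem wordSpan_anti {i j : ℕ} (h : i ≤ j) : wordSpan F z w j ≤ wordSpan F z w i :=
  Submodule.span_mono fun _ ⟨l, hl, e⟩ => ⟨l, h.trans hl, e⟩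

theorem monSpan_anti {i j : ℕ} (h : i ≤ j) : monSpan F z w j ≤ monSpan F z w i :=
  Submodule.span_mono fun _ ⟨l, hl, e⟩ => ⟨l, h.trans hl, e⟩

theorem mem_wordSpan (i : Fin d) : z i ∈ wordSpan F z w (w i) := by
  have := prod_mem_wordSpan (F := F) (z := z) (w := w) (l := [i]) le_rfl
  simpa [wordWeight] using this

theorem one_mem_wordSpan : (1 : A) ∈ wordSpan F z w 0 := by
  simpa using prod_mem_wordSpan (F := F) (z := z) (w := w) (l := []) (Nat.zero_le _)

theorem mul_mem_wordSpan {i j : ℕ} {a b : A} (ha : a ∈ wordSpan F z w i)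
    (hb : b ∈ wordSpan F z w j) : a * b ∈ wordSpan F z w (i + j) := by
  have h : wordSpan F z w i * wordSpan F z w j ≤ wordSpan F z w (i + j) := by
    rw [wordSpan, wordSpan, Submodule.span_mul_span, Submodule.span_le]
    rintro _ ⟨_, ⟨l, hl, rfl⟩, _, ⟨m, hm, rfl⟩, rfl⟩
    have : ((l ++ m).map z).prod ∈ wordSpan F z w (i + j) :=
      prod_mem_wordSpan (by rw [wordWeight_append]; exact add_le_add hl hm)
    simpa using this
  exact h (Submodule.mul_mem_mul ha hb)

theorem pow_mem_wordSpan {j : ℕ} {a : A} (ha : a ∈ wordSpan F z w j) (n : ℕ) :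
    a ^ n ∈ wordSpan F z w (n * j) := by
  induction n with
  | zero => simpa using one_mem_wordSpan
  | succ n ih => rw [pow_succ, Nat.succ_mul]; exact mul_mem_wordSpan ih ha

/-- The word of an exponent. -/
def expWord (x : Fin d → ℕ) : List (Fin d) := (List.ofFn fun i => List.replicate (x i) i).flatten

theorem prod_expWord (x : Fin d → ℕ) : ((expWord x).map z).prod = mon z x := by
  rw [expWord, List.map_flatten, List.prod_flatten, List.map_ofFn, List.map_ofFn, mon]
  congr 2
  ext i
  simp

theorem wordWeight_expWord (x : Fin d → ℕ) : wordWeight w (expWord x) = wt w x := by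
  rw [wordWeight, expWord, List.map_flatten, List.sum_flatten, List.map_ofFn, List.map_ofFn,
    List.sum_ofFn, wt]
  simp

theorem perm_expWord (l : List (Fin d)) : l.Perm (expWord fun i => l.count i) := by
  rw [List.perm_iff_count]
  intro i
  rw [expWord, List.count_flatten, List.map_ofFn, List.sum_ofFn]
  simp [List.count_replicate]

theorem monSpan_le_wordSpan (j : ℕ) : monSpan F z w j ≤ wordSpan F z w j := by
  refine Submodule.span_le.2 ?_
  rintro _ ⟨x, hx, rfl⟩
  rw [← prod_expWord]
  exact prod_mem_wordSpan (by rwa [wordWeight_expWord])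

/-- The commutator relations needed to sort words. -/
def CommRel (F : Type*) [Field F] [Algebra F A] (z : Fin d → A) (w : Fin d → ℕ) : Prop :=
  ∀ i j, z i * z j - z j * z i ∈
    Submodule.span F {a | ∃ l, w l = w i + w j ∧ z l = a} ⊔ wordSpan F z w (w i + w j + 1)

/-- The commutator of the two letters contributes words of the same weight with one letter fewer,
which `h₂` handles, and words of larger weight, which `h₁` handles. -/
theorem swap_mem_monSpan (hc : CommRel F z w) {t r : ℕ}
    (h₁ : wordSpan F z w (t + 1) ≤ monSpan F z w t)
    (h₂ : ∀ l : List (Fin d), wordWeight w l = t → l.length < r →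
      (l.map z).prod ∈ monSpan F z w t)
    (i j : Fin d) (a b : List (Fin d)) (ht : wordWeight w (a ++ i :: j :: b) = t)
    (hr : (a ++ i :: j :: b).length = r) :
    ((a ++ i :: j :: b).map z).prod - ((a ++ j :: i :: b).map z).prod ∈ monSpan F z w t := by
  have e : ((a ++ i :: j :: b).map z).prod - ((a ++ j :: i :: b).map z).prod =
      (a.map z).prod * (z i * z j - z j * z i) * (b.map z).prod := by
    simp only [List.map_append, List.prod_append, List.map_cons, List.prod_cons]
    noncomm_ring
  rw [e]
  simp only [wordWeight_append, wordWeight_cons] at ht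
  simp only [List.length_append, List.length_cons] at hr
  obtain ⟨u, hu, v, hv, huv⟩ := Submodule.mem_sup.1 (hc i j)
  rw [← huv, mul_add, add_mul]
  refine add_mem ?_ ?_
  · clear huv
    induction hu using Submodule.span_induction with
    | mem x hx =>
      obtain ⟨l, hl, rfl⟩ := hx
      have := h₂ (a ++ l :: b) (by simp only [wordWeight_append, wordWeight_cons]; omega)
        (by simp only [List.length_append, List.length_cons]; omega)
      simpa [mul_assoc] using this
    | zero => simp
    | add x y _ _ hx hy => rw [mul_add, add_mul]; exact add_mem hx hy
    | smul c x _ hx => rw [mul_smul_comm, smul_mul_assoc]; exact Submodule.smul_mem _ _ hx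
  · apply h₁
    have := mul_mem_wordSpan (mul_mem_wordSpan
      (prod_mem_wordSpan (F := F) (z := z) (w := w) (l := a) le_rfl) hv)
      (prod_mem_wordSpan (F := F) (z := z) (w := w) (l := b) le_rfl)
    exact wordSpan_anti (by omega) this

/-- A permutation is a chain of adjacent swaps; the prefix `a` collects the letters kept fixed by
the `cons` steps. -/
theorem perm_mem_monSpan (hc : CommRel F z w) {t r : ℕ}
    (h₁ : wordSpan F z w (t + 1) ≤ monSpan F z w t)
    (h₂ : ∀ l : List (Fin d), wordWeight w l = t → l.length < r →
      (l.map z).prod ∈ monSpan F z w t)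
    {l m : List (Fin d)} (h : l.Perm m) :
    ∀ a : List (Fin d), wordWeight w (a ++ l) = t → (a ++ l).length = r →
      ((a ++ l).map z).prod - ((a ++ m).map z).prod ∈ monSpan F z w t := by
  induction h with
  | nil => intro a _ _; simp
  | cons x _ ih =>
    intro a ht hr
    have := ih (a ++ [x]) (by simpa using ht) (by simpa using hr)
    simpa using this
  | swap x y l => intro a ht hr; exact swap_mem_monSpan hc h₁ h₂ y x a l ht hr
  | trans h h' ih ih' =>
    intro a ht hr
    have h3 := ih' a (by rw [← ht]; exact (wordWeight_perm (h.append_left a)).symm)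
      (by rw [← hr]; exact (h.append_left a).length_eq.symm)
    simpa using add_mem (ih a ht hr) h3

/-- Sorting terminates by a double induction: downwards on the weight, starting where all words
vanish, and for fixed weight upwards on the length of the word. -/
theorem wordSpan_eq_monSpan (hc : CommRel F z w) {N : ℕ} (hN : wordSpan F z w N = ⊥) (j : ℕ) :
    wordSpan F z w j = monSpan F z w j := by
  refine le_antisymm ?_ (monSpan_le_wordSpan j)
  by_cases hj : N ≤ j
  · exact (wordSpan_anti hj).trans (by rw [hN]; exact bot_le)
  push Not at hj
  induction hj.le using Nat.decreasingInduction with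
  | self => rw [hN]; exact bot_le
  | of_succ t ht ih =>
    have h₁ : wordSpan F z w (t + 1) ≤ monSpan F z w t := by
      rcases (Nat.succ_le_of_lt ht).eq_or_lt with h | h
      · rw [show t + 1 = N from h, hN]; exact bot_le
      · exact (ih h).trans (monSpan_anti (Nat.le_succ t))
    have h₂ : ∀ r, ∀ l : List (Fin d), wordWeight w l = t → l.length = r →
        (l.map z).prod ∈ monSpan F z w t := by
      intro r
      induction r using Nat.strong_induction_on with
      | _ r ihr =>
        intro l hl hr
        have h3 := perm_mem_monSpan hc h₁ (r := r) (fun l' h h' => ihr _ h' l' h rfl)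
          (perm_expWord l) [] hl hr
        have h4 : mon z (fun i => l.count i) ∈ monSpan F z w t := by
          refine Submodule.subset_span ⟨_, ?_, rfl⟩
          rw [← wordWeight_expWord, ← wordWeight_perm (perm_expWord l), hl]
        rw [List.nil_append, List.nil_append, prod_expWord] at h3
        simpa using add_mem h3 h4
    refine Submodule.span_le.2 ?_
    rintro _ ⟨l, hl, rfl⟩
    rcases hl.eq_or_lt with h | h
    · exact h₂ _ l h.symm rfl
    · exact h₁ (prod_mem_wordSpan h)

theorem mul_sub_one_mem (S : Submodule F A)
    (hS : ∀ a ∈ S, ∀ b ∈ S, a * b ∈ S) {a b : A} (ha : a - 1 ∈ S) (hb : b - 1 ∈ S) :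
    a * b - 1 ∈ S := by
  have : a * b - 1 = (a - 1) * (b - 1) + (a - 1) + (b - 1) := by noncomm_ring
  rw [this]
  exact add_mem (add_mem (hS _ ha _ hb) ha) hb

theorem prod_mem_span_mon {d : ℕ} (z a : Fin d → A)
    (ha : ∀ i, a i ∈ Submodule.span F (Set.range fun n : ℕ => z i ^ n)) :
    (List.ofFn a).prod ∈ Submodule.span F (Set.range (mon z)) := by
  induction d with
  | zero => exact Submodule.subset_span ⟨0, by simp [mon]⟩
  | succ d ih =>
    rw [List.ofFn_succ, List.prod_cons]
    have h1 := Submodule.mul_mem_mul (ha 0) (ih (fun i => z i.succ) (fun i => a i.succ)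
      fun i => ha i.succ)
    rw [Submodule.span_mul_span] at h1
    refine Submodule.span_mono ?_ h1
    rintro _ ⟨_, ⟨n, rfl⟩, _, ⟨x, rfl⟩, rfl⟩
    refine ⟨Fin.cons n x, ?_⟩
    simp [mon, List.ofFn_succ]

theorem mon_mul_last {d : ℕ} (z : Fin d → A) (x : Fin d → ℕ) (i : Fin d)
    (h : ∀ k, i < k → x k = 0) : mon z x * z i = mon z (x + Pi.single i 1) := by
  induction d with
  | zero => exact i.elim0
  | succ d ih =>
    simp only [mon, List.ofFn_succ, List.prod_cons, mul_assoc]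
    induction i using Fin.cases with
    | zero =>
      have : ∀ k : Fin d, x k.succ = 0 := fun k => h _ (Fin.succ_pos k)
      simp [this, pow_succ]
    | succ i =>
      have := ih (fun i => z i.succ) (fun i => x i.succ) i
        (fun k hk => h _ (Fin.succ_lt_succ_iff.2 hk))
      simp only [mon] at this
      rw [this]
      simp [Pi.single_apply, Fin.succ_inj, (Fin.succ_ne_zero i).symm]

theorem mon_eq_zero {z : Fin d → A} {x : Fin d → ℕ} (i : Fin d) (h : z i ^ x i = 0) :
    mon z x = 0 := by
  apply List.prod_eq_zero
  rw [← h]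
  exact List.mem_ofFn.2 ⟨i, rfl⟩

end WeightedWords

/-! ## Nilpotency of the augmentation ideal -/

namespace MonoidAlgebra

variable {p : ℕ} [Fact p.Prime] {F : Type*} [Field F] [CharP F p]
  {Γ : Type*} [Group Γ]

/-- Over F[Γ] a fixed vector generates only its scalar multiples, which are fixed in turn. -/
theorem sub_one_smul_of_mem_span (M : Type*) [AddCommGroup M]
    [Module (MonoidAlgebra F Γ) M] {v : M} (hv : ∀ γ : Γ, of F Γ γ • v = v) (γ : Γ) {m : M}
    (hm : m ∈ Submodule.span (MonoidAlgebra F Γ) {v}) : (of F Γ γ - 1) • m = 0 := by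
  obtain ⟨a, rfl⟩ := Submodule.mem_span_singleton.1 hm
  induction a using MonoidAlgebra.induction_on with
  | of δ => rw [hv, sub_smul, hv, one_smul, sub_self]
  | add a b ha hb =>
    rw [add_smul, smul_add, ha (Submodule.mem_span_singleton.2 ⟨a, rfl⟩),
      hb (Submodule.mem_span_singleton.2 ⟨b, rfl⟩), add_zero]
  | smul c a ha =>
    rw [← mul_smul, mul_smul_comm, ← smul_one_mul c ((of F Γ γ - 1) * a), mul_smul, mul_smul,
      ha (Submodule.mem_span_singleton.2 ⟨a, rfl⟩), smul_zero]

variable [Finite F]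

/-- A p-group acting on a set of order divisible by p with one fixed point, here 0, has another one.
-/
theorem exists_fixed_vector (hΓ : IsPGroup p Γ) (M : Type*) [AddCommGroup M]
    [Module F M] [Module (MonoidAlgebra F Γ) M] [Finite M] [Nontrivial M] :
    ∃ v : M, v ≠ 0 ∧ ∀ γ : Γ, of F Γ γ • v = v := by
  let _ : MulAction Γ M := MulAction.compHom M (of F Γ)
  have hp : p ∣ Nat.card M := by
    have := Module.Finite.of_finite (R := F) (M := M)
    have := Fintype.ofFinite F
    have h := Module.natCard_eq_pow_finrank (K := F) (V := M)
    rw [h, Nat.card_eq_fintype_card]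
    refine dvd_pow ?_ Module.finrank_pos.ne'
    obtain ⟨n, -, hn⟩ := FiniteField.card F p
    rw [hn]
    exact dvd_pow_self p n.ne_zero
  obtain ⟨v, hv, h0⟩ := hΓ.exists_fixed_point_of_prime_dvd_card_of_fixed_point M hp
    (a := 0) (fun γ => smul_zero (of F Γ γ))
  exact ⟨v, h0.symm, fun γ => hv γ⟩

/-- Divide by the submodule generated by a fixed vector: by induction the tail of the product kills
the quotient, and the first factor kills the submodule. -/
theorem exists_prod_smul_eq_zero (hΓ : IsPGroup p Γ) (n : ℕ) :
    ∀ (M : Type*) [AddCommGroup M] [Module F M] [Module (MonoidAlgebra F Γ) M]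
      [IsScalarTower F (MonoidAlgebra F Γ) M] [Finite M],
      Nat.card M ≤ n → ∀ l : List (MonoidAlgebra F Γ), (∀ a ∈ l, ∃ γ, a = of F Γ γ - 1) →
        n ≤ l.length → ∀ m : M, l.prod • m = 0 := by
  induction n with
  | zero =>
    intro M _ _ _ _ _ h
    exact absurd (Nat.card_pos (α := M)) (by omega)
  | succ n ih =>
    intro M _ _ _ _ _ hM l hl hn m
    rcases subsingleton_or_nontrivial M with h | h
    · exact Subsingleton.elim _ _
    obtain ⟨v, h0, hv⟩ := exists_fixed_vector (F := F) hΓ M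
    rcases l with _ | ⟨a, l⟩
    · simp at hn
    obtain ⟨γ, rfl⟩ := hl a (by simp)
    rw [List.prod_cons, mul_smul]
    refine sub_one_smul_of_mem_span M hv γ ?_
    set N := Submodule.span (MonoidAlgebra F Γ) {v} with hN
    have : Finite (M ⧸ N) := Finite.of_surjective _ N.mkQ_surjective
    have hlt : Nat.card (M ⧸ N) < Nat.card M := by
      have h1 := Submodule.card_eq_card_quotient_mul_card N
      have h2 : 1 < Nat.card N := by
        rw [Finite.one_lt_card_iff_nontrivial]
        exact ⟨⟨⟨v, Submodule.mem_span_singleton_self v⟩, 0, fun h => h0 (congrArg Subtype.val h)⟩⟩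
      have h3 : 0 < Nat.card (M ⧸ N) := Nat.card_pos
      rw [h1]
      nlinarith
    have := ih (M ⧸ N) (by omega) l (fun a ha => hl a (List.mem_cons_of_mem _ ha))
      (by simpa using hn) (Submodule.Quotient.mk m)
    rwa [← Submodule.Quotient.mk_smul, Submodule.Quotient.mk_eq_zero] at this

/-- For a finite `p`-group, long products of elements `γ - 1` vanish. -/
theorem exists_prod_eq_zero [Finite Γ] (hΓ : IsPGroup p Γ) :
    ∃ n : ℕ, ∀ l : List (MonoidAlgebra F Γ), (∀ a ∈ l, ∃ γ, a = of F Γ γ - 1) →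
      n ≤ l.length → l.prod = 0 := by
  have : Finite (MonoidAlgebra F Γ) := Module.finite_of_finite F
  refine ⟨Nat.card (MonoidAlgebra F Γ), fun l hl hn => ?_⟩
  have := exists_prod_smul_eq_zero hΓ _ (MonoidAlgebra F Γ) le_rfl l hl hn 1
  simpa using this

end MonoidAlgebra

/-! ## Groups with an ordered basis -/

open WeightedWords
open scoped commutatorElement

/-- The data on a filtered group with ordered basis `g` that determine its completed group ring:
`N m` are normal subgroups, every class modulo `N m` is `∏ g_i ^ x_i` for unique `x_i < p ^ m`, and
the commutators of the `g_i` respect the weights `w_i ∈ {1, 2}`. -/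
structure IsOrderedBasis (p : ℕ) {G : Type*} [Group G] {d : ℕ} (g : Fin d → G) (w : Fin d → ℕ)
    (N : ℕ → Subgroup G) : Prop where
  anti : Antitone N
  weight : ∀ i, w i = 1 ∨ w i = 2
  existsUnique : ∀ m u, ∃! x : Fin d → ℕ, (∀ i, x i < p ^ m) ∧ (mon g x)⁻¹ * u ∈ N m
  pow_mem : ∀ m i, g i ^ p ^ m ∈ N m
  comm_mem : ∀ i j, w i + w j ≠ 2 → ⁅g i, g j⁆ ∈ N 1
  comm_eq : ∀ i j, w i + w j = 2 →
    ∃ t : Fin d → ℕ, (∀ l, t l ≠ 0 → w l = 2) ∧ (mon g t)⁻¹ * ⁅g i, g j⁆ ∈ N 1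
  gen : ∀ l, w l = 2 → ∃ u v : G, ⁅u, v⁆⁻¹ * g l ∈ N 1

namespace WeightedWords

theorem mon_map {A B : Type*} [Monoid A] [Monoid B] {d : ℕ} (φ : A →* B) (g : Fin d → A)
    (x : Fin d → ℕ) : φ (mon g x) = mon (fun i => φ (g i)) x := by
  rw [mon, mon, map_list_prod, List.map_ofFn]
  congr 2
  ext i
  simp

theorem mon_zero {A : Type*} [Monoid A] {d : ℕ} (g : Fin d → A) : mon g 0 = 1 := by
  simp [mon]

theorem list_prod_sub_one_mem {F A : Type*} [Field F] [Ring A] [Algebra F A] (S : Submodule F A)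
    (hS : ∀ a ∈ S, ∀ b ∈ S, a * b ∈ S) (l : List A) (h : ∀ a ∈ l, a - 1 ∈ S) :
    l.prod - 1 ∈ S := by
  induction l with
  | nil => simp
  | cons a l ih =>
    rw [List.prod_cons]
    exact mul_sub_one_mem S hS (h a (by simp)) (ih fun b hb => h b (by simp [hb]))

theorem mon_sub_one_mem {F A : Type*} [Field F] [Ring A] [Algebra F A] (S : Submodule F A)
    (hS : ∀ a ∈ S, ∀ b ∈ S, a * b ∈ S) {d : ℕ} (g : Fin d → A) (x : Fin d → ℕ)
    (h : ∀ i, x i ≠ 0 → g i - 1 ∈ S) : mon g x - 1 ∈ S := by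
  apply list_prod_sub_one_mem S hS
  intro a ha
  obtain ⟨i, rfl⟩ := List.mem_ofFn.1 ha
  by_cases hi : x i = 0
  · simp [hi]
  · have := list_prod_sub_one_mem S hS (List.replicate (x i) (g i)) (fun b hb => by
      rw [List.eq_of_mem_replicate hb]; exact h i hi)
    simpa using this

end WeightedWords

/-! ### Commutation relations between the augmentation generators -/

namespace IsOrderedBasis

variable {p : ℕ} [Fact p.Prime] {G : Type*} [Group G] {d : ℕ} {g : Fin d → G} {w : Fin d → ℕ}
  {N : ℕ → Subgroup G} [hnorm : ∀ m, (N m).Normal] (hB : IsOrderedBasis p g w N)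
  {F : Type*} [Field F]
  {A : Type*} [Ring A] [Algebra F A] [CharP A p]

include hB

omit [Fact p.Prime] hnorm in
theorem exists_mk_eq (m : ℕ) (u : G) :
    ∃ x : Fin d → ℕ, (∀ i, x i < p ^ m) ∧ (mon g x)⁻¹ * u ∈ N m :=
  (hB.existsUnique m u).exists

omit [Fact p.Prime] in
theorem mk_mon_mod (m : ℕ) (x : Fin d → ℕ) :
    (QuotientGroup.mk (mon g x) : G ⧸ N m) = QuotientGroup.mk (mon g fun i => x i % p ^ m) := by
  have h (y : Fin d → ℕ) := mon_map (QuotientGroup.mk' (N m)) g y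
  simp only [QuotientGroup.mk'_apply] at h
  rw [h, h, mon, mon]
  congr 2
  ext i
  have h1 : (QuotientGroup.mk (g i) : G ⧸ N m) ^ p ^ m = 1 := by
    rw [← QuotientGroup.mk_pow]
    exact (QuotientGroup.eq_one_iff _).2 (hB.pow_mem m i)
  conv_lhs => rw [← Nat.div_add_mod (x i) (p ^ m), pow_add, pow_mul, h1, one_pow, one_mul]

/-- The exponents reduced modulo p^m and the zero exponents both represent the trivial class, so
uniqueness makes them equal. -/
theorem dvd_of_mon_mem {m : ℕ} {x : Fin d → ℕ} (h : mon g x ∈ N m) (i : Fin d) : p ^ m ∣ x i := by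
  have hp : 0 < p ^ m := pow_pos (Fact.out : p.Prime).pos m
  have h1 := (hB.existsUnique m 1).unique (y₁ := fun i => x i % p ^ m) (y₂ := 0)
    ⟨fun i => Nat.mod_lt _ hp, ?_⟩ ⟨fun i => hp, by simp [mon_zero, (N m).one_mem]⟩
  · exact Nat.dvd_of_mod_eq_zero (congrFun h1 i)
  · rw [← QuotientGroup.eq, ← hB.mk_mon_mod, QuotientGroup.eq]
    simpa using h

variable {m : ℕ} (φ : G →* A) (hφ : ∀ u ∈ N m, φ u = 1)

include hφ

omit hnorm in
theorem pow_eq_zero (i : Fin d) : (φ (g i) - 1) ^ p ^ m = 0 := by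
  rw [sub_pow_char_pow_of_commute _ _ (Commute.one_right _), one_pow, ← map_pow,
    hφ _ (hB.pow_mem m i), sub_self]

omit [CharP A p] in
theorem map_eq_mon (u : G) :
    ∃ x : Fin d → ℕ, (∀ i, x i < p ^ m) ∧ φ u = φ (mon g x) := by
  obtain ⟨x, hx, h⟩ := hB.exists_mk_eq m u
  refine ⟨x, hx, ?_⟩
  have := hφ _ h
  rw [← mul_inv_cancel_left (mon g x) u, map_mul, this, mul_one]

/-- Up to N m, such a u is a product of powers of the g_i^p, and in characteristic p each g_i^p - 1
= (g_i - 1)^p has weight at least p. -/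
theorem map_sub_one_mem {u : G} (hu : u ∈ N 1) :
    φ u - 1 ∈ wordSpan F (fun i => φ (g i) - 1) w p := by
  have hp := (Fact.out : p.Prime).one_lt
  obtain ⟨x, hx, h⟩ := hB.exists_mk_eq m u
  -- For m = 0 the inclusion N m ≤ N 1 is not available, but then x = 0 and u itself lies in the
  -- subgroup where φ is trivial.
  rcases Nat.eq_zero_or_pos m with rfl | hm
  · have hx0 : x = 0 := by ext i; simpa using hx i
    rw [hx0, mon_zero, inv_one, one_mul] at h
    rw [hφ u h, sub_self]
    exact zero_mem _
  have h1 := hB.anti hm h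
  have h2 : mon g x ∈ N 1 := by
    have := mul_mem hu (inv_mem h1)
    simpa [mul_inv_rev, ← mul_assoc] using this
  have h3 := hB.dvd_of_mon_mem h2
  have h4 : φ u = mon (fun i => φ (g i) ^ p) (fun i => x i / p) := by
    have := hφ _ h
    rw [← mul_inv_cancel_left (mon g x) u, map_mul, this, mul_one, mon_map, mon, mon]
    congr 2
    ext i
    rw [← pow_mul, Nat.mul_div_cancel' (by simpa using h3 i)]
  rw [h4]
  refine mon_sub_one_mem _ (fun a ha b hb => wordSpan_anti (Nat.le_add_left _ _)
    (mul_mem_wordSpan ha hb)) _ _ fun i _ => ?_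
  have h5 := sub_pow_char_of_commute p (Commute.one_right (φ (g i)))
  rw [one_pow] at h5
  rw [← h5]
  refine wordSpan_anti ?_ (pow_mem_wordSpan (mem_wordSpan i) p)
  rcases hB.weight i with h | h <;> rw [h] <;> omega

/-- Modulo N 1 the commutator of two generators is trivial or a product of generators of weight two,
and an element of N 1 contributes weight at least p. A prime p > 3 is at least 5, which exceeds w_i
+ w_j ≤ 4. -/
theorem commRel (hp : 3 < p) : CommRel F (fun i => φ (g i) - 1) w := by
  have hp5 : 5 ≤ p := by
    rcases (show p = 4 ∨ 5 ≤ p by omega) with h | h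
    · exact absurd (Fact.out : p.Prime) (by rw [h]; decide)
    · exact h
  intro i j
  set z : Fin d → A := fun i => φ (g i) - 1 with hz
  set S : Submodule F A := Submodule.span F {a | ∃ l, w l = w i + w j ∧ z l = a} ⊔
    wordSpan F z w (w i + w j + 1) with hS
  have hS1 : S ≤ wordSpan F z w (w i + w j) := by
    refine sup_le (Submodule.span_le.2 ?_) (wordSpan_anti (Nat.le_succ _))
    rintro _ ⟨l, hl, rfl⟩
    rw [← hl]
    exact mem_wordSpan l
  have hi := hB.weight i
  have hj := hB.weight j
  have hc : φ ⁅g i, g j⁆ - 1 ∈ S := by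
    by_cases h : w i + w j = 2
    · obtain ⟨t, ht, h1⟩ := hB.comm_eq i j h
      -- `S` is closed under products because these have weight at least 2(w_i + w_j), more than w_i
      -- + w_j.
      have hS2 : ∀ a ∈ S, ∀ b ∈ S, a * b ∈ S := fun a ha b hb =>
        le_sup_right (a := Submodule.span F {a | ∃ l, w l = w i + w j ∧ z l = a})
          (wordSpan_anti (by omega) (mul_mem_wordSpan (hS1 ha) (hS1 hb)))
      rw [← mul_inv_cancel_left (mon g t) ⁅g i, g j⁆, map_mul]
      refine mul_sub_one_mem S hS2 ?_ ?_
      · rw [mon_map]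
        refine mon_sub_one_mem S hS2 _ _ fun l hl => ?_
        exact le_sup_left (b := wordSpan F z w (w i + w j + 1))
          (Submodule.subset_span ⟨l, by rw [ht l hl, h], rfl⟩)
      · exact le_sup_right (a := Submodule.span F {a | ∃ l, w l = w i + w j ∧ z l = a})
          (wordSpan_anti (by omega) (hB.map_sub_one_mem φ hφ h1))
    · exact le_sup_right (a := Submodule.span F {a | ∃ l, w l = w i + w j ∧ z l = a})
        (wordSpan_anti (by omega) (hB.map_sub_one_mem φ hφ (hB.comm_mem i j h)))
  -- With c = ⁅g_i, g_j⁆ this is (c - 1) g_j g_i, where g_j g_i - 1 has positive weight, so only c -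
  -- 1 matters in leading weight.
  have e : z i * z j - z j * z i = (φ ⁅g i, g j⁆ - 1) +
      (φ ⁅g i, g j⁆ - 1) * (z j * z i + z j + z i) := by
    have h1 : φ (g i) * φ (g j) = φ ⁅g i, g j⁆ * (φ (g j) * φ (g i)) := by
      rw [← map_mul, ← map_mul, ← map_mul]
      congr 1
      simp [commutatorElement_def, mul_assoc]
    have h2 : z j * z i + z j + z i = φ (g j) * φ (g i) - 1 := by
      simp only [hz]; noncomm_ring
    have h3 : z i * z j - z j * z i = φ (g i) * φ (g j) - φ (g j) * φ (g i) := by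
      simp only [hz]; noncomm_ring
    rw [h2, h3, h1]
    noncomm_ring
  rw [e]
  refine add_mem hc ?_
  refine le_sup_right (a := Submodule.span F {a | ∃ l, w l = w i + w j ∧ z l = a}) ?_
  refine mul_mem_wordSpan (hS1 hc) (add_mem (add_mem ?_ ?_) ?_)
  · exact wordSpan_anti (by omega) (mul_mem_wordSpan (mem_wordSpan j) (mem_wordSpan i))
  · exact wordSpan_anti (by omega) (mem_wordSpan j)
  · exact wordSpan_anti (by omega) (mem_wordSpan i)

end IsOrderedBasis

/-! ### Ordered monomial bases of the group rings of the finite quotients -/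

theorem MonoidAlgebra.charP_of_field (p : ℕ) (F : Type*) [Field F] [CharP F p]
    (Γ : Type*) [Group Γ] : CharP (MonoidAlgebra F Γ) p :=
  charP_of_injective_algebraMap (algebraMap F _).injective p

namespace IsOrderedBasis

/-- The exponents with all entries less than `n`. -/
def box (d n : ℕ) : Finset (Fin d → ℕ) := Fintype.piFinset fun _ => Finset.range n

theorem mem_box {d n : ℕ} {x : Fin d → ℕ} : x ∈ box d n ↔ ∀ i, x i < n := by
  simp [box, Fintype.mem_piFinset]

theorem card_box (d n : ℕ) : (box d n).card = n ^ d := by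
  simp [box]

/-- The element `g_i - 1` of the group ring of `G ⧸ N`. -/
def quotGen (F : Type*) [Field F] {G : Type*} [Group G] {d : ℕ} (g : Fin d → G) (N : Subgroup G)
    [N.Normal] (i : Fin d) : MonoidAlgebra F (G ⧸ N) :=
  (MonoidAlgebra.of F (G ⧸ N)).comp (QuotientGroup.mk' N) (g i) - 1

variable {p : ℕ} [Fact p.Prime] {G : Type*} [Group G] {d : ℕ} {g : Fin d → G} {w : Fin d → ℕ}
  {N : ℕ → Subgroup G} [hnorm : ∀ m, (N m).Normal] (hB : IsOrderedBasis p g w N)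
  (F : Type*) [Field F]

theorem of_comp_mk_eq_one {m : ℕ} (u : G) (hu : u ∈ N m) :
    (MonoidAlgebra.of F (G ⧸ N m)).comp (QuotientGroup.mk' (N m)) u = 1 := by
  have : QuotientGroup.mk' (N m) u = 1 := (QuotientGroup.eq_one_iff u).2 hu
  rw [MonoidHom.comp_apply, this, map_one]

variable (m : ℕ)

include hB

theorem card_quotient : Nat.card (G ⧸ N m) = (p ^ m) ^ d := by
  rw [← card_box, ← Fintype.card_coe, ← Nat.card_eq_fintype_card]
  refine (Nat.card_congr (Equiv.ofBijective
    (fun x : box d (p ^ m) => (QuotientGroup.mk (mon g x.1) : G ⧸ N m)) ⟨?_, ?_⟩)).symm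
  · intro x y h
    apply Subtype.ext
    refine (hB.existsUnique m (mon g y.1)).unique ⟨mem_box.1 x.2, QuotientGroup.eq.1 h⟩
      ⟨mem_box.1 y.2, QuotientGroup.eq.1 rfl⟩
  · intro u
    obtain ⟨u, rfl⟩ := QuotientGroup.mk_surjective u
    obtain ⟨x, hx, h⟩ := hB.exists_mk_eq m u
    exact ⟨⟨x, mem_box.2 hx⟩, QuotientGroup.eq.2 h⟩

theorem finite_quotient : Finite (G ⧸ N m) := by
  apply Nat.finite_of_card_ne_zero
  rw [hB.card_quotient]
  exact (pow_pos (pow_pos (Fact.out : p.Prime).pos _) _).ne'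

theorem isPGroup_quotient : IsPGroup p (G ⧸ N m) :=
  IsPGroup.of_card (n := m * d) (by rw [hB.card_quotient, pow_mul])

/-- Expand each (1 + z_i)^{x_i} by the binomial theorem; monomials outside the box vanish. -/
theorem map_mem_span_box {A : Type*} [Ring A] [Algebra F A] [CharP A p] {m : ℕ} (φ : G →* A)
    (hφ : ∀ u ∈ N m, φ u = 1) (u : G) :
    φ u ∈ Submodule.span F
      (Set.range fun x : box d (p ^ m) => mon (fun i => φ (g i) - 1) x.1) := by
  obtain ⟨x, -, hx⟩ := hB.map_eq_mon φ hφ u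
  have h1 := prod_mem_span_mon (F := F) (fun i => φ (g i) - 1) (fun i => φ (g i) ^ x i) (by
    intro i
    have : φ (g i) ^ x i = ((φ (g i) - 1) + 1) ^ x i := by rw [sub_add_cancel]
    rw [this, (Commute.one_right _).add_pow]
    refine sum_mem fun k _ => ?_
    rw [one_pow, mul_one, ← Nat.cast_comm, ← nsmul_eq_mul]
    exact nsmul_mem (Submodule.subset_span (Set.mem_range_self (f := fun n : ℕ =>
      (φ (g i) - 1) ^ n) k)) _)
  rw [hx, mon_map]
  refine Submodule.span_le.2 ?_ h1
  rintro _ ⟨y, rfl⟩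
  by_cases hy : y ∈ box d (p ^ m)
  · exact Submodule.subset_span ⟨⟨y, hy⟩, rfl⟩
  · rw [mem_box] at hy
    push Not at hy
    obtain ⟨i, hi⟩ := hy
    rw [mon_eq_zero i (pow_eq_zero_of_le hi (hB.pow_eq_zero φ hφ i))]
    exact zero_mem _

variable [CharP F p]

theorem quotGen_pow (i : Fin d) : quotGen F g (N m) i ^ p ^ m = 0 := by
  have := MonoidAlgebra.charP_of_field p F (G ⧸ N m)
  exact hB.pow_eq_zero _ (of_comp_mk_eq_one F) i

theorem mon_quotGen_eq_zero {x : Fin d → ℕ} (hx : x ∉ box d (p ^ m)) :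
    mon (quotGen F g (N m)) x = 0 := by
  rw [mem_box] at hx
  push Not at hx
  obtain ⟨i, hi⟩ := hx
  exact mon_eq_zero i (pow_eq_zero_of_le hi (hB.quotGen_pow F m i))

theorem span_box_eq_top :
    ⊤ ≤ Submodule.span F (Set.range fun x : box d (p ^ m) => mon (quotGen F g (N m)) x.1) := by
  have := MonoidAlgebra.charP_of_field p F (G ⧸ N m)
  intro a _
  induction a using MonoidAlgebra.induction_on with
  | of γ =>
    obtain ⟨u, rfl⟩ := QuotientGroup.mk_surjective γ
    exact hB.map_mem_span_box F _ (of_comp_mk_eq_one F) u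
  | add a b ha hb => exact add_mem (ha trivial) (hb trivial)
  | smul c a ha => exact Submodule.smul_mem _ _ (ha trivial)

/-- The basis of ordered monomials of the group ring of `G ⧸ N m`. -/
def monBasis : Module.Basis (box d (p ^ m)) F (MonoidAlgebra F (G ⧸ N m)) :=
  -- The box has p^(md) elements, as many as G/N m, so the spanning family is a basis.
  basisOfTopLeSpanOfCardEqFinrank (fun x : box d (p ^ m) => mon (quotGen F g (N m)) x.1)
    (hB.span_box_eq_top F m) (by
      rw [Module.finrank_eq_nat_card_basis (MonoidAlgebra.basis (G ⧸ N m) F), hB.card_quotient,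
        Fintype.card_coe, card_box])

@[simp] theorem monBasis_apply (x : box d (p ^ m)) :
    hB.monBasis F m x = mon (quotGen F g (N m)) x.1 := by
  simp [monBasis]

theorem exists_wordSpan_eq_bot [Finite F] :
    ∃ n, wordSpan F (quotGen F g (N m)) w n = ⊥ := by
  have := hB.finite_quotient m
  obtain ⟨n, hn⟩ := MonoidAlgebra.exists_prod_eq_zero (F := F) (hB.isPGroup_quotient m)
  -- Letters have weight at most 2, so weight 2n forces length n.
  refine ⟨2 * n, ?_⟩
  rw [eq_bot_iff]
  refine Submodule.span_le.2 ?_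
  rintro _ ⟨l, hl, rfl⟩
  refine hn _ ?_ ?_
  · intro a ha
    obtain ⟨i, -, rfl⟩ := List.mem_map.1 ha
    exact ⟨QuotientGroup.mk (g i), rfl⟩
  · rw [List.length_map]
    have h1 : wordWeight w l ≤ 2 * l.length := by
      rw [wordWeight, ← List.length_map (as := l) w, mul_comm, ← smul_eq_mul]
      refine List.sum_le_card_nsmul _ _ fun a ha => ?_
      obtain ⟨i, -, rfl⟩ := List.mem_map.1 ha
      rcases hB.weight i with h | h <;> omega
    omega

variable [Finite F] (hp : 3 < p)

include hp

theorem wordSpan_quotGen (j : ℕ) :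
    wordSpan F (quotGen F g (N m)) w j = monSpan F (quotGen F g (N m)) w j := by
  have := MonoidAlgebra.charP_of_field p F (G ⧸ N m)
  obtain ⟨n, hn⟩ := hB.exists_wordSpan_eq_bot F m
  exact wordSpan_eq_monSpan (hB.commRel _ (of_comp_mk_eq_one F) hp) hn j

/-- Multiplicativity is immediate for words by concatenation; the sorting theorem carries it over to
ordered monomials. -/
theorem mul_mem_monSpan {i j : ℕ} {a b : MonoidAlgebra F (G ⧸ N m)}
    (ha : a ∈ monSpan F (quotGen F g (N m)) w i) (hb : b ∈ monSpan F (quotGen F g (N m)) w j) :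
    a * b ∈ monSpan F (quotGen F g (N m)) w (i + j) := by
  rw [← hB.wordSpan_quotGen F m hp] at *
  exact mul_mem_wordSpan ha hb

theorem isNilpotent_of_mem_monSpan {a : MonoidAlgebra F (G ⧸ N m)}
    (ha : a ∈ monSpan F (quotGen F g (N m)) w 1) : IsNilpotent a := by
  rw [← hB.wordSpan_quotGen F m hp] at ha
  obtain ⟨n, hn⟩ := hB.exists_wordSpan_eq_bot F m
  refine ⟨n, ?_⟩
  have := pow_mem_wordSpan ha n
  rwa [mul_one, hn] at this

theorem of_sub_one_mem {u : G} (hu : u ∈ N 1) :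
    (MonoidAlgebra.of F (G ⧸ N m)).comp (QuotientGroup.mk' (N m)) u - 1 ∈
      monSpan F (quotGen F g (N m)) w p := by
  have := MonoidAlgebra.charP_of_field p F (G ⧸ N m)
  rw [← hB.wordSpan_quotGen F m hp]
  exact hB.map_sub_one_mem _ (of_comp_mk_eq_one F) hu

end IsOrderedBasis

/-! ### Projections and convergence in the completed group ring -/

namespace CompletedGroupRing

variable {F : Type*} [Field F] {G : Type*} [Group G] [TopologicalSpace G]

/-- The projection `F⟦G⟧ → F[G/M]`. -/
def proj (M : OpenNormalSubgroup G) :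
    CompletedGroupRing F G →ₐ[F] MonoidAlgebra F (G ⧸ (M : Subgroup G)) :=
  (Pi.evalAlgHom F (fun N : OpenNormalSubgroup G => MonoidAlgebra F (G ⧸ (N : Subgroup G))) M).comp
    (completedGroupSubalgebra F G).val

/-- The projection `F[G/N] → F[G/M]` for `N ≤ M`. -/
def trans (F : Type*) [Field F] {N M : Subgroup G} [N.Normal] [M.Normal] (h : N ≤ M) :
    MonoidAlgebra F (G ⧸ N) →ₐ[F] MonoidAlgebra F (G ⧸ M) :=
  MonoidAlgebra.mapDomainAlgHom F F (QuotientGroup.map N M (MonoidHom.id G) h)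

theorem trans_proj {N M : OpenNormalSubgroup G} (h : (N : Subgroup G) ≤ M)
    (y : CompletedGroupRing F G) : trans F h (proj N y) = proj M y :=
  y.2 N M h

theorem proj_of (M : OpenNormalSubgroup G) (g : G) :
    proj M (of F g) = (MonoidAlgebra.of F _).comp (QuotientGroup.mk' (M : Subgroup G)) g :=
  rfl

theorem ext_proj {y y' : CompletedGroupRing F G} (h : ∀ M, proj M y = proj M y') : y = y' :=
  Subtype.ext (funext h)

omit [TopologicalSpace G] in
theorem trans_of {N M : Subgroup G} [N.Normal] [M.Normal] (h : N ≤ M) (g : G) :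
    trans F h ((MonoidAlgebra.of F _).comp (QuotientGroup.mk' N) g) =
      (MonoidAlgebra.of F _).comp (QuotientGroup.mk' M) g := by
  simp [trans, MonoidAlgebra.of_apply]
  rfl

/-- The element of `F⟦G⟧` with given compatible projections. -/
def ofCompatible (f : ∀ M : OpenNormalSubgroup G, MonoidAlgebra F (G ⧸ (M : Subgroup G)))
    (hf : ∀ (N M : OpenNormalSubgroup G) (h : (N : Subgroup G) ≤ M), trans F h (f N) = f M) :
    CompletedGroupRing F G :=
  ⟨f, hf⟩

@[simp] theorem proj_ofCompatible
    (f : ∀ M : OpenNormalSubgroup G, MonoidAlgebra F (G ⧸ (M : Subgroup G)))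
    (hf : ∀ (N M : OpenNormalSubgroup G) (h : (N : Subgroup G) ≤ M), trans F h (f N) = f M)
    (M : OpenNormalSubgroup G) : proj M (ofCompatible f hf) = f M :=
  rfl

theorem trans_trans {N M L : Subgroup G} [N.Normal] [M.Normal] [L.Normal] (h : N ≤ M) (h' : M ≤ L)
    (a : MonoidAlgebra F (G ⧸ N)) : trans F h' (trans F h a) = trans F (h.trans h') a := by
  induction a using MonoidAlgebra.induction_on with
  | of γ =>
    obtain ⟨u, rfl⟩ := QuotientGroup.mk_surjective γ
    have h1 := trans_of (F := F) h u
    have h2 := trans_of (F := F) h' u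
    have h3 := trans_of (F := F) (h.trans h') u
    simp only [MonoidHom.comp_apply, QuotientGroup.mk'_apply] at h1 h2 h3
    rw [h1, h2, h3]
  | add a b ha hb => simp only [map_add, ha, hb]
  | smul c a ha => simp only [map_smul, ha]

theorem nhds_eq (y : CompletedGroupRing F G) :
    nhds y = ⨅ M : OpenNormalSubgroup G, Filter.comap (proj M) (pure (proj M y)) := by
  rw [nhds_iInf]
  refine iInf_congr fun M => ?_
  rw [@nhds_induced _ _ ⊥]
  congr 1
  exact @nhds_discrete _ ⊥ (@DiscreteTopology.mk _ ⊥ rfl) ▸ rfl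

/-- The finite levels are discrete, so convergence means that in each of them the finite partial
sums are eventually constant. -/
theorem hasSum_iff {ι : Type*} (f : ι → CompletedGroupRing F G) (y : CompletedGroupRing F G) :
    HasSum f y ↔ ∀ M, ∃ s : Finset ι, ∀ t, s ⊆ t → ∑ b ∈ t, proj M (f b) = proj M y := by
  rw [HasSum, SummationFilter.unconditional_filter, nhds_eq, Filter.tendsto_iInf]
  refine forall_congr' fun M => ?_
  rw [Filter.tendsto_comap_iff, Filter.tendsto_pure, Filter.eventually_atTop]
  simp only [Function.comp_apply, map_sum]

variable {d : ℕ}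

theorem proj_monomial (g : Fin d → G) (M : OpenNormalSubgroup G) (x : Fin d → ℕ) :
    proj M (monomial F g x) = mon (IsOrderedBasis.quotGen F g (M : Subgroup G)) x := by
  change proj M (mon (fun i => of F (g i) - 1) x) = _
  have := mon_map (MonoidHomClass.toMonoidHom (proj (F := F) M)) (fun i => of F (g i) - 1) x
  refine this.trans ?_
  congr 1

theorem trans_mon (g : Fin d → G) {N M : Subgroup G} [N.Normal] [M.Normal] (h : N ≤ M)
    (x : Fin d → ℕ) : trans F h (mon (IsOrderedBasis.quotGen F g N) x) =
      mon (IsOrderedBasis.quotGen F g M) x := by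
  have := mon_map (MonoidHomClass.toMonoidHom (trans F h)) (IsOrderedBasis.quotGen F g N) x
  refine this.trans ?_
  congr 1
  ext1 i
  change trans F h (IsOrderedBasis.quotGen F g N i) = _
  rw [IsOrderedBasis.quotGen, map_sub, trans_of, map_one]
  rfl

end CompletedGroupRing

/-! ### Existence and uniqueness of expansions -/

namespace IsOrderedBasis

open CompletedGroupRing

variable {p : ℕ} [Fact p.Prime] {G : Type*} [Group G] [TopologicalSpace G] {d : ℕ} {g : Fin d → G}
  {w : Fin d → ℕ} {N : ℕ → OpenNormalSubgroup G}
  (hB : IsOrderedBasis p g w fun m => (N m : Subgroup G))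
  (hN : ∀ V : OpenNormalSubgroup G, ∃ m, (N m : Subgroup G) ≤ V)
  {F : Type*} [Field F]

/-- The partial sum of `∑ c_x z^x` in `F[G/N]` over the exponents less than `n`. -/
def partialSum (g : Fin d → G) (N : Subgroup G) [N.Normal] (n : ℕ) (c : (Fin d → ℕ) → F) :
    MonoidAlgebra F (G ⧸ N) :=
  ∑ x ∈ box d n, c x • mon (quotGen F g N) x

variable [CharP F p]

include hB in
theorem sum_eq_partialSum (m : ℕ) (c : (Fin d → ℕ) → F) {t : Finset (Fin d → ℕ)}
    (ht : box d (p ^ m) ⊆ t) :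
    ∑ x ∈ t, c x • mon (quotGen F g (N m : Subgroup G)) x =
      partialSum g (N m : Subgroup G) (p ^ m) c := by
  refine (Finset.sum_subset ht fun x _ hx => ?_).symm
  rw [hB.mon_quotGen_eq_zero F m hx, smul_zero]

include hB in
theorem trans_partialSum {m m' : ℕ} (h : m ≤ m') (c : (Fin d → ℕ) → F) :
    trans F (hB.anti h) (partialSum g (N m' : Subgroup G) (p ^ m') c) =
      partialSum g (N m : Subgroup G) (p ^ m) c := by
  rw [← hB.sum_eq_partialSum m c (t := box d (p ^ m')), partialSum, map_sum]
  · refine Finset.sum_congr rfl fun x _ => ?_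
    rw [map_smul, trans_mon]
  · intro x hx
    rw [mem_box] at *
    exact fun i => (hx i).trans_le (Nat.pow_le_pow_right (Fact.out : p.Prime).pos h)

include hB hN in
-- All monomials outside a finite box vanish in F[G/N m], so the infinite sum becomes finite there,
-- and these levels are cofinal by `hN`.
theorem isExpansion_iff {c : (Fin d → ℕ) → F} {y : CompletedGroupRing F G} :
    IsExpansion g c y ↔
      ∀ m, proj (N m) y = partialSum g (N m : Subgroup G) (p ^ m) c := by
  rw [IsExpansion, hasSum_iff]
  simp only [map_smul, proj_monomial]
  constructor
  · intro h m
    obtain ⟨s, hs⟩ := h (N m)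
    rw [← hs (s ∪ box d (p ^ m)) Finset.subset_union_left,
      hB.sum_eq_partialSum m c Finset.subset_union_right]
  · intro h V
    obtain ⟨m, hm⟩ := hN V
    refine ⟨box d (p ^ m), fun t ht => ?_⟩
    rw [← trans_proj hm, h m, ← hB.sum_eq_partialSum m c ht, map_sum]
    refine Finset.sum_congr rfl fun x _ => ?_
    rw [map_smul, trans_mon]

include hB hN in
theorem exists_isExpansion (c : (Fin d → ℕ) → F) :
    ∃ y : CompletedGroupRing F G, IsExpansion g c y := by
  choose k hk using hN
  have key : ∀ (V : OpenNormalSubgroup G) (m m' : ℕ) (h : (N m : Subgroup G) ≤ V)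
      (h' : (N m' : Subgroup G) ≤ V), trans F h (partialSum g _ (p ^ m) c) =
        trans F h' (partialSum g _ (p ^ m') c) := by
    intro V m m' h h'
    rw [← hB.trans_partialSum (le_max_left m m') c, ← hB.trans_partialSum (le_max_right m m') c,
      trans_trans, trans_trans]
  refine ⟨ofCompatible (fun V => trans F (hk V) (partialSum g _ (p ^ k V) c)) ?_, ?_⟩
  · intro V V' h
    exact (trans_trans (hk V) h _).trans (key V' _ _ _ _)
  · rw [hB.isExpansion_iff (fun V => ⟨k V, hk V⟩)]
    intro m
    rw [proj_ofCompatible]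
    refine (key (N m) (k (N m)) m _ le_rfl).trans ?_
    exact hB.trans_partialSum le_rfl c

/-- The coordinates of an element of `F[G/N m]` in the basis of ordered monomials. -/
def coord (m : ℕ) (a : MonoidAlgebra F (G ⧸ (N m : Subgroup G))) (x : Fin d → ℕ) : F :=
  if h : x ∈ box d (p ^ m) then (hB.monBasis F m).repr a ⟨x, h⟩ else 0

theorem partialSum_eq_sum (m : ℕ) (c : (Fin d → ℕ) → F) :
    partialSum g (N m : Subgroup G) (p ^ m) c =
      ∑ x : box d (p ^ m), c x.1 • hB.monBasis F m x := by
  rw [partialSum, ← Finset.sum_coe_sort]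
  simp only [monBasis_apply]

theorem coord_partialSum (m : ℕ) (c : (Fin d → ℕ) → F) {x : Fin d → ℕ} (hx : x ∈ box d (p ^ m)) :
    hB.coord m (partialSum g (N m : Subgroup G) (p ^ m) c) x = c x := by
  rw [coord, dif_pos hx, hB.partialSum_eq_sum, Module.Basis.repr_sum_self]

theorem partialSum_coord (m : ℕ) (a : MonoidAlgebra F (G ⧸ (N m : Subgroup G))) :
    partialSum g (N m : Subgroup G) (p ^ m) (hB.coord m a) = a := by
  rw [hB.partialSum_eq_sum]
  conv_rhs => rw [← (hB.monBasis F m).sum_repr a]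
  refine Finset.sum_congr rfl fun x _ => ?_
  rw [coord, dif_pos x.2]

theorem coord_trans {m m' : ℕ} (h : m ≤ m') (a : MonoidAlgebra F (G ⧸ (N m' : Subgroup G)))
    {x : Fin d → ℕ} (hx : x ∈ box d (p ^ m)) :
    hB.coord m (trans F (hB.anti h) a) x = hB.coord m' a x := by
  conv_lhs => rw [← hB.partialSum_coord m' a, hB.trans_partialSum h]
  exact hB.coord_partialSum m _ hx

theorem exists_mem_box (x : Fin d → ℕ) : x ∈ box d (p ^ ∑ i, x i) := by
  rw [mem_box]
  intro i
  refine lt_of_le_of_lt ?_ (Nat.lt_pow_self (Fact.out : p.Prime).one_lt)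
  exact Finset.single_le_sum (f := x) (fun _ _ => Nat.zero_le _) (Finset.mem_univ i)

include hB hN in
/-- Unique expansion of the elements of `F⟦G⟧`. -/
theorem existsUnique_isExpansion (y : CompletedGroupRing F G) :
    ∃! c : (Fin d → ℕ) → F, IsExpansion g c y := by
  simp only [hB.isExpansion_iff hN]
  -- The coefficient at x is read off at level ∑ x_i, where x already lies in the box; by
  -- `coord_trans` every other level whose box contains x gives the same value.
  refine ⟨fun x => hB.coord (∑ i, x i) (proj (N (∑ i, x i)) y) x, ?_, ?_⟩
  · intro m
    conv_lhs => rw [← hB.partialSum_coord m (proj (N m) y)]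
    refine Finset.sum_congr rfl fun x hx => ?_
    congr 1
    beta_reduce
    rcases le_total m (∑ i, x i) with h | h
    · rw [← hB.coord_trans h _ hx, trans_proj]
    · rw [← hB.coord_trans h _ (exists_mem_box x), trans_proj]
  · intro c hc
    ext x
    rw [hc, hB.coord_partialSum _ _ (exists_mem_box x)]

end IsOrderedBasis

/-! ### Powers of left ideals -/

section IdealPow

variable {R : Type*} [Ring R] {I : Ideal R}

/-- The ideal is only a left ideal: for n = 0 the statement would make I^m a right ideal. -/
theorem Ideal.mul_mem_pow_add {m : ℕ} {a : R} (ha : a ∈ I ^ m) {n : ℕ} (hn : 1 ≤ n) :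
    ∀ {b : R}, b ∈ I ^ n → a * b ∈ I ^ (m + n) := by
  induction n, hn using Nat.le_induction with
  | base =>
    intro b hb
    rw [Submodule.pow_succ]
    rw [Submodule.pow_one] at hb
    exact Submodule.mul_mem_mul ha hb
  | succ n hn ih =>
    intro b hb
    rw [Submodule.pow_succ] at hb
    rw [← add_assoc, Submodule.pow_succ]
    induction hb using Submodule.mul_induction_on' with
    | mem_mul_mem x hx y hy => rw [← mul_assoc]; exact Submodule.mul_mem_mul (ih hx) hy
    | add x _ y _ hx hy => rw [mul_add]; exact add_mem hx hy

theorem Ideal.pow_le_pow_left_ideal {m n : ℕ} (h : m ≤ n) : I ^ n ≤ I ^ m := by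
  have step : ∀ n, I ^ (n + 1) ≤ I ^ n := by
    intro n
    induction n with
    | zero => rw [Submodule.pow_zero, Ideal.one_eq_top]; exact le_top
    | succ n ih =>
      rw [Submodule.pow_succ, Submodule.pow_succ (n := n)]
      exact Ideal.mul_le.2 fun r hr s hs => Submodule.mul_mem_mul (ih hr) hs
  exact antitone_nat_of_succ_le step h

end IdealPow

/-! ### The weight filtration and the powers of the maximal ideal -/

namespace IsOrderedBasis

open CompletedGroupRing

variable {A : Type*} [Ring A] {F : Type*} [Field F] [Algebra F A]

/-- The coefficients of the part of `∑ c_x z^x` whose last letter is `z_i`, divided by `z_i`. -/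
def lastCoeff {d : ℕ} (c : (Fin d → ℕ) → F) (i : Fin d) (x : Fin d → ℕ) : F :=
  if ∀ k, i < k → x k = 0 then c (x + Pi.single i 1) else 0

theorem exists_last {d : ℕ} {x : Fin d → ℕ} (hx : x ≠ 0) :
    ∃ i, x i ≠ 0 ∧ ∀ k, i < k → x k = 0 := by
  have hne : (Finset.univ.filter fun i => x i ≠ 0).Nonempty := by
    obtain ⟨i, hi⟩ := Function.ne_iff.1 hx
    exact ⟨i, by simpa using hi⟩
  refine ⟨_, (Finset.mem_filter.1 (Finset.max'_mem _ hne)).2, fun k hk => ?_⟩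
  by_contra h
  exact absurd (Finset.le_max' _ k (Finset.mem_filter.2 ⟨Finset.mem_univ _, h⟩)) (not_le.2 hk)

/-- Group the nonzero exponents by their last nonzero index i and split off one factor z_i on the
right. There are only d possible last letters, which is what later turns an infinite expansion into
a finite sum. -/
theorem sum_box_eq {d n : ℕ} (z : Fin d → A) (hz : ∀ x ∉ box d n, mon z x = 0)
    (c : (Fin d → ℕ) → F) (h0 : c 0 = 0) :
    ∑ x ∈ box d n, c x • mon z x = ∑ i, (∑ x ∈ box d n, lastCoeff c i x • mon z x) * z i := by
  classical
  have h1 : ∀ x ∈ box d n, c x • mon z x =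
      ∑ i, if x i ≠ 0 ∧ ∀ k, i < k → x k = 0 then c x • mon z x else 0 := by
    intro x _
    by_cases hx : x = 0
    · simp [hx, h0]
    · obtain ⟨i, hi, hk⟩ := exists_last hx
      rw [Finset.sum_eq_single i, if_pos ⟨hi, hk⟩]
      · intro j _ hj
        rw [if_neg]
        rintro ⟨hj1, hj2⟩
        rcases lt_or_gt_of_ne hj with h | h
        · exact hi (hj2 i h)
        · exact hj1 (hk j h)
      · simp
  rw [Finset.sum_congr rfl h1, Finset.sum_comm]
  refine Finset.sum_congr rfl fun i _ => ?_
  rw [Finset.sum_mul, ← Finset.sum_filter]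
  refine Finset.sum_of_injOn (fun x => x - Pi.single i 1) ?_ ?_ ?_ ?_
  · intro x hx y hy h
    simp only [Finset.coe_filter, Set.mem_ofPred_eq] at hx hy
    ext k
    have := congrFun h k
    simp only [Pi.sub_apply] at this
    by_cases hk : k = i
    · subst hk
      simp only [Pi.single_eq_same] at this
      have := hx.2.1
      have := hy.2.1
      omega
    · simpa [Pi.single_eq_of_ne hk] using this
  · intro x hx
    simp only [Finset.coe_filter, Set.mem_ofPred_eq, mem_box] at hx
    simp only [Finset.mem_coe, mem_box, Pi.sub_apply]
    intro k
    have := hx.1 k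
    omega
  · intro x hx hn
    rw [lastCoeff]
    split_ifs with h
    -- An exponent x that is not hit has x + e_i outside the box, so its term is zero.
    · rw [smul_mul_assoc, mon_mul_last _ _ _ h]
      rw [hz, smul_zero]
      intro hb
      refine hn ⟨x + Pi.single i 1, ?_, by simp⟩
      simp only [Finset.coe_filter, Set.mem_ofPred_eq]
      refine ⟨hb, by simp, fun k hk => ?_⟩
      simp [h k hk, Pi.single_eq_of_ne hk.ne']
    · simp
  · intro x hx
    simp only [Finset.mem_filter] at hx
    have h : ∀ k, i < k → (x - Pi.single i 1 : Fin d → ℕ) k = 0 := fun k hk => by simp [hx.2.2 k hk]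
    have hx1 : x - Pi.single i 1 + Pi.single i 1 = x := by
      ext k
      by_cases hk : k = i
      · subst hk
        have := hx.2.1
        simp only [Pi.add_apply, Pi.sub_apply, Pi.single_eq_same]
        omega
      · simp [Pi.single_eq_of_ne hk]
    rw [lastCoeff, if_pos h, smul_mul_assoc, mon_mul_last _ _ _ h, hx1]

variable {p : ℕ} [Fact p.Prime] {G : Type*} [Group G] [TopologicalSpace G] {d : ℕ} {g : Fin d → G}
  {w : Fin d → ℕ} {N : ℕ → OpenNormalSubgroup G}
  (hB : IsOrderedBasis p g w fun m => (N m : Subgroup G))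
  (hN : ∀ V : OpenNormalSubgroup G, ∃ m, (N m : Subgroup G) ≤ V) [CharP F p]

include hB in
theorem monSpan_zero (m : ℕ) : monSpan F (quotGen F g (N m : Subgroup G)) w 0 = ⊤ := by
  rw [eq_top_iff]
  refine (hB.span_box_eq_top F m).trans (Submodule.span_mono ?_)
  rintro _ ⟨x, rfl⟩
  exact ⟨x.1, Nat.zero_le _, rfl⟩

omit [CharP F p] in
include hN in
theorem eq_of_proj {y y' : CompletedGroupRing F G} (h : ∀ m, proj (N m) y = proj (N m) y') :
    y = y' := by
  refine ext_proj fun V => ?_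
  obtain ⟨m, hm⟩ := hN V
  rw [← trans_proj hm, h, trans_proj]

include hB in
theorem coord_eq_zero {m j : ℕ} {a : MonoidAlgebra F (G ⧸ (N m : Subgroup G))}
    (ha : a ∈ monSpan F (quotGen F g (N m : Subgroup G)) w j) {x : Fin d → ℕ} (hx : wt w x < j) :
    hB.coord m a x = 0 := by
  rw [coord]
  split_ifs with hb
  · induction ha using Submodule.span_induction with
    | mem a ha =>
      obtain ⟨y, hy, rfl⟩ := ha
      by_cases hyb : y ∈ box d (p ^ m)
      · have := hB.monBasis_apply F m ⟨y, hyb⟩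
        simp only at this
        rw [← this, Module.Basis.repr_self, Finsupp.single_apply, if_neg]
        rintro h
        have : y = x := congrArg Subtype.val h
        subst this
        omega
      · rw [hB.mon_quotGen_eq_zero F m hyb]
        simp
    | zero => simp
    | add a b _ _ ha hb => simp [ha, hb]
    | smul c a _ ha => simp [ha]
  · rfl

include hB hN in
theorem exists_eq_sum_mul {c : (Fin d → ℕ) → F} {y : CompletedGroupRing F G}
    (hc : IsExpansion g c y) (h0 : c 0 = 0) : ∃ y' : Fin d → CompletedGroupRing F G,
      (∀ i, IsExpansion g (lastCoeff c i) (y' i)) ∧ y = ∑ i, y' i * (of F (g i) - 1) := by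
  choose y' hy' using fun i => hB.exists_isExpansion hN (lastCoeff c i)
  refine ⟨y', hy', eq_of_proj hN fun m => ?_⟩
  rw [map_sum, (hB.isExpansion_iff hN).1 hc, partialSum,
    sum_box_eq _ (fun x hx => hB.mon_quotGen_eq_zero F m hx) c h0]
  refine Finset.sum_congr rfl fun i _ => ?_
  rw [map_mul, (hB.isExpansion_iff hN).1 (hy' i), map_sub, map_one, proj_of]
  rfl

include hB hN in
-- Peeling off the last letter z_i lowers the weight bound by v i and leaves another full expansion,
-- so no closedness of I^j is needed. The weight v is kept free: v = 1 serves to place the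
-- generators in powers of I, and v = w then gives the final result.
theorem mem_pow_of_weight {I : Ideal (CompletedGroupRing F G)} {v : Fin d → ℕ} (hv : ∀ i, 1 ≤ v i)
    (hI : ∀ i, of F (g i) - 1 ∈ I ^ v i) (j : ℕ) : ∀ {c : (Fin d → ℕ) → F}
      {y : CompletedGroupRing F G}, IsExpansion g c y → (∀ x, c x ≠ 0 → j ≤ wt v x) →
        y ∈ I ^ j := by
  induction j using Nat.strong_induction_on with
  | _ j ih =>
    intro c y hc h
    rcases Nat.eq_zero_or_pos j with rfl | hj
    · rw [Submodule.pow_zero, Ideal.one_eq_top]; trivial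
    have h0 : c 0 = 0 := by
      by_contra h0
      have := h 0 h0
      simp [wt] at this
      omega
    obtain ⟨y', hy', rfl⟩ := hB.exists_eq_sum_mul hN hc h0
    refine sum_mem fun i _ => ?_
    have hvi := hv i
    have h1 : y' i ∈ I ^ (j - v i) := by
      refine ih _ (by omega) (hy' i) fun x hx => ?_
      rw [lastCoeff] at hx
      split_ifs at hx with hk
      · have := h _ hx
        have h2 : wt v (x + Pi.single i 1) = wt v x + v i := by
          simp [wt, add_mul, Finset.sum_add_distrib, Pi.single_apply]
        omega
      · exact absurd rfl hx
    -- When v i > j the subtraction j - v i truncates to 0, and the product lies in the smaller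
    -- ideal I^(v i).
    exact Ideal.pow_le_pow_left_ideal (by omega) (Ideal.mul_mem_pow_add h1 hvi (hI i))

variable [Finite F] (hp : 3 < p)

/-- The elements of `F⟦G⟧` of weight at least `j`. -/
def filtration (j : ℕ) : Ideal (CompletedGroupRing F G) where
  carrier := {y | ∀ m, proj (N m) y ∈ monSpan F (quotGen F g (N m : Subgroup G)) w j}
  add_mem' ha hb m := by rw [map_add]; exact add_mem (ha m) (hb m)
  zero_mem' m := by rw [map_zero]; exact zero_mem _
  smul_mem' a y hy m := by
    rw [smul_eq_mul, map_mul]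
    have h := hB.mul_mem_monSpan F m hp (i := 0) (a := proj (N m) a)
      (by rw [hB.monSpan_zero]; trivial) (hy m)
    rwa [zero_add] at h

theorem mul_mem_filtration {i j : ℕ} {y y' : CompletedGroupRing F G}
    (hy : y ∈ hB.filtration hp i) (hy' : y' ∈ hB.filtration hp j) :
    y * y' ∈ hB.filtration hp (i + j) := fun m => by
  rw [map_mul]
  exact hB.mul_mem_monSpan F m hp (hy m) (hy' m)

theorem mem_filtration_zero (y : CompletedGroupRing F G) : y ∈ hB.filtration hp 0 := fun m => by
  rw [hB.monSpan_zero]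
  trivial

include hN in
theorem mem_filtration_iff {j : ℕ} {y : CompletedGroupRing F G} {c : (Fin d → ℕ) → F}
    (hc : IsExpansion g c y) :
    y ∈ hB.filtration hp j ↔ ∀ x, c x ≠ 0 → j ≤ wt w x := by
  rw [hB.isExpansion_iff hN] at hc
  constructor
  · intro h x hx
    by_contra! hlt
    have h1 := hB.coord_eq_zero (h (∑ i, x i)) hlt
    rw [hc, hB.coord_partialSum _ _ (exists_mem_box x)] at h1
    exact hx h1
  · intro h m
    rw [hc]
    refine sum_mem fun x _ => ?_
    by_cases hx : c x = 0
    · rw [hx, zero_smul]; exact zero_mem _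
    · exact Submodule.smul_mem _ _ (Submodule.subset_span ⟨x, h x hx, rfl⟩)

include hN in
theorem le_nu_iff {ω : G → ℝ≥0∞} (hω : ∀ i, 2 * ω (g i) = w i) {j : ℕ}
    {y : CompletedGroupRing F G} : (j : ℝ≥0∞) ≤ nu ω g y ↔ y ∈ hB.filtration hp j := by
  obtain ⟨c, hc, hu⟩ := hB.existsUnique_isExpansion hN y
  rw [hB.mem_filtration_iff hN hp hc]
  have h1 : nu ω g y = ⨅ (x : Fin d → ℕ) (_ : c x ≠ 0), ((wt w x : ℕ) : ℝ≥0∞) := by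
    rw [nu, ENNReal.mul_iInf_of_ne two_ne_zero ENNReal.ofNat_ne_top]
    have h2 : ∀ x : Fin d → ℕ, 2 * ∑ i, (x i : ℝ≥0∞) * ω (g i) = ((wt w x : ℕ) : ℝ≥0∞) := by
      intro x
      rw [Finset.mul_sum, wt, Nat.cast_sum]
      refine Finset.sum_congr rfl fun i _ => ?_
      rw [Nat.cast_mul, ← hω]
      ring
    simp only [ENNReal.mul_iInf_of_ne two_ne_zero ENNReal.ofNat_ne_top, h2]
    -- Uniqueness of the expansion collapses the infimum over c.
    refine le_antisymm (iInf₂_le c hc) (le_iInf₂ fun c' hc' => ?_)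
    rw [hu c' hc']
  rw [h1]
  simp only [le_iInf_iff, Nat.cast_le]

theorem of_sub_one_mem_filtration (u : G) : of F u - 1 ∈ hB.filtration hp 1 := fun m => by
  have := MonoidAlgebra.charP_of_field p F (G ⧸ (N m : Subgroup G))
  rw [map_sub, map_one, proj_of, ← hB.wordSpan_quotGen F m hp]
  obtain ⟨x, -, hx⟩ := hB.map_eq_mon ((MonoidAlgebra.of F (G ⧸ (N m : Subgroup G))).comp
    (QuotientGroup.mk' (N m : Subgroup G)))
    (of_comp_mk_eq_one (N := fun m => (N m : Subgroup G)) F) u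
  rw [hx, mon_map]
  refine mon_sub_one_mem _ (fun a ha b hb => wordSpan_anti (Nat.le_add_left _ _)
    (mul_mem_wordSpan ha hb)) _ _ fun i _ => ?_
  refine wordSpan_anti ?_ (mem_wordSpan i)
  rcases hB.weight i with h | h <;> omega

theorem of_sub_one_mem_filtration_of_mem {u : G} (hu : u ∈ (N 1 : Subgroup G)) :
    of F u - 1 ∈ hB.filtration hp p := fun m => by
  rw [map_sub, map_one, proj_of]
  exact hB.of_sub_one_mem F m hp hu

theorem one_notMem_filtration : (1 : CompletedGroupRing F G) ∉ hB.filtration hp 1 := by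
  intro h
  have h1 := h 0
  rw [map_one] at h1
  obtain ⟨n, hn⟩ := hB.isNilpotent_of_mem_monSpan F 0 hp h1
  rw [one_pow] at hn
  exact one_ne_zero hn

include hN in
-- The constant coefficient is nonzero, so at level N m the element is a nonzero scalar plus a
-- nilpotent of positive weight.
theorem isUnit_proj {y : CompletedGroupRing F G} (hy : y ∉ hB.filtration hp 1)
    (V : OpenNormalSubgroup G) : IsUnit (proj V y) := by
  obtain ⟨m, hm⟩ := hN V
  rw [← trans_proj hm]
  refine IsUnit.map _ ?_
  obtain ⟨c, hc, -⟩ := hB.existsUnique_isExpansion hN y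
  have h0 : c 0 ≠ 0 := by
    intro h0
    refine hy ((hB.mem_filtration_iff hN hp hc).2 fun x hx => ?_)
    have hx0 : x ≠ 0 := by rintro rfl; exact hx h0
    obtain ⟨i, hi⟩ := Function.ne_iff.1 hx0
    have h1 : x i * w i ≤ wt w x :=
      Finset.single_le_sum (f := fun i => x i * w i) (fun _ _ => Nat.zero_le _) (Finset.mem_univ i)
    have h2 : 0 < x i := Nat.pos_of_ne_zero hi
    rcases hB.weight i with h | h <;> rw [h] at h1 <;> omega
  have hmem : proj (N m) y - algebraMap F _ (c 0) ∈
      monSpan F (quotGen F g (N m : Subgroup G)) w 1 := by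
    have h0b : (0 : Fin d → ℕ) ∈ box d (p ^ m) :=
      mem_box.2 fun i => pow_pos (Fact.out : p.Prime).pos m
    rw [(hB.isExpansion_iff hN).1 hc m, partialSum, ← Finset.add_sum_erase _ _ h0b, mon_zero,
      Algebra.algebraMap_eq_smul_one, add_sub_cancel_left]
    refine sum_mem fun x hx => Submodule.smul_mem _ _ (Submodule.subset_span ⟨x, ?_, rfl⟩)
    obtain ⟨i, hi⟩ := Function.ne_iff.1 (Finset.ne_of_mem_erase hx)
    have h1 : x i * w i ≤ wt w x :=
      Finset.single_le_sum (f := fun i => x i * w i) (fun _ _ => Nat.zero_le _) (Finset.mem_univ i)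
    have h2 : 0 < x i := Nat.pos_of_ne_zero hi
    rcases hB.weight i with h | h <;> rw [h] at h1 <;> omega
  have hnil := hB.isNilpotent_of_mem_monSpan F m hp hmem
  have hu : IsUnit (algebraMap F (MonoidAlgebra F (G ⧸ (N m : Subgroup G))) (c 0)) :=
    (IsUnit.mk0 _ h0).map _
  have := hnil.isUnit_add_right_of_commute hu (Algebra.commutes _ _).symm
  simpa using this

include hN in
-- Inverses at the finite levels are unique, hence compatible, and glue to an inverse in the limit.
theorem exists_mul_eq_one {y : CompletedGroupRing F G} (hy : y ∉ hB.filtration hp 1) :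
    ∃ v, v * y = 1 := by
  choose u hu using hB.isUnit_proj hN hp hy
  refine ⟨ofCompatible (fun V => ((u V)⁻¹ : (MonoidAlgebra F (G ⧸ (V : Subgroup G)))ˣ)) ?_, ?_⟩
  · intro V V' h
    have h1 : Units.map (MonoidHomClass.toMonoidHom (trans F h)) (u V) = u V' := by
      ext1
      change trans F h (u V) = _
      rw [hu, hu, trans_proj]
    rw [← h1, ← map_inv]
    rfl
  · refine ext_proj fun V => ?_
    rw [map_mul, proj_ofCompatible, ← hu V, map_one, Units.inv_mul]

include hN in
-- In weight two, g_i is a commutator ⁅u, v⁆ times an element of N 1. Here ⁅u, v⁆ - 1 is uv times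
-- the ring commutator of u⁻¹ - 1 and v⁻¹ - 1, so it lies in I².
theorem of_sub_one_mem_pow (i : Fin d) : of F (g i) - 1 ∈ hB.filtration (F := F) hp 1 ^ w i := by
  set I := hB.filtration (F := F) hp 1 with hI
  rcases hB.weight i with h | h
  · rw [h, Submodule.pow_one]
    exact hB.of_sub_one_mem_filtration hp _
  rw [h]
  obtain ⟨u, v, huv⟩ := hB.gen i h
  have h1 : of F (⁅u, v⁆⁻¹ * g i) - 1 ∈ I ^ 2 := by
    obtain ⟨c, hc, -⟩ := hB.existsUnique_isExpansion hN (of F (⁅u, v⁆⁻¹ * g i) - 1)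
    -- The weights w cannot be used yet, so monomials are measured by degree: weight at least p > 3
    -- with letters of weight at most 2 forces degree at least 2.
    refine hB.mem_pow_of_weight hN (v := fun _ => 1) (fun _ => le_rfl) (fun i => ?_) 2 hc ?_
    · rw [Submodule.pow_one]
      exact hB.of_sub_one_mem_filtration hp _
    · intro x hx
      have h2 := (hB.mem_filtration_iff hN hp hc).1 (hB.of_sub_one_mem_filtration_of_mem hp huv) x hx
      have h3 : wt w x ≤ 2 * wt (fun _ => 1) x := by
        rw [wt, wt, Finset.mul_sum]
        refine Finset.sum_le_sum fun i _ => ?_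
        rcases hB.weight i with h | h <;> rw [h] <;> omega
      omega
  have hmul : ∀ a b : G, of F (a * b) = of F a * of F b := fun a b =>
    ext_proj fun V => by simp only [map_mul, proj_of]
  have hone : of F (1 : G) = 1 := ext_proj fun V => by simp only [map_one, proj_of]
  have h2 : of F ⁅u, v⁆ - 1 ∈ I ^ 2 := by
    have e : of F ⁅u, v⁆ - 1 = of F (u * v) * ((of F u⁻¹ - 1) * (of F v⁻¹ - 1) -
        (of F v⁻¹ - 1) * (of F u⁻¹ - 1)) := by
      have e1 : (of F u⁻¹ - 1) * (of F v⁻¹ - 1) - (of F v⁻¹ - 1) * (of F u⁻¹ - 1) =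
          of F (u⁻¹ * v⁻¹) - of F (v⁻¹ * u⁻¹) := by
        rw [hmul, hmul]; noncomm_ring
      rw [e1, mul_sub, ← hmul, ← hmul, ← hone]
      congr 2
      · simp [commutatorElement_def, mul_assoc]
      · simp [mul_assoc]
    rw [e]
    refine Ideal.mul_mem_left _ _ ?_
    rw [Submodule.pow_succ, Submodule.pow_one]
    have hm : ∀ a : G, of F a - 1 ∈ I := hB.of_sub_one_mem_filtration hp
    exact sub_mem (Submodule.mul_mem_mul (hm _) (hm _)) (Submodule.mul_mem_mul (hm _) (hm _))
  have e : of F (g i) - 1 = of F ⁅u, v⁆ * (of F (⁅u, v⁆⁻¹ * g i) - 1) + (of F ⁅u, v⁆ - 1) := by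
    rw [mul_sub, ← hmul, mul_inv_cancel_left]
    noncomm_ring
  rw [e]
  exact add_mem (Ideal.mul_mem_left _ _ h1) h2

include hN in
theorem filtration_eq_pow (j : ℕ) :
    hB.filtration (F := F) hp 1 ^ j = hB.filtration hp j := by
  refine le_antisymm ?_ ?_
  · induction j with
    | zero => exact fun y _ => hB.mem_filtration_zero hp y
    | succ j ih =>
      rw [Submodule.pow_succ]
      exact Ideal.mul_le.2 fun r hr s hs => hB.mul_mem_filtration hp (ih hr) hs
  · intro y hy
    obtain ⟨c, hc, -⟩ := hB.existsUnique_isExpansion hN y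
    refine hB.mem_pow_of_weight hN (fun i => ?_) (hB.of_sub_one_mem_pow hN hp) j hc
      ((hB.mem_filtration_iff hN hp hc).1 hy)
    rcases hB.weight i with h | h <;> omega

include hB hN hp in
/-- The expansions in `F⟦G⟧`, and the powers of its maximal ideal. -/
theorem completedGroupRing {ω : G → ℝ≥0∞} (hω : ∀ i, 2 * ω (g i) = w i) :
    (∀ y : CompletedGroupRing F G, ∃! c : (Fin d → ℕ) → F, IsExpansion g c y) ∧
      ∃ 𝔪 : Ideal (CompletedGroupRing F G), 𝔪.IsTwoSided ∧
        (∀ I : Ideal (CompletedGroupRing F G), I.IsMaximal ↔ I = 𝔪) ∧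
        ∀ j : ℕ, ((𝔪 ^ j : Ideal (CompletedGroupRing F G)) : Set (CompletedGroupRing F G)) =
          {y | (j : ℝ≥0∞) ≤ nu ω g y} := by
  refine ⟨hB.existsUnique_isExpansion hN, hB.filtration hp 1, ⟨fun b ha => ?_⟩, fun I => ?_,
    fun j => ?_⟩
  · have h := hB.mul_mem_filtration hp ha (hB.mem_filtration_zero hp b)
    rwa [add_zero] at h
  · have key : ∀ J : Ideal (CompletedGroupRing F G), ¬ J ≤ hB.filtration hp 1 → J = ⊤ := by
      intro J hJ
      obtain ⟨y, hy, hn⟩ := SetLike.not_le_iff_exists.1 hJ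
      obtain ⟨v, hv⟩ := hB.exists_mul_eq_one hN hp hn
      exact Ideal.eq_top_of_unit_mem _ y v hy hv
    have hne : hB.filtration (F := F) hp 1 ≠ ⊤ :=
      (Ideal.ne_top_iff_one _).2 (hB.one_notMem_filtration hp)
    constructor
    · intro hI
      refine hI.eq_of_le hne ?_
      by_contra h
      exact hI.ne_top (key I h)
    · rintro rfl
      exact ⟨hne, fun J hJ => key J (not_le_of_gt hJ)⟩
  · ext y
    rw [hB.filtration_eq_pow hN hp]
    exact (hB.le_nu_iff hN hp hω).symm

end IsOrderedBasis

/-! ## Unit groups of twisted quadratic orders -/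

/-- A group of elements `X u + (Y u) Π`, with `X u ≡ 1` modulo `p`, where `Π ^ 2 = p` and
`Π r = σ(r) Π` for an involution `σ` of the commutative ring `R`. -/
structure IsTwistedUnitGroup (p : ℕ) {U R : Type*} [Group U] [CommRing R] (σ : R →+* R)
    (X Y : U → R) : Prop where
  X_mul : ∀ u v, X (u * v) = X u * X v + p * (Y u * σ (Y v))
  Y_mul : ∀ u v, Y (u * v) = X u * Y v + Y u * σ (X v)
  X_one : X 1 = 1
  Y_one : Y 1 = 0
  dvd_X : ∀ u, (p : R) ∣ X u - 1
  σ_σ : ∀ r, σ (σ r) = r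
  reg : ∀ r, (p : R) * r = 0 → r = 0
  unit : ∀ r, IsUnit (1 + (p : R) * r)

theorem RingHom.natCast_pow_dvd_map {R : Type*} [CommRing R] (σ : R →+* R) {p n : ℕ} {r : R}
    (h : (p : R) ^ n ∣ r) : (p : R) ^ n ∣ σ r := by
  have := map_dvd σ h
  rwa [map_pow, map_natCast] at this

namespace IsTwistedUnitGroup

variable {p : ℕ} {U R : Type*} [Group U] [CommRing R] {σ : R →+* R} {X Y : U → R}
  (hU : IsTwistedUnitGroup p σ X Y)

include hU

theorem dvd_σ_X (u : U) : (p : R) ∣ σ (X u) - 1 := by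
  have := map_dvd σ (hU.dvd_X u)
  rwa [map_natCast, map_sub, map_one] at this

theorem norm_eq (u : U) : ∃ r, X u * σ (X u) - p * (Y u * σ (Y u)) = 1 + p * r := by
  obtain ⟨r, hr⟩ := hU.dvd_X u
  rw [sub_eq_iff_eq_add] at hr
  refine ⟨r + σ r + p * r * σ r - Y u * σ (Y u), ?_⟩
  rw [hr]
  simp only [map_add, map_mul, map_natCast, map_one]
  ring

/-- Solving (a b⁻¹) b = a for the coordinates of a b⁻¹ introduces the reduced norm of b as a
denominator, and avoids a formula for b⁻¹. -/
theorem X_mul_inv (a b : U) : X (a * b⁻¹) * (X b * σ (X b) - p * (Y b * σ (Y b))) =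
    X a * σ (X b) - p * (Y a * σ (Y b)) := by
  have h1 := hU.X_mul (a * b⁻¹) b
  have h2 := hU.Y_mul (a * b⁻¹) b
  rw [inv_mul_cancel_right] at h1 h2
  rw [h1, h2]
  ring

theorem Y_mul_inv (a b : U) : Y (a * b⁻¹) * (X b * σ (X b) - p * (Y b * σ (Y b))) =
    Y a * X b - X a * Y b := by
  have h1 := hU.X_mul (a * b⁻¹) b
  have h2 := hU.Y_mul (a * b⁻¹) b
  rw [inv_mul_cancel_right] at h1 h2
  rw [h1, h2]
  ring

/-- The reduced norm of b is a σ-invariant unit, so multiplying by it does not affect divisibility.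
-/
theorem dvd_mul_inv_iff (a b : U) (m n : ℕ) :
    ((p : R) ^ m ∣ X (a * b⁻¹) - σ (X (a * b⁻¹)) ∧ (p : R) ^ n ∣ Y (a * b⁻¹)) ↔
      ((p : R) ^ m ∣ X a * σ (X b) - σ (X a) * X b - p * (Y a * σ (Y b) - σ (Y a) * Y b) ∧
        (p : R) ^ n ∣ Y a * X b - X a * Y b) := by
  obtain ⟨r, hr⟩ := hU.norm_eq b
  have hu := hU.unit r
  rw [← hr] at hu
  have h1 := hU.X_mul_inv a b
  have h2 := congrArg σ h1
  simp only [map_sub, map_mul, map_natCast, hU.σ_σ] at h2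
  rw [← hU.Y_mul_inv a b, hu.dvd_mul_right]
  rw [show X a * σ (X b) - σ (X a) * X b - p * (Y a * σ (Y b) - σ (Y a) * Y b) =
    (X (a * b⁻¹) - σ (X (a * b⁻¹))) * (X b * σ (X b) - p * (Y b * σ (Y b))) by
      linear_combination -h1 + h2, hu.dvd_mul_right]

/-- The congruence filtration modulo the centre. -/
def congr (n : ℕ) : Subgroup U where
  carrier := {u | (p : R) ^ ((n + 1) / 2) ∣ X u - σ (X u) ∧ (p : R) ^ (n / 2) ∣ Y u}
  one_mem' := by simp [hU.X_one, hU.Y_one]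
  mul_mem' := by
    rintro u v ⟨hu, hu'⟩ ⟨hv, hv'⟩
    constructor
    · rw [hU.X_mul]
      have e : X u * X v + p * (Y u * σ (Y v)) - σ (X u * X v + p * (Y u * σ (Y v))) =
          (X u - σ (X u)) * X v + σ (X u) * (X v - σ (X v)) +
            p * (Y u * σ (Y v)) - p * (σ (Y u) * Y v) := by
        simp only [map_add, map_mul, map_natCast, hU.σ_σ]
        ring
      rw [e]
      have h1 : (p : R) ^ ((n + 1) / 2) ∣ (p : R) * (p : R) ^ (n / 2) := by
        rw [← pow_succ']; exact pow_dvd_pow _ (by omega)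
      refine dvd_sub (dvd_add (dvd_add (hu.mul_right _) (hv.mul_left _)) ?_) ?_
      · exact h1.trans (mul_dvd_mul_left _ (hu'.mul_right _))
      · exact h1.trans (mul_dvd_mul_left _ (hv'.mul_left _))
    · rw [hU.Y_mul]
      exact dvd_add (hv'.mul_left _) (hu'.mul_right _)
  inv_mem' := by
    rintro u ⟨hu, hu'⟩
    have h := hU.dvd_mul_inv_iff 1 u ((n + 1) / 2) (n / 2)
    rw [one_mul] at h
    refine h.2 ⟨?_, ?_⟩
    · simp only [hU.X_one, hU.Y_one, map_one, map_zero]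
      rw [← dvd_neg]
      simpa using hu
    · simpa [hU.X_one, hU.Y_one] using hu'

theorem mem_congr {n : ℕ} {u : U} : u ∈ hU.congr n ↔
    (p : R) ^ ((n + 1) / 2) ∣ X u - σ (X u) ∧ (p : R) ^ (n / 2) ∣ Y u :=
  Iff.rfl

theorem congr_anti : Antitone hU.congr := by
  rintro m n h u ⟨h1, h2⟩
  exact ⟨(pow_dvd_pow _ (by omega)).trans h1, (pow_dvd_pow _ (by omega)).trans h2⟩

theorem dvd_sub_σ (u : U) : (p : R) ∣ X u - σ (X u) := by
  have := dvd_sub (hU.dvd_X u) (hU.dvd_σ_X u)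
  rwa [sub_sub_sub_cancel_right] at this

theorem mem_congr_one (u : U) : u ∈ hU.congr 1 := by
  rw [mem_congr]
  simpa using hU.dvd_sub_σ u

/-- As ⁅u, v⁆ = uv(vu)⁻¹, only the differences of the coordinates of uv and vu matter. For X the
difference is p times products with Y v; for Y it involves Y v (X u - σ(X u)) and Y u (X v - σ(X
v)), each divisible enough for the next level. -/
theorem commutator_mem (u : U) {v : U} {n : ℕ} (hv : v ∈ hU.congr n) :
    ⁅u, v⁆ ∈ hU.congr (n + 1) := by
  obtain ⟨h1, h2⟩ := hv
  have e : ⁅u, v⁆ = u * v * (v * u)⁻¹ := by simp [commutatorElement_def, mul_assoc]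
  rw [e, mem_congr, hU.dvd_mul_inv_iff]
  have hX : (p : R) ^ (n / 2 + 1) ∣ X (u * v) - X (v * u) := by
    have : X (u * v) - X (v * u) = p * (Y u * σ (Y v) - Y v * σ (Y u)) := by
      rw [hU.X_mul, hU.X_mul]; ring
    rw [this, pow_succ']
    exact mul_dvd_mul_left _ (dvd_sub ((σ.natCast_pow_dvd_map h2).mul_left _) (h2.mul_right _))
  have hY : (p : R) ^ ((n + 1) / 2) ∣ Y (u * v) - Y (v * u) := by
    have : Y (u * v) - Y (v * u) = Y v * (X u - σ (X u)) - Y u * (X v - σ (X v)) := by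
      rw [hU.Y_mul, hU.Y_mul]; ring
    rw [this]
    refine dvd_sub ?_ (h1.mul_left _)
    refine (pow_dvd_pow _ (show (n + 1) / 2 ≤ n / 2 + 1 by omega)).trans ?_
    rw [pow_succ]
    exact mul_dvd_mul h2 (hU.dvd_sub_σ u)
  have e2 : (n + 1 + 1) / 2 = n / 2 + 1 := by omega
  constructor
  · have : X (u * v) * σ (X (v * u)) - σ (X (u * v)) * X (v * u) -
        p * (Y (u * v) * σ (Y (v * u)) - σ (Y (u * v)) * Y (v * u)) =
        (X (u * v) - X (v * u)) * σ (X (v * u)) - σ (X (u * v) - X (v * u)) * X (v * u) -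
        p * ((Y (u * v) - Y (v * u)) * σ (Y (v * u)) - σ (Y (u * v) - Y (v * u)) * Y (v * u)) := by
      simp only [map_sub]; ring
    rw [this, e2]
    refine dvd_sub (dvd_sub (hX.mul_right _) ((σ.natCast_pow_dvd_map hX).mul_right _)) ?_
    refine (pow_dvd_pow _ (show n / 2 + 1 ≤ (n + 1) / 2 + 1 by omega)).trans ?_
    rw [pow_succ']
    exact mul_dvd_mul_left _ (dvd_sub (hY.mul_right _) ((σ.natCast_pow_dvd_map hY).mul_right _))
  · have : Y (u * v) * X (v * u) - X (u * v) * Y (v * u) =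
        (Y (u * v) - Y (v * u)) * X (v * u) - (X (u * v) - X (v * u)) * Y (v * u) := by ring
    rw [this]
    exact dvd_sub (hY.mul_right _)
      (((pow_dvd_pow _ (show (n + 1) / 2 ≤ n / 2 + 1 by omega)).trans hX).mul_right _)

theorem congr_normal (n : ℕ) : (hU.congr n).Normal := by
  constructor
  intro v hv u
  have h := mul_mem (hU.congr_anti (Nat.le_succ n) (hU.commutator_mem u hv)) hv
  simpa [commutatorElement_def] using h

/-- The leading coefficient of an element of the `n`-th congruence subgroup. -/
def lead (_ : IsTwistedUnitGroup p σ X Y) (n : ℕ) (u : U) : R :=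
  if n % 2 = 1 then Y u else X u - σ (X u)

theorem dvd_lead {n : ℕ} {u : U} (hu : u ∈ hU.congr n) : (p : R) ^ (n / 2) ∣ hU.lead n u := by
  rw [lead]
  split_ifs with h
  · exact hu.2
  · exact (pow_dvd_pow _ (by omega)).trans hu.1

theorem mem_congr_succ {n : ℕ} {u : U} (hu : u ∈ hU.congr n) :
    u ∈ hU.congr (n + 1) ↔ (p : R) ^ (n / 2 + 1) ∣ hU.lead n u := by
  rw [lead, mem_congr, show (n + 1 + 1) / 2 = n / 2 + 1 by omega]
  split_ifs with h
  · rw [show (n + 1) / 2 = n / 2 + 1 by omega]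
    refine and_iff_right ?_
    have := hu.1
    rwa [show (n + 1) / 2 = n / 2 + 1 by omega] at this
  · rw [show (n + 1) / 2 = n / 2 by omega]
    exact and_iff_left hu.2

/-- The cross terms gain a factor p, either from X ≡ 1 modulo p or from Π² = p. -/
theorem lead_mul {n : ℕ} {u v : U} (hu : u ∈ hU.congr n) (hv : v ∈ hU.congr n) :
    (p : R) ^ (n / 2 + 1) ∣ hU.lead n (u * v) - (hU.lead n u + hU.lead n v) := by
  simp only [lead]
  split_ifs with h
  · have : Y (u * v) - (Y u + Y v) = Y v * (X u - 1) + Y u * (σ (X v) - 1) := by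
      rw [hU.Y_mul]; ring
    rw [this, pow_succ]
    exact dvd_add (mul_dvd_mul hv.2 (hU.dvd_X u)) (mul_dvd_mul hu.2 (hU.dvd_σ_X v))
  · have : X (u * v) - σ (X (u * v)) - (X u - σ (X u) + (X v - σ (X v))) =
        (X u - σ (X u)) * (X v - 1) + (X v - σ (X v)) * (σ (X u) - 1) +
          p * (Y u * σ (Y v)) - p * (σ (Y u) * Y v) := by
      rw [hU.X_mul]
      simp only [map_add, map_mul, map_natCast, hU.σ_σ]
      ring
    rw [this, pow_succ]
    have hu1 := hu.1
    have hv1 := hv.1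
    rw [show (n + 1) / 2 = n / 2 by omega] at hu1 hv1
    refine dvd_sub (dvd_add (dvd_add (mul_dvd_mul hu1 (hU.dvd_X v)) (mul_dvd_mul hv1 (hU.dvd_σ_X u))) ?_) ?_
    · rw [mul_comm]; exact mul_dvd_mul_left _ (hu.2.mul_right _)
    · rw [mul_comm]; exact mul_dvd_mul_left _ (hv.2.mul_left _)

/-- The leading coefficient, as a homomorphism. -/
def leadHom {n : ℕ} :
    hU.congr n →* Multiplicative (R ⧸ Ideal.span {(p : R) ^ (n / 2 + 1)}) :=
  MonoidHom.mk' (fun u => Multiplicative.ofAdd (Ideal.Quotient.mk _ (hU.lead n u))) (by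
    intro u v
    rw [← ofAdd_add, ← map_add]
    congr 1
    rw [Ideal.Quotient.eq, Ideal.mem_span_singleton]
    exact hU.lead_mul u.2 v.2)

/-- The next level is the kernel of the leading coefficient homomorphism. -/
theorem inv_mul_mem_congr {n : ℕ} {u v : U} (hu : u ∈ hU.congr n)
    (hv : v ∈ hU.congr n) :
    v⁻¹ * u ∈ hU.congr (n + 1) ↔ (p : R) ^ (n / 2 + 1) ∣ hU.lead n u - hU.lead n v := by
  rw [hU.mem_congr_succ (mul_mem (inv_mem hv) hu), ← Ideal.mem_span_singleton,
    ← Ideal.mem_span_singleton, ← Ideal.Quotient.eq, ← Ideal.Quotient.eq_zero_iff_mem]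
  have h : hU.leadHom (⟨v, hv⟩⁻¹ * ⟨u, hu⟩) =
    (hU.leadHom ⟨v, hv⟩)⁻¹ * hU.leadHom ⟨u, hu⟩ := by rw [map_mul, map_inv]
  have h' : Ideal.Quotient.mk (Ideal.span {(p : R) ^ (n / 2 + 1)}) (hU.lead n (v⁻¹ * u)) =
    -Ideal.Quotient.mk _ (hU.lead n v) + Ideal.Quotient.mk _ (hU.lead n u) := h
  rw [h', neg_add_eq_zero, eq_comm]

theorem lead_mon {n : ℕ} {d : ℕ} (h : Fin d → hU.congr n) (s : Fin d → ℕ) :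
    (p : R) ^ (n / 2 + 1) ∣ hU.lead n (mon h s : hU.congr n) - ∑ i, s i * hU.lead n (h i) := by
  rw [← Ideal.mem_span_singleton, ← Ideal.Quotient.eq]
  have h1 := mon_map (hU.leadHom (n := n)) h s
  conv_rhs at h1 => rw [mon, List.prod_ofFn]
  have h2 := congrArg Multiplicative.toAdd h1
  rw [toAdd_prod] at h2
  refine (show _ = _ from h2).trans ?_
  rw [map_sum]
  refine Finset.sum_congr rfl fun i _ => ?_
  rw [toAdd_pow, map_mul, map_natCast, nsmul_eq_mul]
  rfl

theorem eq_zero_of_pow_mul {n : ℕ} {t : R} (h : (p : R) ^ n * t = 0) : t = 0 := by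
  induction n with
  | zero => simpa using h
  | succ n ih => rw [pow_succ', mul_assoc] at h; exact ih (hU.reg _ h)

theorem dvd_of_pow_succ_dvd {n : ℕ} {r : R} (h : (p : R) ^ (n + 1) ∣ p ^ n * r) : (p : R) ∣ r := by
  obtain ⟨s, hs⟩ := h
  exact ⟨s, sub_eq_zero.1 (hU.eq_zero_of_pow_mul (n := n) (by rw [mul_sub, hs]; ring))⟩

end IsTwistedUnitGroup

/-! ## Ordered bases from congruence filtrations -/

namespace WeightedWords

theorem prod_ofFn_mul_of_central {Q : Type*} [Monoid Q] {d : ℕ} (a b : Fin d → Q)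
    (hb : ∀ i q, b i * q = q * b i) :
    (List.ofFn fun i => a i * b i).prod = (List.ofFn a).prod * (List.ofFn b).prod := by
  induction d with
  | zero => simp
  | succ d ih =>
    simp only [List.ofFn_succ, List.prod_cons]
    rw [ih (fun i => a i.succ) (fun i => b i.succ) fun i => hb i.succ, mul_assoc, mul_assoc,
      ← mul_assoc (b 0), ← mul_assoc _ (b 0), hb 0]

/-- Elements of K are central modulo L, so the factors g_i^{y_i} can be collected on the right. -/
theorem mk_mon_add {U : Type*} [Group U] {K L : Subgroup U} [L.Normal]
    (hK : ∀ u : U, ∀ v ∈ K, ⁅u, v⁆ ∈ L) {d : ℕ} (g : Fin d → U) (x y : Fin d → ℕ)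
    (hy : ∀ i, g i ^ y i ∈ K) :
    (QuotientGroup.mk (mon g (x + y)) : U ⧸ L) =
      QuotientGroup.mk (mon g x) * QuotientGroup.mk (mon g y) := by
  have h (y : Fin d → ℕ) := mon_map (QuotientGroup.mk' L) g y
  simp only [QuotientGroup.mk'_apply] at h
  rw [h, h, h, mon, mon, mon, ← prod_ofFn_mul_of_central]
  · simp only [Pi.add_apply, pow_add]
  · intro i q
    obtain ⟨q, rfl⟩ := QuotientGroup.mk_surjective q
    rw [← QuotientGroup.mk_pow, ← QuotientGroup.mk_mul, ← QuotientGroup.mk_mul, eq_comm]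
    rw [← mul_inv_eq_one, ← QuotientGroup.mk_inv, ← QuotientGroup.mk_mul, QuotientGroup.eq_one_iff]
    have := hK q _ (hy i)
    rwa [commutatorElement_def, mul_assoc _ q⁻¹, ← mul_inv_rev] at this

/-- Exponents in base `p`, digit by digit along a central filtration. -/
theorem existsUnique_exponent {p : ℕ} (hp : 0 < p) {U : Type*} [Group U] (K : ℕ → Subgroup U)
    [∀ n, (K n).Normal] (hanti : Antitone K) (h1 : ∀ u, u ∈ K 1)
    (hK : ∀ n, ∀ u : U, ∀ v ∈ K n, ⁅u, v⁆ ∈ K (n + 1))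
    {d : ℕ} (g : Fin d → U) (a e : ℕ → Fin d → ℕ) (ha : ∀ i, a 1 i = 0)
    (hae : ∀ n, 1 ≤ n → ∀ i, a (n + 1) i = a n i + e n i)
    (hpow : ∀ n, 1 ≤ n → ∀ i, e n i ≠ 0 → g i ^ p ^ a n i ∈ K n)
    (hdig : ∀ n, 1 ≤ n → ∀ h ∈ K n, ∃! t : Fin d → ℕ,
      (∀ i, t i < p ^ e n i) ∧ (mon g fun i => p ^ a n i * t i)⁻¹ * h ∈ K (n + 1))
    (n : ℕ) (hn : 1 ≤ n) (u : U) :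
    ∃! x : Fin d → ℕ, (∀ i, x i < p ^ a n i) ∧ (mon g x)⁻¹ * u ∈ K n := by
  induction n, hn using Nat.le_induction with
  | base =>
    refine ⟨0, ⟨fun i => by simp [ha], h1 _⟩, fun x hx => ?_⟩
    ext i
    have := hx.1 i
    rw [ha, pow_zero] at this
    simpa using this
  | succ n hn ih =>
    have hlow : ∀ t : Fin d → ℕ, (∀ i, t i < p ^ e n i) → ∀ i, g i ^ (p ^ a n i * t i) ∈ K n := by
      intro t ht i
      by_cases he : e n i = 0
      · have := ht i
        rw [he, pow_zero, Nat.lt_one_iff] at this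
        rw [this, mul_zero, pow_zero]
        exact one_mem _
      · rw [pow_mul]
        exact pow_mem (hpow n hn i he) _
    have hsplit : ∀ x t : Fin d → ℕ, (∀ i, t i < p ^ e n i) →
        ((mon g (x + fun i => p ^ a n i * t i))⁻¹ * u ∈ K (n + 1) ↔
          (mon g fun i => p ^ a n i * t i)⁻¹ * ((mon g x)⁻¹ * u) ∈ K (n + 1)) := by
      intro x t ht
      have h2 := mk_mon_add (hK n) g x (fun i => p ^ a n i * t i) (hlow t ht)
      rw [← QuotientGroup.eq, h2, ← mul_assoc, ← mul_inv_rev, ← QuotientGroup.eq,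
        QuotientGroup.mk_mul]
    have hmon : ∀ t : Fin d → ℕ, (∀ i, t i < p ^ e n i) → (mon g fun i => p ^ a n i * t i) ∈ K n := by
      intro t ht
      refine list_prod_mem fun b hb => ?_
      obtain ⟨i, rfl⟩ := List.mem_ofFn.1 hb
      exact hlow t ht i
    obtain ⟨x, ⟨hx, hxu⟩, hxuniq⟩ := ih
    obtain ⟨t, ⟨ht, htu⟩, htuniq⟩ := hdig n hn _ hxu
    refine ⟨x + fun i => p ^ a n i * t i, ⟨fun i => ?_, (hsplit x t ht).2 htu⟩, ?_⟩
    · rw [hae n hn, pow_add]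
      have h2 := hx i
      have h3 := ht i
      simp only [Pi.add_apply]
      calc x i + p ^ a n i * t i < p ^ a n i + p ^ a n i * t i := by omega
        _ = p ^ a n i * (t i + 1) := by ring
        _ ≤ _ := Nat.mul_le_mul_left _ h3
    · rintro x' ⟨hx', hxu'⟩
      have hpa : ∀ i, 0 < p ^ a n i := fun i => pow_pos hp _
      -- A competing exponent splits into its old digits, fixed by the induction hypothesis, and its
      -- new top digits, fixed by `hdig`.
      have e1 : x' = (fun i => x' i % p ^ a n i) + fun i => p ^ a n i * (x' i / p ^ a n i) := by
        ext i
        exact (Nat.mod_add_div _ _).symm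
      have ht' : ∀ i, x' i / p ^ a n i < p ^ e n i := fun i => by
        rw [Nat.div_lt_iff_lt_mul (hpa i), mul_comm, ← pow_add, ← hae n hn]
        exact hx' i
      rw [e1] at hxu'
      have h2 := (hsplit _ _ ht').1 hxu'
      have h3 : (mon g fun i => x' i % p ^ a n i)⁻¹ * u ∈ K n := by
        have := mul_mem (hmon _ ht') (hanti (Nat.le_succ n) h2)
        rwa [mul_inv_cancel_left] at this
      have h4 := hxuniq _ ⟨fun i => Nat.mod_lt _ (hpa i), h3⟩
      rw [h4] at h2
      have h5 := htuniq _ ⟨ht', h2⟩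
      rw [e1, h4]
      congr 1
      ext i
      rw [congrFun h5 i]

end WeightedWords

/-! ## Powers of generators -/

/-- The binomial terms of degree 2 ≤ k < p contain both p and V². -/
theorem exists_one_add_pow_eq {S : Type*} [CommRing S] {p : ℕ} (hp : p.Prime) (V : S) :
    ∃ r, (1 + V) ^ p = 1 + p * V + (p * V ^ 2 * r + V ^ p) := by
  obtain ⟨q, rfl⟩ : ∃ q, p = q + 2 := ⟨p - 2, by have := hp.two_le; omega⟩
  have h : ((q + 2 : ℕ) : S) * V ^ 2 ∣
      ∑ k ∈ Finset.range q, V ^ (k + 2) * ((q + 2).choose (k + 2) : S) := by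
    refine Finset.dvd_sum fun k hk => ?_
    rw [mul_comm]
    refine mul_dvd_mul ?_ (Nat.cast_dvd_cast (hp.dvd_choose_self (by omega) ?_))
    · exact pow_dvd_pow _ (by omega)
    · have := Finset.mem_range.1 hk; omega
  obtain ⟨r, hr⟩ := h
  refine ⟨r, ?_⟩
  rw [← hr, add_comm, add_pow, Finset.sum_range_succ, Finset.sum_range_succ',
    Finset.sum_range_succ']
  simp only [one_pow, mul_one, pow_zero, Nat.choose_zero_right, Nat.choose_self, Nat.cast_one,
    zero_add, pow_one, Nat.choose_one_right, add_assoc, Nat.reduceAdd]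
  ring

theorem exists_one_add_mul_pow_eq {S : Type*} [CommRing S] {p : ℕ} (hp : p.Prime) (η : S) (m : ℕ)
    (h3 : 3 ≤ p) : ∃ q, (1 + p * η) ^ p ^ m = 1 + p ^ (m + 1) * (η + p * q) := by
  induction m with
  | zero => exact ⟨0, by simp⟩
  | succ m ih =>
    obtain ⟨q, hq⟩ := ih
    obtain ⟨r, hr⟩ := exists_one_add_pow_eq hp ((p : S) ^ (m + 1) * (η + p * q))
    obtain ⟨l, rfl⟩ : ∃ l, p = l + 3 := ⟨p - 3, by omega⟩
    set P : S := ((l + 3 : ℕ) : S)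
    refine ⟨q + P ^ m * (η + P * q) ^ 2 * r + P ^ (m * (l + 2) + l) * (η + P * q) ^ (l + 3), ?_⟩
    rw [pow_succ (l + 3) m, pow_mul, hq, hr]
    -- The last binomial term is harmless because (m + 1)p ≥ m + 3, which uses p ≥ 3.
    have e : (P ^ (m + 1) * (η + P * q)) ^ (l + 3) =
        P ^ (m + 3) * (P ^ (m * (l + 2) + l) * (η + P * q) ^ (l + 3)) := by
      rw [mul_pow, ← pow_mul, ← mul_assoc, ← pow_add]
      congr 2
      ring
    rw [e]
    ring

/-- Since ω behaves like an element of valuation 1/2, the first p-th power produces ω^p of valuation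
p/2, which must be absorbed in p²; hence 4 ≤ p. For p = 3 the term ω³ = 3nω would change the leading
coefficient. -/
theorem exists_one_add_pow_eq_of_sq {S : Type*} [CommRing S] {p : ℕ} (hp : p.Prime) {ω n : S}
    (hω : ω ^ 2 = p * n) (m : ℕ) (h4 : 4 ≤ p) :
    ∃ q, (1 + ω) ^ p ^ m = 1 + p ^ m * (ω + p * q) := by
  induction m with
  | zero => exact ⟨0, by simp⟩
  | succ m ih =>
    obtain ⟨q, hq⟩ := ih
    obtain ⟨r, hr⟩ := exists_one_add_pow_eq hp ((p : S) ^ m * (ω + p * q))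
    obtain ⟨l, rfl⟩ : ∃ l, p = l + 4 := ⟨p - 4, by omega⟩
    set P : S := ((l + 4 : ℕ) : S)
    have h2 : (ω + P * q) ^ 2 = P * (n + 2 * ω * q + P * q ^ 2) := by
      linear_combination hω
    set s := n + 2 * ω * q + P * q ^ 2
    refine ⟨q + P ^ m * s * r + P ^ (m * (l + 3)) * s ^ 2 * (ω + P * q) ^ l, ?_⟩
    rw [pow_succ (l + 4) m, pow_mul, hq, hr]
    have e : (P ^ m * (ω + P * q)) ^ (l + 4) =
        P ^ (m + 2) * (P ^ (m * (l + 3)) * s ^ 2 * (ω + P * q) ^ l) := by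
      have e1 : (ω + P * q) ^ (l + 4) = (ω + P * q) ^ l * ((ω + P * q) ^ 2) ^ 2 := by
        rw [← pow_mul, ← pow_add]
      rw [mul_pow, e1, h2, ← pow_mul]
      ring
    rw [e, mul_pow (P ^ m), h2]
    ring

open scoped QuadraticAlgebra in
-- This commutative algebra models the powers of 1 + yΠ: ω stands for yΠ, and a for yσ(y), since
-- (yΠ)² = p yσ(y).
theorem QuadraticAlgebra.exists_one_add_omega_pow {R : Type*} [CommRing R] {p : ℕ} (hp : p.Prime)
    (h4 : 4 ≤ p) (a : R) (m : ℕ) : ∃ c e : R,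
      (1 + omega : QuadraticAlgebra R (p * a) 0) ^ p ^ m =
        ⟨1 + (p : R) ^ (m + 1) * c, (p : R) ^ m * (1 + p * e)⟩ := by
  have hω : (omega : QuadraticAlgebra R (p * a) 0) ^ 2 =
      (p : QuadraticAlgebra R (p * a) 0) * ⟨a, 0⟩ := by
    rw [← nsmul_eq_mul]
    ext <;> simp [sq]
  obtain ⟨q, hq⟩ := exists_one_add_pow_eq_of_sq hp hω m h4
  refine ⟨q.re, q.im, ?_⟩
  have e (n : ℕ) (z : QuadraticAlgebra R (p * a) 0) : (n : QuadraticAlgebra R (p * a) 0) * z =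
      n • z := (nsmul_eq_mul n z).symm
  rw [hq, ← Nat.cast_pow, e, e]
  ext <;> simp [-nsmul_eq_mul] <;> push_cast [nsmul_eq_mul] <;> ring

/-- Generators `1 + y_i Π` (of weight one) and `1 + p y_i` (of weight two) of a twisted unit group,
whose leading coefficients are bases over the prime field. -/
structure IsTwistedBasis (p : ℕ) {U R : Type*} [Group U] [CommRing R] (σ : R →+* R)
    (X Y : U → R) {d : ℕ} (u : Fin d → U) (w : Fin d → ℕ) (y : Fin d → R) : Prop extends
    IsTwistedUnitGroup p σ X Y where
  weight : ∀ i, w i = 1 ∨ w i = 2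
  X_gen_one : ∀ i, w i = 1 → X (u i) = 1
  Y_gen_one : ∀ i, w i = 1 → Y (u i) = y i
  X_gen_two : ∀ i, w i = 2 → X (u i) = 1 + p * y i
  Y_gen_two : ∀ i, w i = 2 → Y (u i) = 0
  digits_one : ∀ r, ∃! t : Fin d → ℕ, (∀ i, t i < p ^ (if w i = 1 then 1 else 0)) ∧
    (p : R) ∣ r - ∑ i, t i * y i
  digits_two : ∀ r, σ r = -r → ∃! t : Fin d → ℕ, (∀ i, t i < p ^ (if w i = 2 then 1 else 0)) ∧
    (p : R) ∣ r - ∑ i, t i * (y i - σ (y i))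
  lift : ∀ r, ∃ v, X v = 1 ∧ Y v = r
  comm : ∀ l, w l = 2 → ∃ a b, (p : R) ∣ 2 * (a * σ b - b * σ a) - (y l - σ (y l))

/-! ### Digit expansions along the congruence filtration -/

namespace IsTwistedBasis

variable {p : ℕ} {U R : Type*} [Group U] [CommRing R] {σ : R →+* R}
  {X Y : U → R} {d : ℕ} {u : Fin d → U} {w : Fin d → ℕ} {y : Fin d → R}
  (hT : IsTwistedBasis p σ X Y u w y)

include hT

theorem pow_gen_one [hp : Fact p.Prime] (h3 : 3 < p) {i : Fin d} (hi : w i = 1) (m : ℕ) :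
    (∃ c, X (u i ^ p ^ m) = 1 + (p : R) ^ (m + 1) * c) ∧
      ∃ q, Y (u i ^ p ^ m) = (p : R) ^ m * (y i + p * q) := by
  -- Sending ω to y_i Π turns re + im·ω into re + (im·y_i)Π, whence the factor y_i in the second
  -- coordinate.
  have key : ∀ n : ℕ, X (u i ^ n) =
        ((1 + QuadraticAlgebra.omega : QuadraticAlgebra R (p * (y i * σ (y i))) 0) ^ n).re ∧
      Y (u i ^ n) =
        y i * ((1 + QuadraticAlgebra.omega : QuadraticAlgebra R (p * (y i * σ (y i))) 0) ^ n).im := by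
    intro n
    induction n with
    | zero => simp [hT.X_one, hT.Y_one, QuadraticAlgebra.re_one, QuadraticAlgebra.im_one]
    | succ n ih =>
      rw [pow_succ, pow_succ, hT.X_mul, hT.Y_mul, ih.1, ih.2, hT.X_gen_one i hi,
        hT.Y_gen_one i hi]
      constructor
      · simp [QuadraticAlgebra.re_one, QuadraticAlgebra.im_one]
        ring
      · simp [QuadraticAlgebra.re_one, QuadraticAlgebra.im_one]
        ring
  obtain ⟨c, e, h⟩ := QuadraticAlgebra.exists_one_add_omega_pow hp.out h3 (y i * σ (y i)) m
  refine ⟨⟨c, by rw [(key _).1, h]⟩, ⟨e * y i, ?_⟩⟩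
  rw [(key _).2, h]
  ring

theorem pow_gen_two [hp : Fact p.Prime] (h3 : 3 < p) {i : Fin d} (hi : w i = 2) (m : ℕ) :
    (∃ q, X (u i ^ p ^ m) = 1 + (p : R) ^ (m + 1) * (y i + p * q)) ∧ Y (u i ^ p ^ m) = 0 := by
  have key : ∀ n : ℕ, X (u i ^ n) = (1 + p * y i) ^ n ∧ Y (u i ^ n) = 0 := by
    intro n
    induction n with
    | zero => simp [hT.X_one, hT.Y_one]
    | succ n ih =>
      rw [pow_succ, hT.X_mul, hT.Y_mul, ih.1, ih.2, hT.X_gen_two i hi, hT.Y_gen_two i hi]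
      simp [pow_succ]
  obtain ⟨q, hq⟩ := exists_one_add_mul_pow_eq hp.out (y i) m (by omega)
  exact ⟨⟨q, by rw [(key _).1, hq]⟩, (key _).2⟩

/-- The number of base `p` digits of the `i`-th exponent modulo the `n`-th congruence subgroup. -/
def numDigits (w : Fin d → ℕ) (n : ℕ) (i : Fin d) : ℕ := (n + 1 - w i) / 2

/-- Whether the `i`-th generator contributes to the `n`-th graded piece. -/
def active (w : Fin d → ℕ) (n : ℕ) (i : Fin d) : ℕ := if n % 2 = w i % 2 then 1 else 0

omit [CommRing R] [Group U] hT in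
theorem active_odd (hw : ∀ i, w i = 1 ∨ w i = 2) {n : ℕ} (hn : n % 2 = 1) (i : Fin d) :
    active w n i = if w i = 1 then 1 else 0 := by
  rw [active, hn]
  rcases hw i with h | h <;> simp [h]

omit [CommRing R] [Group U] hT in
theorem active_even (hw : ∀ i, w i = 1 ∨ w i = 2) {n : ℕ} (hn : n % 2 = 0) (i : Fin d) :
    active w n i = if w i = 2 then 1 else 0 := by
  rw [active, hn]
  rcases hw i with h | h <;> simp [h]

/-- The leading coefficient of the `i`-th generator. -/
def leadGen (σ : R →+* R) (y : Fin d → R) (n : ℕ) (i : Fin d) : R :=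
  if n % 2 = 1 then y i else y i - σ (y i)

theorem pow_gen [Fact p.Prime] (h3 : 3 < p) {n : ℕ} (hn : 1 ≤ n) {i : Fin d}
    (hi : active w n i ≠ 0) : u i ^ p ^ numDigits w n i ∈ hT.congr n ∧
      (p : R) ^ (n / 2 + 1) ∣ hT.lead n (u i ^ p ^ numDigits w n i) -
        (p : R) ^ (n / 2) * leadGen σ y n i := by
  have hpar : n % 2 = w i % 2 := by
    by_contra h
    exact hi (if_neg h)
  rw [hT.mem_congr]
  rcases hT.weight i with h | h <;> rw [h] at hpar
  · obtain ⟨⟨c, hc⟩, q, hq⟩ := hT.pow_gen_one h3 h (numDigits w n i)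
    have e1 : numDigits w n i = n / 2 := by rw [numDigits, h]; omega
    have e2 : (n + 1) / 2 = n / 2 + 1 := by omega
    rw [e1] at hc hq ⊢
    rw [IsTwistedUnitGroup.lead, if_pos (by omega), leadGen, if_pos (by omega), hc, hq, e2]
    refine ⟨⟨⟨c - σ c, ?_⟩, dvd_mul_right _ _⟩, ⟨q, by ring⟩⟩
    simp only [map_add, map_mul, map_pow, map_natCast, map_one]
    ring
  · obtain ⟨⟨q, hq⟩, hc⟩ := hT.pow_gen_two h3 h (numDigits w n i)
    have e1 : numDigits w n i + 1 = n / 2 := by rw [numDigits, h]; omega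
    have e2 : (n + 1) / 2 = n / 2 := by omega
    rw [e1] at hq
    rw [IsTwistedUnitGroup.lead, if_neg (by omega), leadGen, if_neg (by omega), hc, hq, e2]
    refine ⟨⟨⟨y i + p * q - σ (y i + p * q), ?_⟩, dvd_zero _⟩, ⟨q - σ q, ?_⟩⟩
    all_goals
      simp only [map_add, map_mul, map_pow, map_natCast, map_one]
      ring

/-- Divide the leading coefficient by p^(n/2) and expand modulo p. For even n the quotient is
σ-anti-invariant, because X - σ(X) is and p is regular. -/
theorem digits {n : ℕ} {h : U} (hh : h ∈ hT.congr n) :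
    ∃! t : Fin d → ℕ, (∀ i, t i < p ^ active w n i) ∧
      (p : R) ^ (n / 2 + 1) ∣ hT.lead n h - (p : R) ^ (n / 2) * ∑ i, t i * leadGen σ y n i := by
  obtain ⟨r, hr⟩ := hT.dvd_lead hh
  have key : ∀ s : R, (p : R) ^ (n / 2 + 1) ∣ hT.lead n h - (p : R) ^ (n / 2) * s ↔
      (p : R) ∣ r - s := by
    intro s
    rw [hr, ← mul_sub]
    refine ⟨hT.dvd_of_pow_succ_dvd, fun h => ?_⟩
    rw [pow_succ]
    exact mul_dvd_mul_left _ h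
  simp only [key]
  rcases Nat.mod_two_eq_zero_or_one n with hp | hp
  · simp only [active_even hT.weight hp, leadGen, hp, zero_ne_one, if_false]
    refine hT.digits_two r ?_
    rw [IsTwistedUnitGroup.lead, if_neg (by omega)] at hr
    have h1 := congrArg σ hr
    simp only [map_sub, hT.σ_σ, map_mul, map_pow, map_natCast] at h1
    rw [← add_eq_zero_iff_eq_neg]
    refine hT.eq_zero_of_pow_mul (n := n / 2) ?_
    linear_combination -h1 - hr
  · simp only [active_odd hT.weight hp, leadGen, hp, if_true]
    exact hT.digits_one r

/-- The leading coefficient turns the multiplicative congruence into an additive digit problem. -/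
theorem existsUnique_digits [Fact p.Prime] (h3 : 3 < p) {n : ℕ} (hn : 1 ≤ n) {h : U}
    (hh : h ∈ hT.congr n) : ∃! t : Fin d → ℕ, (∀ i, t i < p ^ active w n i) ∧
      (mon u fun i => p ^ numDigits w n i * t i)⁻¹ * h ∈ hT.congr (n + 1) := by
  have key : ∀ t : Fin d → ℕ, (∀ i, t i < p ^ active w n i) →
      ((mon u fun i => p ^ numDigits w n i * t i)⁻¹ * h ∈ hT.congr (n + 1) ↔
        (p : R) ^ (n / 2 + 1) ∣ hT.lead n h -
          (p : R) ^ (n / 2) * ∑ i, t i * leadGen σ y n i) := by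
    intro t ht
    have ht0 : ∀ i, active w n i = 0 → t i = 0 := fun i hi => by
      have := ht i
      rwa [hi, pow_zero, Nat.lt_one_iff] at this
    classical
    -- The digit of an inactive generator is forced to be 0, so the default value 1 does no harm.
    let v : Fin d → hT.congr n := fun i =>
      if hi : active w n i ≠ 0 then ⟨_, (hT.pow_gen h3 hn hi).1⟩ else 1
    have hv : (mon u fun i => p ^ numDigits w n i * t i) = (mon v t : hT.congr n) := by
      have := mon_map (hT.congr n).subtype v t
      rw [Subgroup.subtype_apply] at this
      rw [this, mon, mon]
      congr 2
      ext i
      by_cases hi : active w n i = 0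
      · rw [ht0 i hi, mul_zero, pow_zero, pow_zero]
      · simp only [v, dif_pos hi, Subgroup.subtype_apply, pow_mul]
    rw [hv, hT.inv_mul_mem_congr hh (mon v t).2]
    have h1 := hT.lead_mon v t
    have h2 : (p : R) ^ (n / 2 + 1) ∣ ∑ i, t i * hT.lead n (v i) -
        (p : R) ^ (n / 2) * ∑ i, t i * leadGen σ y n i := by
      rw [Finset.mul_sum, ← Finset.sum_sub_distrib]
      refine Finset.dvd_sum fun i _ => ?_
      by_cases hi : active w n i = 0
      · simp [ht0 i hi]
      · have h3 := (hT.pow_gen h3 hn hi).2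
        have h4 : (t i : R) * hT.lead n (v i) - (p : R) ^ (n / 2) * (t i * leadGen σ y n i) =
            t i * (hT.lead n (v i) - (p : R) ^ (n / 2) * leadGen σ y n i) := by ring
        rw [h4]
        simp only [v, dif_pos hi]
        exact h3.mul_left _
    have h3 := dvd_add h1 h2
    rw [sub_add_sub_cancel] at h3
    constructor
    · intro h
      have := dvd_add h h3
      rwa [sub_add_sub_cancel] at this
    · intro h
      have := dvd_sub h h3
      rwa [sub_sub_sub_cancel_right] at this
  obtain ⟨t, ⟨ht, ht'⟩, huniq⟩ := hT.digits hh
  exact ⟨t, ⟨ht, (key t ht).2 ht'⟩, fun s hs => huniq s ⟨hs.1, (key s hs.1).1 hs.2⟩⟩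

theorem existsUnique_mon [hp : Fact p.Prime] (h3 : 3 < p) {n : ℕ} (hn : 1 ≤ n) (v : U) :
    ∃! x : Fin d → ℕ, (∀ i, x i < p ^ numDigits w n i) ∧ (mon u x)⁻¹ * v ∈ hT.congr n := by
  have := hT.congr_normal
  refine existsUnique_exponent hp.out.pos hT.congr hT.congr_anti hT.mem_congr_one
    (fun n u v hv => hT.commutator_mem u hv) u (numDigits w) (active w) (fun i => ?_)
    (fun n hn i => ?_) (fun n hn i hi => (hT.pow_gen h3 hn hi).1)
    (fun n hn h hh => hT.existsUnique_digits h3 hn hh) n hn v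
  · rw [numDigits]
    rcases hT.weight i with h | h <;> rw [h]
  · rw [numDigits, numDigits, active]
    rcases hT.weight i with h | h <;> rw [h] <;> split_ifs <;> omega

/-- For a = 1 + rΠ and b = 1 + sΠ, the commutator has X - σ(X) ≡ 2p(rσ(s) - sσ(r)) modulo p²; the 2
arises because X(ab) and σ(X(ba)) both equal 1 + p rσ(s). The field `comm` says that such values
reach the leading coefficient of the generator. -/
theorem exists_commutator {l : Fin d} (hl : w l = 2) :
    ∃ a b : U, ⁅a, b⁆⁻¹ * u l ∈ hT.congr 3 := by
  obtain ⟨r, s, hrs⟩ := hT.comm l hl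
  obtain ⟨a, ha, ha'⟩ := hT.lift r
  obtain ⟨b, hb, hb'⟩ := hT.lift s
  refine ⟨a, b, ?_⟩
  have h1 : ⁅a, b⁆ ∈ hT.congr 2 := hT.commutator_mem a (hT.mem_congr_one b)
  have h2 : u l ∈ hT.congr 2 := by
    rw [hT.mem_congr, hT.X_gen_two l hl, hT.Y_gen_two l hl]
    refine ⟨⟨y l - σ (y l), ?_⟩, dvd_zero _⟩
    simp only [map_add, map_mul, map_natCast, map_one]
    ring
  rw [hT.inv_mul_mem_congr h2 h1]
  simp only [IsTwistedUnitGroup.lead, show 2 % 2 ≠ 1 by norm_num, if_false]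
  have e : ⁅a, b⁆ = a * b * (b * a)⁻¹ := by simp [commutatorElement_def, mul_assoc]
  have h4 := hT.X_mul_inv (a * b) (b * a)
  rw [← e] at h4
  obtain ⟨n, hn⟩ := hT.norm_eq (b * a)
  rw [hn] at h4
  simp only [hT.X_mul, hT.Y_mul, ha, hb, ha', hb', map_add, map_mul, map_one, map_natCast,
    hT.σ_σ] at h4 hn
  have hnσ := congrArg σ hn
  simp only [map_add, map_sub, map_mul, map_one, map_natCast, hT.σ_σ] at hnσ
  have h5 := congrArg σ h4
  simp only [map_add, map_sub, map_mul, map_one, map_natCast, hT.σ_σ] at h5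
  obtain ⟨c, hc⟩ := h1.1
  obtain ⟨q, hq⟩ := hrs
  rw [show (2 + 1) / 2 = 1 by norm_num, pow_one] at hc
  -- The reduced norm 1 + pn is σ-invariant.
  have hnn : (p : R) * n = p * σ n := by linear_combination hnσ - hn
  rw [hT.X_gen_two l hl]
  simp only [map_add, map_mul, map_natCast, map_one]
  refine ⟨c * n - q - (r * σ s - s * σ r) * (r * σ s + s * σ r), ?_⟩
  simp only [show 2 / 2 + 1 = 2 by norm_num]
  linear_combination (-1 : R) * h4 + h5 + (p : R) * n * hc + σ (X ⁅a, b⁆) * hnn - (p : R) * hq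

end IsTwistedBasis

/-! ### Passage to the quotient by the centre -/

namespace IsTwistedBasis

variable {p : ℕ} {U R : Type*} [Group U] [CommRing R] {σ : R →+* R}
  {X Y : U → R} {d : ℕ} {u : Fin d → U} {w : Fin d → ℕ} {y : Fin d → R}
  (hT : IsTwistedBasis p σ X Y u w y) (Z : Subgroup U) [Z.Normal]
  (hZ : ∀ z ∈ Z, σ (X z) = X z ∧ Y z = 0)

/-- The image of the congruence filtration modulo the central subgroup `Z`. -/
def quotCongr (m : ℕ) : Subgroup (U ⧸ Z) :=
  (hT.congr (2 * m + 1)).map (QuotientGroup.mk' Z)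

theorem quotCongr_normal (m : ℕ) : (hT.quotCongr Z m).Normal :=
  have := hT.congr_normal (2 * m + 1)
  Subgroup.Normal.map this _ (QuotientGroup.mk'_surjective Z)

include hZ

theorem mk_mem_quotCongr {m : ℕ} {v : U} :
    (QuotientGroup.mk v : U ⧸ Z) ∈ hT.quotCongr Z m ↔ v ∈ hT.congr (2 * m + 1) := by
  have hle : Z ≤ hT.congr (2 * m + 1) := fun z hz => by
    obtain ⟨h1, h2⟩ := hZ z hz
    rw [hT.mem_congr, h1, h2, sub_self]
    exact ⟨dvd_zero _, dvd_zero _⟩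
  constructor
  · rintro ⟨v', hv', h⟩
    have h1 : v'⁻¹ * v ∈ Z := QuotientGroup.eq.1 h
    have := mul_mem hv' (hle h1)
    rwa [mul_inv_cancel_left] at this
  · exact fun h => ⟨v, h, rfl⟩

theorem isOrderedBasis [Fact p.Prime] (h3 : 3 < p) :
    IsOrderedBasis p (fun i => (QuotientGroup.mk (u i) : U ⧸ Z)) w (hT.quotCongr Z) := by
  have hmon : ∀ x, mon (fun i => (QuotientGroup.mk (u i) : U ⧸ Z)) x = QuotientGroup.mk (mon u x) :=
    fun x => (mon_map (QuotientGroup.mk' Z) u x).symm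
  have hcomm : ∀ a b : U, (QuotientGroup.mk ⁅a, b⁆ : U ⧸ Z) =
      ⁅(QuotientGroup.mk a : U ⧸ Z), (QuotientGroup.mk b : U ⧸ Z)⁆ :=
    fun a b => map_commutatorElement (QuotientGroup.mk' Z) a b
  have hgen2 : ∀ i, w i = 2 → u i ∈ hT.congr 2 := fun i hi => by
    rw [hT.mem_congr, hT.X_gen_two i hi, hT.Y_gen_two i hi]
    refine ⟨⟨y i - σ (y i), ?_⟩, dvd_zero _⟩
    simp only [map_add, map_mul, map_natCast, map_one]
    ring
  refine ⟨fun m n h => Subgroup.map_mono (hT.congr_anti (by omega)), hT.weight, fun m v => ?_,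
    fun m i => ?_, fun i j hij => ?_, fun i j hij => ?_, fun l hl => ?_⟩
  · obtain ⟨v, rfl⟩ := QuotientGroup.mk_surjective v
    simp only [hmon, ← QuotientGroup.mk_inv, ← QuotientGroup.mk_mul, hT.mk_mem_quotCongr Z hZ]
    have h := hT.existsUnique_mon h3 (n := 2 * m + 1) (by omega) v
    -- At the odd level 2m + 1 generators of both weights have exactly m digits.
    have e : ∀ i, numDigits w (2 * m + 1) i = m := fun i => by
      rw [numDigits]
      rcases hT.weight i with h | h <;> rw [h] <;> omega
    simpa only [e] using h
  · rw [← QuotientGroup.mk_pow, hT.mk_mem_quotCongr Z hZ]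
    rcases hT.weight i with h | h
    · have h1 := (hT.pow_gen h3 (n := 2 * m + 1) (i := i) (by omega)
        (by rw [active, h, if_pos (by omega)]; exact one_ne_zero)).1
      rwa [show numDigits w (2 * m + 1) i = m by rw [numDigits, h]; omega] at h1
    -- A generator of weight two is active only at even levels; its power lies one level deeper than
    -- required.
    · have h1 := (hT.pow_gen h3 (n := 2 * m + 2) (i := i) (by omega)
        (by rw [active, h, if_pos (by omega)]; exact one_ne_zero)).1
      rw [show numDigits w (2 * m + 2) i = m by rw [numDigits, h]; omega] at h1
      exact hT.congr_anti (Nat.le_succ _) h1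
  · rw [← hcomm, hT.mk_mem_quotCongr Z hZ]
    by_cases hj : w j = 2
    · exact hT.commutator_mem _ (hgen2 j hj)
    · have hi : w i = 2 := by
        rcases hT.weight i with h | h <;> rcases hT.weight j with h' | h' <;> omega
      rw [← commutatorElement_inv]
      exact inv_mem (hT.commutator_mem _ (hgen2 i hi))
  -- A commutator lies in level 2, where only generators of weight two are active; this gives the
  -- condition on the support of t.
  · obtain ⟨t, ⟨ht, h1⟩, -⟩ := hT.existsUnique_digits h3 (n := 2) (by omega)
      (hT.commutator_mem (u i) (hT.mem_congr_one (u j)))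
    refine ⟨fun l => p ^ numDigits w 2 l * t l, fun l hl => ?_, ?_⟩
    · by_contra h
      have := ht l
      rw [active_even hT.weight (by norm_num), if_neg h, pow_zero, Nat.lt_one_iff] at this
      exact hl (by simp [this])
    · rw [hmon, ← hcomm, ← QuotientGroup.mk_inv, ← QuotientGroup.mk_mul, hT.mk_mem_quotCongr Z hZ]
      exact h1
  · obtain ⟨a, b, hab⟩ := hT.exists_commutator hl
    refine ⟨QuotientGroup.mk a, QuotientGroup.mk b, ?_⟩
    rw [← hcomm, ← QuotientGroup.mk_inv, ← QuotientGroup.mk_mul, hT.mk_mem_quotCongr Z hZ]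
    exact hab

/-- Expansions in the completed group ring of `U ⧸ Z`, and the powers of its maximal ideal. -/
theorem completedGroupRing [Fact p.Prime] (h3 : 3 < p) [TopologicalSpace U]
    (hopen : ∀ n, IsOpen (hT.congr n : Set U))
    (hcof : ∀ V : Subgroup U, IsOpen (V : Set U) → Z ≤ V → ∃ n, hT.congr n ≤ V)
    {F : Type*} [Field F] [Finite F] [CharP F p] {ω : U ⧸ Z → ℝ≥0∞} {g : Fin d → U ⧸ Z}
    (hg : ∀ i, g i = QuotientGroup.mk (u i)) (hω : ∀ i, 2 * ω (g i) = w i) :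
    (∀ y : CompletedGroupRing F (U ⧸ Z),
        ∃! c : (Fin d → ℕ) → F, CompletedGroupRing.IsExpansion g c y) ∧
      ∃ 𝔪 : Ideal (CompletedGroupRing F (U ⧸ Z)), 𝔪.IsTwoSided ∧
        (∀ I : Ideal (CompletedGroupRing F (U ⧸ Z)), I.IsMaximal ↔ I = 𝔪) ∧
        ∀ j : ℕ, ((𝔪 ^ j : Ideal (CompletedGroupRing F (U ⧸ Z))) :
          Set (CompletedGroupRing F (U ⧸ Z))) =
            {y | (j : ℝ≥0∞) ≤ CompletedGroupRing.nu ω g y} := by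
  obtain rfl : g = fun i => QuotientGroup.mk (u i) := funext hg
  let N : ℕ → OpenNormalSubgroup (U ⧸ Z) := fun m =>
    { toSubgroup := hT.quotCongr Z m
      isOpen' := by
        refine isOpen_coinduced.2 ?_
        convert hopen (2 * m + 1) using 1
        ext v
        exact hT.mk_mem_quotCongr Z hZ
      isNormal' := hT.quotCongr_normal Z m }
  refine IsOrderedBasis.completedGroupRing (N := N) (hT.isOrderedBasis Z hZ h3) (fun V => ?_) h3 hω
  obtain ⟨n, hn⟩ := hcof ((V : Subgroup (U ⧸ Z)).comap (QuotientGroup.mk' Z))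
    (V.isOpen'.preimage QuotientGroup.continuous_mk) (fun z hz => by
      have h1 : QuotientGroup.mk' Z z = 1 := (QuotientGroup.eq_one_iff z).2 hz
      rw [Subgroup.mem_comap, h1]
      exact one_mem _)
  refine ⟨n, ?_⟩
  rintro _ ⟨v, hv, rfl⟩
  exact hn (hT.congr_anti (by omega) hv)

end IsTwistedBasis

/-! ## Digits in finite fields -/

theorem existsUnique_sum_smul_pow {K L : Type*} [Field K] [Field L] [Algebra K L]
    [FiniteDimensional K L] {x : L} (hx : IntermediateField.adjoin K {x} = ⊤) {n : ℕ}
    (hn : Module.finrank K L = n) (s : L) :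
    ∃! c : Fin n → K, s = ∑ i, algebraMap K L (c i) * x ^ (i : ℕ) := by
  have hdeg := (Field.primitive_element_iff_minpoly_natDegree_eq K x).1 hx
  rw [hn] at hdeg
  have hli := linearIndependent_pow (K := K) x
  rw [hdeg] at hli
  have e : ∀ c : Fin n → K, ∑ i, algebraMap K L (c i) * x ^ (i : ℕ) =
      ∑ i, c i • x ^ (i : ℕ) := fun c => by simp only [Algebra.smul_def]
  simp only [e]
  let b := basisOfLinearIndependentOfCardEqFinrank' _ hli (by rw [Fintype.card_fin, hn])
  have hb : ∀ i, b i = x ^ (i : ℕ) := fun i => by simp [b]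
  refine ⟨b.repr s, ?_, fun c hc => ?_⟩
  · simpa only [hb] using (b.sum_repr s).symm
  · simp only [← hb] at hc
    rw [hc, b.repr_sum_self]

theorem existsUnique_digits_field {p : ℕ} [Fact p.Prime] {f : ℕ} {k : Type*} [Field k] [Fintype k]
    [CharP k p] (hk : Fintype.card k = p ^ f) {α : k} (hα : Subfield.closure {α} = ⊤) (s : k) :
    ∃! t : Fin f → ℕ, (∀ i, t i < p) ∧ s = ∑ i, (t i : k) * α ^ (i : ℕ) := by
  let _ := ZMod.algebra k p
  have hp1 := (Fact.out : p.Prime).one_lt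
  have htop : IntermediateField.adjoin (ZMod p) {α} = ⊤ := by
    rw [eq_top_iff]
    intro x _
    have hx : x ∈ Subfield.closure {α} := by rw [hα]; trivial
    exact (Subfield.closure_le (t := (IntermediateField.adjoin (ZMod p) {α}).toSubfield)).2
      (IntermediateField.subset_adjoin _ _) hx
  have hfin : Module.finrank (ZMod p) k = f := by
    have h := Module.card_eq_pow_finrank (K := ZMod p) (V := k)
    rw [hk, ZMod.card] at h
    exact (Nat.pow_right_injective hp1 h).symm
  obtain ⟨c, hc, hu⟩ := existsUnique_sum_smul_pow htop hfin s
  refine ⟨fun i => (c i).val, ⟨fun i => ZMod.val_lt _, ?_⟩, fun t ht => ?_⟩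
  · rw [hc]
    refine Finset.sum_congr rfl fun i _ => ?_
    rw [← map_natCast (algebraMap (ZMod p) k), ZMod.natCast_zmod_val]
  · have := hu (fun i => (t i : ZMod p)) (by rw [ht.2]; simp)
    ext i
    rw [← this, ZMod.val_natCast_of_lt (ht.1 i)]

section Append

variable {f : ℕ}

/-- The weights of the generators `A_i`, `B_i`, `C_i`. -/
def genWeight (f : ℕ) : Fin (f + f + f) → ℕ :=
  Fin.append (Fin.append (fun _ : Fin f => 1) fun _ : Fin f => 1) fun _ : Fin f => 2

theorem genWeight_eq (i : Fin (f + f + f)) : genWeight f i = 1 ∨ genWeight f i = 2 := by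
  refine Fin.addCases (fun i => Fin.addCases (fun i => ?_) (fun i => ?_) i) (fun i => ?_) i <;>
    simp only [genWeight, Fin.append_left, Fin.append_right] <;> simp

theorem forall_append {P : Fin (f + f + f) → Prop} : (∀ i, P i) ↔
    (∀ i : Fin f, P (Fin.castAdd f (Fin.castAdd f i))) ∧
      (∀ i : Fin f, P (Fin.castAdd f (Fin.natAdd f i))) ∧
        ∀ i : Fin f, P (Fin.natAdd (f + f) i) := by
  refine ⟨fun h => ⟨fun i => h _, fun i => h _, fun i => h _⟩, fun ⟨h1, h2, h3⟩ i => ?_⟩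
  exact Fin.addCases (fun i => Fin.addCases h1 h2 i) h3 i

theorem genWeight_A (i : Fin f) : genWeight f (Fin.castAdd f (Fin.castAdd f i)) = 1 := by
  simp [genWeight]

theorem genWeight_B (i : Fin f) : genWeight f (Fin.castAdd f (Fin.natAdd f i)) = 1 := by
  rw [genWeight, Fin.append_left, Fin.append_right]

theorem genWeight_C (i : Fin f) : genWeight f (Fin.natAdd (f + f) i) = 2 := by
  simp [genWeight]

variable {p : ℕ} [Fact p.Prime] {k : Type*} [Field k] [Fintype k]
    [CharP k p] (hk : Fintype.card k = p ^ f) {α : k} (hα : Subfield.closure {α} = ⊤)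
    {S : Type*} [CommRing S] (φ : k →+* S)

include hk hα

/-- Combines a k-basis of S with the 𝔽_p-basis of powers of α; the bound p^0 forces the digits of
weight two to vanish. -/
theorem existsUnique_digits_one {e₁ e₂ : S}
    (h : ∀ s, ∃! ab : k × k, s = φ ab.1 * e₁ + φ ab.2 * e₂) {y : Fin (f + f + f) → S}
    (hy₁ : ∀ i : Fin f, y (Fin.castAdd f (Fin.castAdd f i)) = φ (α ^ (i : ℕ)) * e₁)
    (hy₂ : ∀ i : Fin f, y (Fin.castAdd f (Fin.natAdd f i)) = φ (α ^ (i : ℕ)) * e₂) (s : S) :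
    ∃! t : Fin (f + f + f) → ℕ, (∀ i, t i < p ^ (if genWeight f i = 1 then 1 else 0)) ∧
      s = ∑ i, t i * y i := by
  obtain ⟨⟨a, b⟩, hab, huniq⟩ := h s
  obtain ⟨t, ⟨ht, hta⟩, htu⟩ := existsUnique_digits_field hk hα a
  obtain ⟨t', ⟨ht', htb⟩, htu'⟩ := existsUnique_digits_field hk hα b
  simp only [forall_append, genWeight_A, genWeight_B, genWeight_C, if_true, pow_one,
    show (2 : ℕ) ≠ 1 by norm_num, if_false, pow_zero, Nat.lt_one_iff, Fin.sum_univ_add, hy₁, hy₂]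
  have hφ : ∀ t : Fin f → ℕ, ∀ e : S, φ (∑ i, (t i : k) * α ^ (i : ℕ)) * e =
      ∑ i, (t i : S) * (φ (α ^ (i : ℕ)) * e) := fun t e => by
    simp only [map_sum, map_mul, map_natCast, Finset.sum_mul, mul_assoc]
  refine ⟨Fin.append (Fin.append t t') 0, ?_, ?_⟩
  · simp only [Fin.append_left, Fin.append_right, Pi.zero_apply, Nat.cast_zero, zero_mul,
      Finset.sum_const_zero, add_zero, ← hφ]
    exact ⟨⟨ht, ht', fun _ => trivial⟩, by rw [← hta, ← htb]; exact hab⟩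
  · rintro r ⟨⟨h1, h2, h3⟩, hs⟩
    simp only [h3, Nat.cast_zero, zero_mul, Finset.sum_const_zero, add_zero, ← hφ] at hs
    have h4 := huniq (_, _) hs
    have h5 := htu _ ⟨h1, (congrArg Prod.fst h4).symm⟩
    have h6 := htu' _ ⟨h2, (congrArg Prod.snd h4).symm⟩
    funext i
    revert i
    rw [forall_append]
    refine ⟨fun i => ?_, fun i => ?_, fun i => ?_⟩
    · simpa only [Fin.append_left] using congrFun h5 i
    · simpa only [Fin.append_left, Fin.append_right] using congrFun h6 i
    · simpa only [Fin.append_right, Pi.zero_apply] using h3 i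

theorem existsUnique_digits_two {δ : S} {s : S} (h : ∃! a : k, s = φ a * δ)
    {y : Fin (f + f + f) → S} (hy : ∀ i : Fin f, y (Fin.natAdd (f + f) i) = φ (α ^ (i : ℕ)) * δ) :
    ∃! t : Fin (f + f + f) → ℕ, (∀ i, t i < p ^ (if genWeight f i = 2 then 1 else 0)) ∧
      s = ∑ i, t i * y i := by
  obtain ⟨a, ha, huniq⟩ := h
  obtain ⟨t, ⟨ht, hta⟩, htu⟩ := existsUnique_digits_field hk hα a
  simp only [forall_append, genWeight_A, genWeight_B, genWeight_C, if_true, pow_one,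
    show (1 : ℕ) ≠ 2 by norm_num, if_false, pow_zero, Nat.lt_one_iff, Fin.sum_univ_add, hy]
  have hφ : ∀ t : Fin f → ℕ, φ (∑ i, (t i : k) * α ^ (i : ℕ)) * δ =
      ∑ i, (t i : S) * (φ (α ^ (i : ℕ)) * δ) := fun t => by
    simp only [map_sum, map_mul, map_natCast, Finset.sum_mul, mul_assoc]
  refine ⟨Fin.append 0 t, ?_, ?_⟩
  · simp only [Fin.append_left, Fin.append_right, Pi.zero_apply, Nat.cast_zero, zero_mul,
      Finset.sum_const_zero, zero_add, ← hφ]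
    exact ⟨⟨fun _ => trivial, fun _ => trivial, ht⟩, by rw [← hta]; exact ha⟩
  · rintro r ⟨⟨h1, h2, h3⟩, hs⟩
    simp only [h1, h2, Nat.cast_zero, zero_mul, Finset.sum_const_zero, zero_add, ← hφ] at hs
    have h4 := huniq _ hs
    have h5 := htu _ ⟨h3, h4.symm⟩
    funext i
    revert i
    rw [forall_append]
    refine ⟨fun i => ?_, fun i => ?_, fun i => ?_⟩
    · simpa only [Fin.append_left, Pi.zero_apply] using h1 i
    · simpa only [Fin.append_left, Pi.zero_apply] using h2 i
    · simpa only [Fin.append_right] using congrFun h5 i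

end Append

/-! ## The `p`-adic topology -/

namespace WittVector

variable {p : ℕ} [Fact p.Prime] {k : Type*} [CommRing k]

theorem nhds_eq_iInf (x : WittVector p k) :
    nhds x = ⨅ n : ℕ, Filter.principal {y | (p : WittVector p k) ^ n ∣ y - x} := by
  have h := (Ideal.hasBasis_nhds_adic (Ideal.span {(p : WittVector p k)}) x).eq_iInf
  refine h.trans (iInf_congr fun n => ?_)
  congr 1
  ext y
  rw [Ideal.span_singleton_pow]
  constructor
  · rintro ⟨z, hz, rfl⟩
    simpa [Ideal.mem_span_singleton] using hz
  · intro hy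
    exact ⟨y - x, Ideal.mem_span_singleton.2 hy, by simp⟩

/-- There are finitely many coordinates and the basic neighbourhoods decrease, so one exponent n
works for all of them. -/
theorem mem_nhds_iff {U ι : Type*} [Finite ι] (Φ : ι → U → WittVector p k) (u : U) (V : Set U) :
    V ∈ @nhds U (⨅ i, TopologicalSpace.induced (Φ i) inferInstance) u ↔
      ∃ n : ℕ, ∀ v, (∀ i, (p : WittVector p k) ^ n ∣ Φ i v - Φ i u) → v ∈ V := by
  rw [nhds_iInf]
  simp only [nhds_induced, nhds_eq_iInf, Filter.comap_iInf, Filter.comap_principal]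
  rw [iInf_comm]
  simp only [Filter.iInf_principal]
  rw [Filter.mem_iInf_of_directed]
  · simp only [Filter.mem_principal, Set.subset_def, Set.mem_iInter, Set.mem_preimage,
      Set.mem_ofPred_eq]
  · refine Antitone.directed_ge fun m n hmn => Filter.principal_mono.2 fun v hv => ?_
    simp only [Set.mem_iInter, Set.mem_preimage, Set.mem_ofPred_eq] at hv ⊢
    exact fun i => (pow_dvd_pow _ hmn).trans (hv i)

end WittVector

/-! ## Topological twisted unit groups -/

namespace IsTwistedUnitGroup

variable {p : ℕ} {U R : Type*} [Group U] [CommRing R] {σ : R →+* R} {X Y : U → R}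
  (hU : IsTwistedUnitGroup p σ X Y) [TopologicalSpace U]
  (hnhds : ∀ (u : U) (V : Set U), V ∈ nhds u ↔ ∃ n : ℕ, ∀ v, (p : R) ^ n ∣ X v - X u →
    (p : R) ^ n ∣ Y v - Y u → (p : R) ^ n ∣ X v⁻¹ - X u⁻¹ → (p : R) ^ n ∣ Y v⁻¹ - Y u⁻¹ → v ∈ V)

include hnhds

theorem isOpen_congr (n : ℕ) : IsOpen (hU.congr n : Set U) := by
  rw [isOpen_iff_mem_nhds]
  intro u hu
  rw [hnhds]
  refine ⟨n, fun v h1 h2 _ _ => ?_⟩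
  rw [SetLike.mem_coe, hU.mem_congr] at hu ⊢
  have h3 := RingHom.natCast_pow_dvd_map σ h1
  rw [map_sub] at h3
  constructor
  · have := ((pow_dvd_pow (p : R) (show (n + 1) / 2 ≤ n by omega)).trans
      (dvd_sub h1 h3)).add hu.1
    convert this using 1
    ring
  · have := ((pow_dvd_pow (p : R) (show n / 2 ≤ n by omega)).trans h2).add hu.2
    convert this using 1
    ring

/-- The filtration controls u only modulo the centre. Dividing by a central z with X z close to X u
brings u near 1, hence into V, and Z ≤ V restores u. -/
theorem exists_congr_le {Z : Subgroup U} (hZ : ∀ z ∈ Z, σ (X z) = X z ∧ Y z = 0)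
    (hcent : ∀ n : ℕ, 1 ≤ n → ∀ u, (p : R) ^ n ∣ X u - σ (X u) →
      ∃ z ∈ Z, (p : R) ^ n ∣ X u - X z)
    {V : Subgroup U} (hV : IsOpen (V : Set U)) (hle : Z ≤ V) : ∃ n, hU.congr n ≤ V := by
  obtain ⟨M, hM⟩ := (hnhds 1 V).1 (hV.mem_nhds V.one_mem)
  simp only [hU.X_one, hU.Y_one, inv_one, sub_zero] at hM
  -- M may be 0, whereas `hcent` needs a positive exponent.
  refine ⟨2 * (M + 1), fun u hu => ?_⟩
  rw [hU.mem_congr, show (2 * (M + 1) + 1) / 2 = M + 1 by omega,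
    show 2 * (M + 1) / 2 = M + 1 by omega] at hu
  obtain ⟨z, hz, hzu⟩ := hcent (M + 1) (by omega) u hu.1
  suffices h : u * z⁻¹ ∈ V by
    have := V.mul_mem h (hle hz)
    rwa [inv_mul_cancel_right] at this
  obtain ⟨hz1, hz2⟩ := hZ z⁻¹ (inv_mem hz)
  set v := u * z⁻¹ with hv
  have hX : X v = X u * X z⁻¹ := by rw [hv, hU.X_mul, hz2, map_zero]; ring
  have hY : Y v = Y u * X z⁻¹ := by rw [hv, hU.Y_mul, hz2, hz1]; ring
  have hzz : X z * X z⁻¹ = 1 := by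
    have := hU.X_mul z z⁻¹
    rw [mul_inv_cancel, hU.X_one, hz2, map_zero] at this
    linear_combination -this
  have hpow : (p : R) ^ M ∣ (p : R) ^ (M + 1) := pow_dvd_pow _ (Nat.le_succ M)
  have h1 : (p : R) ^ M ∣ X v - 1 := by
    have := (hpow.trans hzu).mul_right (X z⁻¹)
    rw [hX]
    convert this using 1
    linear_combination hzz
  have h2 : (p : R) ^ M ∣ Y v := by
    rw [hY]
    exact (hpow.trans hu.2).mul_right _
  -- The unit topology also constrains v⁻¹; its coordinates are controlled through v⁻¹ v = 1.
  have e1 := hU.X_mul v⁻¹ v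
  have e2 := hU.Y_mul v⁻¹ v
  rw [inv_mul_cancel] at e1 e2
  rw [hU.X_one] at e1
  rw [hU.Y_one] at e2
  have h3 := RingHom.natCast_pow_dvd_map σ h1
  have h4 := RingHom.natCast_pow_dvd_map σ h2
  rw [map_sub, map_one] at h3
  obtain ⟨a1, h1'⟩ := h1
  obtain ⟨a2, h2'⟩ := h2
  obtain ⟨a3, h3'⟩ := h3
  obtain ⟨a4, h4'⟩ := h4
  refine hM v ⟨_, h1'⟩ ⟨_, h2'⟩ ⟨-(X v⁻¹ * a1 + p * Y v⁻¹ * a4), ?_⟩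
    ⟨-(X v⁻¹ * a2 + Y v⁻¹ * a3), ?_⟩
  · linear_combination -e1 - X v⁻¹ * h1' - p * Y v⁻¹ * h4'
  · linear_combination -e2 - X v⁻¹ * h2' - Y v⁻¹ * h3'

end IsTwistedUnitGroup

/-- Over the prime field α = 0 is allowed, and then only α^0 occurs. In general a vanishing α^i
would give 0 a second digit expansion. -/
theorem pow_ne_zero_of_closure {p : ℕ} [Fact p.Prime] {f : ℕ} {k : Type*} [Field k] [Fintype k]
    [CharP k p] (hk : Fintype.card k = p ^ f) {α : k} (hα : Subfield.closure {α} = ⊤)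
    (i : Fin f) : α ^ (i : ℕ) ≠ 0 := by
  intro h
  have hp := (Fact.out : p.Prime).one_lt
  have h1 := (existsUnique_digits_field hk hα 0).unique (y₁ := 0) (y₂ := Pi.single i 1)
    ⟨fun _ => zero_lt_one.trans hp, by simp⟩ ⟨fun j => ?_, ?_⟩
  · simpa using congrFun h1 i
  · by_cases hj : j = i
    · subst hj
      simpa using hp
    · simpa [Pi.single_eq_of_ne hj] using zero_lt_one.trans hp
  · rw [Finset.sum_eq_single i]
    · simp [h]
    · intro j _ hj
      simp [Pi.single_eq_of_ne hj]
    · simp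

theorem natCast_dvd_sub_sum_iff {R S ι : Type*} [CommRing R] [CommRing S] [Fintype ι] {p : ℕ}
    {ρ : R →+* S} (hρ : ∀ r, (p : R) ∣ r ↔ ρ r = 0) (r : R) (t : ι → ℕ) (y : ι → R) :
    (p : R) ∣ r - ∑ i, t i * y i ↔ ρ r = ∑ i, t i * ρ (y i) := by
  rw [hρ, map_sub, sub_eq_zero, map_sum]
  simp only [map_mul, map_natCast]

theorem ENNReal.two_mul_half : (2 : ℝ≥0∞) * (1 / 2) = 1 :=
  ENNReal.mul_div_cancel (by norm_num) (by norm_num)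

namespace WittVector

variable {p : ℕ} [Fact p.Prime] {k : Type*} [Field k] [CharP k p]

theorem natCast_ne_zero : (p : WittVector p k) ≠ 0 := WittVector.p_nonzero p k

theorem natCast_dvd_iff [PerfectRing k p] (x : WittVector p k) :
    (p : WittVector p k) ∣ x ↔ constantCoeff x = 0 := by
  rw [← Ideal.mem_span_singleton, mem_span_p_iff_coeff_zero_eq_zero]
  rfl

omit [CharP k p] in
theorem constantCoeff_teichmuller (a : k) : constantCoeff (teichmuller p a) = a :=
  teichmuller_coeff_zero p a

theorem isUnit_one_add_mul (r : WittVector p k) : IsUnit (1 + (p : WittVector p k) * r) :=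
  isUnit_of_eq_one_add ⟨r, rfl⟩

theorem isUnit_teichmuller {a : k} (ha : a ≠ 0) : IsUnit (teichmuller p a) :=
  isUnit_of_coeff_zero_ne_zero _ (by rwa [teichmuller_coeff_zero])

theorem not_isUnit_natCast : ¬ IsUnit (p : WittVector p k) := by
  intro h
  have := h.map (constantCoeff (p := p) (R := k))
  rw [map_natCast, CharP.cast_eq_zero] at this
  exact not_isUnit_zero this

omit [CharP k p] in
theorem vp_zero : vp (0 : WittVector p k) = ⊤ := by
  rw [vp, emultiplicity_zero]; rfl

theorem vp_of_isUnit {x : WittVector p k} (h : IsUnit x) : vp x = 0 := by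
  have : emultiplicity (p : WittVector p k) x = 0 :=
    emultiplicity_eq_zero.2 fun h' => not_isUnit_natCast (isUnit_of_dvd_unit h' h)
  rw [vp, this]; simp

theorem vp_mul_natCast {x : WittVector p k} (h : IsUnit x) : vp (x * (p : WittVector p k)) = 1 := by
  have : emultiplicity (p : WittVector p k) (x * (p : WittVector p k)) = (1 : ℕ) := by
    rw [emultiplicity_eq_coe]
    refine ⟨by rw [pow_one]; exact Dvd.intro_left _ rfl, fun h' => ?_⟩
    rw [pow_succ, pow_one] at h'
    exact not_isUnit_natCast (isUnit_of_dvd_unit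
      ((mul_dvd_mul_iff_right natCast_ne_zero).1 h') h)
  rw [vp, this]; simp

/-- A principal unit of square one is one. -/
theorem eq_one_of_mul_self [PerfectRing k p] (hp : 2 < p) {c : WittVector p k}
    (h1 : (p : WittVector p k) ∣ c - 1) (h2 : c * c = 1) : c = 1 := by
  have h3 : (c - 1) * (c + 1) = 0 := by linear_combination h2
  rcases mul_eq_zero.1 h3 with h | h
  · exact sub_eq_zero.1 h
  · exfalso
    have h4 : constantCoeff (2 : WittVector p k) = 0 := by
      rw [← natCast_dvd_iff]
      have := h1.neg_right
      convert this using 1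
      linear_combination h
    rw [map_ofNat, ← Nat.cast_ofNat, CharP.cast_eq_zero_iff k p] at h4
    exact absurd (Nat.le_of_dvd (by norm_num) h4) (by omega)

end WittVector

/-! ### The Iwahori group as a twisted unit group -/

namespace Iwahori

variable {p : ℕ} [Fact p.Prime] {k : Type*} [Field k]

local notation "W" => WittVector p k

/-- The entry below the diagonal, divided by `p`. -/
def lowerEntry (u : I₁ p k) : W := u.2.2.1.choose

theorem lowerEntry_spec (u : I₁ p k) : u.1 1 0 = p * lowerEntry u := u.2.2.1.choose_spec

/-- The diagonal of a matrix. -/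
def diagPart (u : I₁ p k) : W × W := (u.1 0 0, u.1 1 1)

/-- The off-diagonal part of a matrix. -/
def offDiagPart (u : I₁ p k) : W × W := (u.1 0 1, lowerEntry u)

variable (p k) in
/-- The swap of the two coordinates. -/
def swapHom : W × W →+* W × W := (RingHom.snd _ _).prod (RingHom.fst _ _)

theorem swapHom_apply (r : W × W) : swapHom p k r = (r.2, r.1) := rfl

theorem natCast_eq (n : ℕ) : (n : W × W) = ((n : W), (n : W)) := rfl

theorem natCast_pow_dvd_iff (n : ℕ) (r : W × W) :
    (p : W × W) ^ n ∣ r ↔ (p : W) ^ n ∣ r.1 ∧ (p : W) ^ n ∣ r.2 := by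
  rw [natCast_eq, Prod.pow_mk, ← Prod.mk_dvd_mk]

/-- An element of `I₁` from a matrix. -/
def mkI (M : Matrix (Fin 2) (Fin 2) W) (h : IsUnit M.det)
    (h₀ : (p : W) ∣ M 0 0 - 1) (h₁ : (p : W) ∣ M 1 0)
    (h₂ : (p : W) ∣ M 1 1 - 1) : I₁ p k :=
  ⟨Matrix.GeneralLinearGroup.mk'' M h, h₀, h₁, h₂⟩

theorem coe_mkI (M : Matrix (Fin 2) (Fin 2) W) (h : IsUnit M.det)
    (h₀ : (p : W) ∣ M 0 0 - 1) (h₁ : (p : W) ∣ M 1 0)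
    (h₂ : (p : W) ∣ M 1 1 - 1) :
    ((mkI M h h₀ h₁ h₂).1 : Matrix (Fin 2) (Fin 2) W) = M := rfl

variable [CharP k p]

theorem lowerEntry_eq {u : I₁ p k} {y : W} (h : u.1 1 0 = p * y) : lowerEntry u = y :=
  mul_left_cancel₀ WittVector.natCast_ne_zero ((lowerEntry_spec u).symm.trans h)

omit [CharP k p] in
theorem coe_mul_apply (u v : I₁ p k) (i j : Fin 2) :
    (u * v).1 i j = u.1 i 0 * v.1 0 j + u.1 i 1 * v.1 1 j := by
  simp [Matrix.mul_apply]

variable (p k) in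
-- With Π = (0, 1; p, 0), the matrix (a, b; pc, d) is diag(a, d) + diag(b, c)Π, and conjugation by Π
-- swaps diagonal entries.
theorem isTwistedUnitGroup :
    IsTwistedUnitGroup p (swapHom p k) diagPart offDiagPart where
  X_mul u v := by
    ext1 <;> simp only [diagPart, offDiagPart, swapHom_apply, natCast_eq, Prod.mk_mul_mk,
      Prod.mk_add_mk, coe_mul_apply, lowerEntry_spec] <;> ring
  Y_mul u v := by
    ext1
    · simp only [diagPart, offDiagPart, swapHom_apply, Prod.mk_mul_mk,
        Prod.mk_add_mk, coe_mul_apply]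
    · refine lowerEntry_eq ?_
      simp only [diagPart, offDiagPart, swapHom_apply, Prod.mk_mul_mk,
        Prod.mk_add_mk, coe_mul_apply, lowerEntry_spec]
      ring
  X_one := by simp [diagPart]
  Y_one := by
    ext1
    · simp [offDiagPart]
    · exact lowerEntry_eq (by simp)
  dvd_X u := by
    have := (natCast_pow_dvd_iff 1 (diagPart u - 1)).2
    rw [pow_one, pow_one] at this
    exact this ⟨u.2.1, u.2.2.2⟩
  σ_σ r := rfl
  reg r hr := by
    have h1 := congrArg Prod.fst hr
    have h2 := congrArg Prod.snd hr
    simp only [natCast_eq, Prod.fst_mul, Prod.snd_mul, Prod.fst_zero, Prod.snd_zero,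
      mul_eq_zero, WittVector.natCast_ne_zero, false_or] at h1 h2
    exact Prod.ext h1 h2
  unit r := by
    rw [Prod.isUnit_iff]
    exact ⟨WittVector.isUnit_one_add_mul _, WittVector.isUnit_one_add_mul _⟩

theorem diagPart_of_mem_Z₁ {z : I₁ p k} (hz : z ∈ Z₁ p k) :
    swapHom p k (diagPart z) = diagPart z ∧ offDiagPart z = 0 := by
  obtain ⟨c, hc⟩ := hz
  have hz : (z.1 : Matrix (Fin 2) (Fin 2) W) =
      Matrix.scalar (Fin 2) (c : W) := congrArg Units.val hc.symm
  refine ⟨?_, Prod.ext ?_ (lowerEntry_eq ?_)⟩ <;>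
    simp [diagPart, offDiagPart, swapHom_apply, hz]

theorem exists_mem_Z₁ {n : ℕ} {u : I₁ p k}
    (h : (p : W × W) ^ n ∣ diagPart u - swapHom p k (diagPart u)) :
    ∃ z ∈ Z₁ p k, (p : W × W) ^ n ∣ diagPart u - diagPart z := by
  have hc : IsUnit (u.1 0 0) := by
    obtain ⟨r, hr⟩ := u.2.1
    exact WittVector.isUnit_of_eq_one_add ⟨r, by linear_combination hr⟩
  refine ⟨⟨Units.map (Matrix.scalar (Fin 2) : W →+* _).toMonoidHom hc.unit, ?_⟩, ⟨hc.unit, rfl⟩, ?_⟩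
  · have := u.2.1
    exact ⟨by simpa using this, by simp, by simpa using this⟩
  · rw [natCast_pow_dvd_iff] at h ⊢
    refine ⟨?_, ?_⟩
    · simp [diagPart]
    · simpa [diagPart, swapHom_apply] using h.2

omit [CharP k p] in
-- The Boolean index chooses between u and u⁻¹, both of which define the topology of a unit group.
theorem topology_eq : (inferInstance : TopologicalSpace (I₁ p k)) =
    ⨅ i : Bool × Fin 2 × Fin 2, TopologicalSpace.induced
      (fun u : I₁ p k => (bif i.1 then u else u⁻¹).1 i.2.1 i.2.2) inferInstance := by
  have h1 : (inferInstance : TopologicalSpace (I₁ p k)) = TopologicalSpace.induced Subtype.val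
    (inferInstance : TopologicalSpace (GL (Fin 2) W)) := rfl
  have h2 : (inferInstance : TopologicalSpace (Matrix (Fin 2) (Fin 2) W)) =
    ⨅ i, TopologicalSpace.induced (fun M => M i) (⨅ j, TopologicalSpace.induced (fun r => r j)
      inferInstance) := rfl
  have h3 := Units.topology_eq_inf (M := Matrix (Fin 2) (Fin 2) W)
  have h2' : (instTopologicalSpaceMatrix : TopologicalSpace (Matrix (Fin 2) (Fin 2) W)) = _ := h2
  rw [h2'] at h3
  rw [h1]
  refine (congrArg _ h3).trans ?_
  simp only [induced_inf, induced_iInf, induced_compose, iInf_prod, iInf_bool_eq]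
  rfl

theorem mem_nhds_iff (u : I₁ p k) (V : Set (I₁ p k)) : V ∈ nhds u ↔ ∃ n : ℕ, ∀ v,
    (p : W × W) ^ n ∣ diagPart v - diagPart u → (p : W × W) ^ n ∣ offDiagPart v - offDiagPart u →
    (p : W × W) ^ n ∣ diagPart v⁻¹ - diagPart u⁻¹ →
    (p : W × W) ^ n ∣ offDiagPart v⁻¹ - offDiagPart u⁻¹ → v ∈ V := by
  have h := WittVector.mem_nhds_iff (p := p) (k := k)
    (fun (i : Bool × Fin 2 × Fin 2) (u : I₁ p k) => (bif i.1 then u else u⁻¹).1 i.2.1 i.2.2) u V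
  rw [← topology_eq] at h
  refine Iff.trans h ?_
  -- The lower coordinate is the matrix entry divided by p, which costs one power of p.
  have key : ∀ (n : ℕ) (a b : I₁ p k), (p : W) ^ (n + 1) ∣ a.1 1 0 - b.1 1 0 ↔
      (p : W) ^ n ∣ lowerEntry a - lowerEntry b := fun n a b => by
    rw [lowerEntry_spec, lowerEntry_spec, ← mul_sub, pow_succ',
      mul_dvd_mul_iff_left WittVector.natCast_ne_zero]
  simp only [natCast_pow_dvd_iff, diagPart, offDiagPart, Prod.fst_sub, Prod.snd_sub, Prod.forall,
    Bool.forall_bool, Fin.forall_fin_two, cond_true, cond_false]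
  constructor
  · rintro ⟨n, hn⟩
    refine ⟨n, fun v ⟨h1, h2⟩ ⟨h3, h4⟩ ⟨h5, h6⟩ ⟨h7, h8⟩ => hn v ?_⟩
    have hle := pow_dvd_pow (p : W) (Nat.le_succ n)
    exact ⟨⟨⟨h5, h7⟩, hle.trans ((key n _ _).2 h8), h6⟩,
      ⟨h1, h3⟩, hle.trans ((key n _ _).2 h4), h2⟩
  · rintro ⟨n, hn⟩
    refine ⟨n + 1, fun v h => ?_⟩
    obtain ⟨⟨⟨h5, h7⟩, h8, h6⟩, ⟨h1, h3⟩, h4, h2⟩ := h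
    have hle := pow_dvd_pow (p : W) (Nat.le_succ n)
    exact hn v ⟨hle.trans h1, hle.trans h2⟩ ⟨hle.trans h3, (key n _ _).1 h4⟩
      ⟨hle.trans h5, hle.trans h6⟩ ⟨hle.trans h7, (key n _ _).1 h8⟩

end Iwahori

/-! ### Generators of the Iwahori group and their valuations -/

namespace Iwahori

variable {p : ℕ} [Fact p.Prime] {k : Type*} [Field k] [CharP k p]

local notation "W" => WittVector p k
local notation "T" => WittVector.teichmuller p

theorem isUnit_coe_inv_oneAdd (a : k) : IsUnit (((oneAdd a)⁻¹ : (W)ˣ) : W) := Units.isUnit _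

theorem inv_oneAdd_mul (a : k) : (((oneAdd a)⁻¹ : (W)ˣ) : W) * (1 + T a * (p : W)) = 1 :=
  Units.inv_mul (oneAdd (p := p) a)

omit [CharP k p] in
/-- A lift of `A a`. -/
def liftA (a : k) : I₁ p k :=
  mkI !![1, T a; 0, 1] (by simp [Matrix.det_fin_two]) (by simp) (by simp) (by simp)

omit [CharP k p] in
/-- A lift of `B a`. -/
def liftB (a : k) : I₁ p k :=
  mkI !![1, 0; T a * p, 1] (by simp [Matrix.det_fin_two]) (by simp) (by simp) (by simp)

/-- A lift of `C a`. -/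
def liftC (a : k) : I₁ p k :=
  mkI !![(oneAdd a : W), 0; 0, ((oneAdd a)⁻¹ : (W)ˣ)]
    (by simp [Matrix.det_fin_two]) (by simp [coe_oneAdd]) (by simp)
    (by simpa using dvd_inv_oneAdd_sub_one a)

/-- Lifts of the elements of the basis. -/
def basisLift (f : ℕ) (α : k) : Fin (f + f + f) → I₁ p k :=
  Fin.append (Fin.append (fun i : Fin f => liftA (α ^ (i : ℕ)))
    (fun i : Fin f => liftB (α ^ (i : ℕ)))) (fun i : Fin f => liftC (α ^ (i : ℕ)))

variable (p) in
/-- The leading coefficients of the elements of the basis. -/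
def basisCoeff (f : ℕ) (α : k) : Fin (f + f + f) → W × W :=
  Fin.append (Fin.append (fun i : Fin f => (T (α ^ (i : ℕ)), 0))
    (fun i : Fin f => (0, T (α ^ (i : ℕ)))))
    (fun i : Fin f => (T (α ^ (i : ℕ)),
      -(T (α ^ (i : ℕ)) * ((oneAdd (α ^ (i : ℕ)))⁻¹ : (W)ˣ))))

theorem mk_basisLift (f : ℕ) (α : k) (i : Fin (f + f + f)) :
    basis (p := p) f α i = QuotientGroup.mk (basisLift f α i) := by
  revert i
  rw [forall_append]
  refine ⟨fun i => ?_, fun i => ?_, fun i => ?_⟩ <;>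
    simp only [basis, basisLift, Fin.append_left, Fin.append_right] <;> rfl

/-- The two representatives differ by a scalar c ≡ 1 modulo p with c² = 1, hence by c = 1. -/
theorem eq_of_mk_eq [PerfectRing k p] (hp : 2 < p) {u v : I₁ p k}
    (h : (QuotientGroup.mk u : G p k) = QuotientGroup.mk v)
    (hu : Matrix.GeneralLinearGroup.det u.1 = 1) (hv : Matrix.GeneralLinearGroup.det v.1 = 1) :
    u = v := by
  have hz : u⁻¹ * v ∈ Z₁ p k := QuotientGroup.eq.1 h
  have hdet : Matrix.GeneralLinearGroup.det (u⁻¹ * v).1 = 1 := by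
    simp [hu, hv]
  have hd := (u⁻¹ * v).2.1
  obtain ⟨c, hc⟩ := hz
  have hc' : ((u⁻¹ * v).1 : Matrix (Fin 2) (Fin 2) W) = Matrix.scalar (Fin 2) (c : W) :=
    congrArg Units.val hc.symm
  have hone : (c : W) = 1 := by
    refine WittVector.eq_one_of_mul_self hp ?_ ?_
    · rw [hc'] at hd
      simpa using hd
    · have := congrArg Units.val hdet
      rw [Matrix.GeneralLinearGroup.val_det_apply, hc'] at this
      simpa only [Matrix.det_fin_two, Matrix.scalar_apply, Matrix.diagonal_apply_eq, Units.val_one,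
        ne_eq, zero_ne_one, not_false_eq_true, Matrix.diagonal_apply_ne, zero_mul, sub_zero]
        using this
  have : u⁻¹ * v = 1 := by
    apply Subtype.ext
    apply Units.ext
    rw [hc', hone, map_one]
    rfl
  exact inv_mul_eq_one.1 this

theorem omega_mk [PerfectRing k p] (hp : 2 < p) {u : I₁ p k}
    (hu : Matrix.GeneralLinearGroup.det u.1 = 1) :
    omega (QuotientGroup.mk u) =
      min (min (WittVector.vp (u.1 0 0 - 1)) (WittVector.vp (u.1 0 1) + 1 / 2))
        (min (WittVector.vp (u.1 1 0) - 1 / 2) (WittVector.vp (u.1 1 1 - 1))) := by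
  refine le_antisymm (iSup_le fun v => iSup_le fun hv => iSup_le fun hd => ?_)
    (le_iSup_of_le u (le_iSup_of_le rfl (le_iSup_of_le hu le_rfl)))
  rw [eq_of_mk_eq hp hv hd hu]

theorem two_mul_omega_A [PerfectRing k p] (hp : 2 < p) {a : k} (ha : a ≠ 0) :
    2 * omega (QuotientGroup.mk (liftA (p := p) a)) = 1 := by
  rw [omega_mk hp (Units.ext (by simp [liftA, coe_mkI, Matrix.det_fin_two]))]
  simp only [liftA, coe_mkI, Matrix.of_apply, Matrix.cons_val', Matrix.cons_val_zero,
    Matrix.cons_val_one, Matrix.cons_val_fin_one, sub_self, WittVector.vp_zero,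
    WittVector.vp_of_isUnit (WittVector.isUnit_teichmuller ha), zero_add, top_inf_eq, inf_top_eq]
  rw [min_eq_left, ENNReal.two_mul_half]
  rw [ENNReal.top_sub (by norm_num)]
  exact le_top

theorem two_mul_omega_B [PerfectRing k p] (hp : 2 < p) {a : k} (ha : a ≠ 0) :
    2 * omega (QuotientGroup.mk (liftB (p := p) a)) = 1 := by
  rw [omega_mk hp (Units.ext (by simp [liftB, coe_mkI, Matrix.det_fin_two]))]
  simp only [liftB, coe_mkI, Matrix.of_apply, Matrix.cons_val', Matrix.cons_val_zero,
    Matrix.cons_val_one, Matrix.cons_val_fin_one, sub_self, WittVector.vp_zero,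
    WittVector.vp_mul_natCast (WittVector.isUnit_teichmuller ha), top_add,
    min_top_left, min_top_right]
  rw [one_div, ENNReal.one_sub_inv_two, ← one_div, ENNReal.two_mul_half]

theorem two_mul_omega_C [PerfectRing k p] (hp : 2 < p) {a : k} (ha : a ≠ 0) :
    2 * omega (QuotientGroup.mk (liftC (p := p) a)) = 2 := by
  rw [omega_mk hp (Units.ext (by simp [liftC, coe_mkI, Matrix.det_fin_two]))]
  have h1 : (((oneAdd a)⁻¹ : (W)ˣ) : W) - 1 = -(((oneAdd a)⁻¹ : (W)ˣ) : W) * T a * p := by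
    linear_combination inv_oneAdd_mul a
  simp only [liftC, coe_mkI, Matrix.of_apply, Matrix.cons_val', Matrix.cons_val_zero,
    Matrix.cons_val_one, Matrix.cons_val_fin_one, WittVector.vp_zero, top_add, h1]
  rw [coe_oneAdd, add_sub_cancel_left,
    WittVector.vp_mul_natCast (WittVector.isUnit_teichmuller ha), WittVector.vp_mul_natCast
      ((isUnit_coe_inv_oneAdd a).neg.mul (WittVector.isUnit_teichmuller ha)),
    ENNReal.top_sub (by norm_num)]
  simp

theorem two_mul_omega_basis [PerfectRing k p] [Fintype k] (hp : 2 < p) {f : ℕ}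
    (hk : Fintype.card k = p ^ f) {α : k} (hα : Subfield.closure {α} = ⊤) (i : Fin (f + f + f)) :
    2 * omega (basis (p := p) f α i) = genWeight f i := by
  rw [mk_basisLift]
  revert i
  rw [forall_append]
  simp only [genWeight_A, genWeight_B, genWeight_C, basisLift, Fin.append_left, Fin.append_right]
  exact ⟨fun i => by simpa using two_mul_omega_A hp (pow_ne_zero_of_closure hk hα i),
    fun i => by simpa using two_mul_omega_B hp (pow_ne_zero_of_closure hk hα i),
    fun i => by simpa using two_mul_omega_C hp (pow_ne_zero_of_closure hk hα i)⟩

variable (p k) in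
/-- Reduction modulo `p`. -/
def residue : W × W →+* k × k := WittVector.constantCoeff.prodMap WittVector.constantCoeff

omit [CharP k p] in
theorem residue_apply (r : W × W) :
    residue p k r = (WittVector.constantCoeff r.1, WittVector.constantCoeff r.2) := rfl

theorem natCast_dvd_iff [PerfectRing k p] (r : W × W) : (p : W × W) ∣ r ↔ residue p k r = 0 := by
  have := natCast_pow_dvd_iff 1 r
  rw [pow_one, pow_one, WittVector.natCast_dvd_iff, WittVector.natCast_dvd_iff] at this
  rw [this, residue_apply, Prod.ext_iff]
  rfl

theorem isTwistedBasis [Fintype k] (hp : 2 < p) {f : ℕ}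
    (hk : Fintype.card k = p ^ f) {α : k} (hα : Subfield.closure {α} = ⊤) :
    IsTwistedBasis p (swapHom p k) diagPart offDiagPart (basisLift f α) (genWeight f)
      (basisCoeff p f α) where
  toIsTwistedUnitGroup := isTwistedUnitGroup p k
  weight := genWeight_eq
  X_gen_one := by
    rw [forall_append]
    simp only [genWeight_C, basisLift, Fin.append_left, Fin.append_right]
    exact ⟨fun i _ => by simp [diagPart, liftA, coe_mkI],
      fun i _ => by simp [diagPart, liftB, coe_mkI], fun i h => by norm_num at h⟩
  Y_gen_one := by
    rw [forall_append]
    simp only [genWeight_C, basisLift, basisCoeff, Fin.append_left, Fin.append_right]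
    refine ⟨fun i _ => Prod.ext ?_ (lowerEntry_eq ?_), fun i _ => Prod.ext ?_ (lowerEntry_eq ?_),
      fun i h => by norm_num at h⟩
    · simp [offDiagPart, liftA, coe_mkI]
    · simp [liftA, coe_mkI]
    · simp [offDiagPart, liftB, coe_mkI]
    · simp [liftB, coe_mkI, mul_comm]
  X_gen_two := by
    rw [forall_append]
    simp only [genWeight_A, genWeight_B, basisLift, basisCoeff, Fin.append_left, Fin.append_right]
    refine ⟨fun i h => by norm_num at h, fun i h => by norm_num at h, fun i _ => Prod.ext ?_ ?_⟩
    · simp [diagPart, liftC, coe_mkI, coe_oneAdd, mul_comm]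
    · simp only [diagPart, liftC, coe_mkI, Matrix.of_apply, Matrix.cons_val', Matrix.cons_val_one,
        Matrix.cons_val_fin_one, Prod.snd_add, Prod.snd_one, Prod.snd_mul, Prod.snd_natCast]
      linear_combination inv_oneAdd_mul (p := p) (α ^ (i : ℕ))
  Y_gen_two := by
    rw [forall_append]
    simp only [genWeight_A, genWeight_B, basisLift, Fin.append_left, Fin.append_right]
    refine ⟨fun i h => by norm_num at h, fun i h => by norm_num at h,
      fun i _ => Prod.ext ?_ (lowerEntry_eq ?_)⟩
    · simp [offDiagPart, liftC, coe_mkI]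
    · simp [liftC, coe_mkI]
  digits_one r := by
    simp only [natCast_dvd_sub_sum_iff (ρ := residue p k) natCast_dvd_iff]
    refine existsUnique_digits_one hk hα (RingHom.prod (RingHom.id k) (RingHom.id k))
      (e₁ := (1, 0)) (e₂ := (0, 1)) (fun s => ⟨s, ?_, fun s' hs => ?_⟩) (fun i => ?_)
      (fun i => ?_) _
    · simp
    · simpa [eq_comm] using hs
    · simp only [basisCoeff, Fin.append_left, residue_apply]
      simp [WittVector.constantCoeff_teichmuller, -WittVector.constantCoeff_apply, -map_pow]
    · simp only [basisCoeff, Fin.append_left, Fin.append_right, residue_apply]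
      simp [WittVector.constantCoeff_teichmuller, -WittVector.constantCoeff_apply, -map_pow]
  digits_two r hr := by
    simp only [natCast_dvd_sub_sum_iff (ρ := residue p k) natCast_dvd_iff]
    have h2 : (2 : k) ≠ 0 := by
      rw [← Nat.cast_ofNat, Ne, CharP.cast_eq_zero_iff k p]
      exact fun h => absurd (Nat.le_of_dvd (by norm_num) h) (by omega)
    -- Modulo p the coefficient of C_i is (a, -a) with a = α^i; subtracting its swap gives a(2, -2).
    refine existsUnique_digits_two hk hα (RingHom.prod (RingHom.id k) (RingHom.id k))
      (δ := (2, -2)) ⟨WittVector.constantCoeff r.1 / 2, ?_, fun a ha => ?_⟩ (fun i => ?_)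
    · have h1 : r.2 = -r.1 := congrArg Prod.fst hr
      simp [residue_apply, h1, h2, -WittVector.constantCoeff_apply]
    · have := congrArg Prod.fst ha
      simp only [residue_apply] at this
      rw [eq_div_iff h2]
      simpa using this.symm
    · have h1 := congrArg (WittVector.constantCoeff) (inv_oneAdd_mul (p := p) (α ^ (i : ℕ)))
      simp only [map_mul, map_add, map_one, map_natCast, CharP.cast_eq_zero, mul_zero, add_zero,
        mul_one] at h1
      simp only [basisCoeff, Fin.append_right, residue_apply, swapHom_apply, Prod.mk_sub_mk,
        map_sub, map_neg, map_mul,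
        WittVector.constantCoeff_teichmuller, h1, RingHom.prod_apply, RingHom.id_apply,
        Prod.mk_mul_mk]
      ext1 <;> ring
  lift r := by
    refine ⟨mkI !![1, r.1; p * r.2, 1] ?_ ?_ ?_ ?_, ?_, Prod.ext ?_ (lowerEntry_eq ?_)⟩
    · have := WittVector.isUnit_one_add_mul (p := p) (-(r.1 * r.2))
      convert this using 1
      simp [Matrix.det_fin_two]
      ring
    · simp
    · simp
    · simp
    · simp [diagPart, coe_mkI]
    · simp [offDiagPart, coe_mkI]
    · simp [coe_mkI]
  comm := by
    rw [forall_append]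
    simp only [genWeight_A, genWeight_B, basisCoeff, Fin.append_left, Fin.append_right]
    -- These witnesses correspond to an upper and a lower unipotent matrix, whose commutator is
    -- diagonal to leading order.
    refine ⟨fun i h => by norm_num at h, fun i h => by norm_num at h,
      fun i _ => ⟨(T (α ^ (i : ℕ)), 0), (0, 1), ?_⟩⟩
    have h1 := congrArg (WittVector.constantCoeff) (inv_oneAdd_mul (p := p) (α ^ (i : ℕ)))
    simp only [map_mul, map_add, map_one, map_natCast, CharP.cast_eq_zero, mul_zero, add_zero,
      mul_one] at h1
    rw [natCast_dvd_iff]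
    simp only [residue_apply, swapHom_apply, Prod.mk_sub_mk, map_sub, map_mul, map_neg, map_zero,
      map_ofNat, map_one, WittVector.constantCoeff_teichmuller, h1, Prod.mk_mul_mk]
    ext1 <;> simp only [Prod.fst_zero, Prod.snd_zero, Prod.fst_sub, Prod.snd_sub,
      Prod.fst_mul, Prod.snd_mul, Prod.fst_ofNat, Prod.snd_ofNat] <;> ring

theorem completedGroupRing [Fintype k] (hp : 3 < p) {f : ℕ} (hk : Fintype.card k = p ^ f) {α : k}
    (hα : Subfield.closure {α} = ⊤) (F : Type*) [Field F] [Finite F] [CharP F p] :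
    (∀ y : CompletedGroupRing F (Iwahori.G p k), ∃! c : (Fin (f + f + f) → ℕ) → F,
        CompletedGroupRing.IsExpansion (Iwahori.basis f α) c y) ∧
      ∃ 𝔪 : Ideal (CompletedGroupRing F (Iwahori.G p k)),
        𝔪.IsTwoSided ∧ (∀ I : Ideal (CompletedGroupRing F (Iwahori.G p k)), I.IsMaximal ↔ I = 𝔪) ∧
        ∀ j : ℕ, ((𝔪 ^ j : Ideal (CompletedGroupRing F (Iwahori.G p k))) :
            Set (CompletedGroupRing F (Iwahori.G p k))) =
          {y | (j : ℝ≥0∞) ≤ CompletedGroupRing.nu Iwahori.omega (Iwahori.basis f α) y} :=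
  have hT := isTwistedBasis (by omega) hk hα
  hT.completedGroupRing (Z₁ p k) (fun _ => diagPart_of_mem_Z₁) hp
    (hT.isOpen_congr mem_nhds_iff)
    (fun _ hV hle => hT.exists_congr_le mem_nhds_iff (fun _ => diagPart_of_mem_Z₁)
      (fun _ _ _ h => exists_mem_Z₁ h) hV hle)
    (mk_basisLift f α) (two_mul_omega_basis (by omega) hk hα)

end Iwahori

/-! ## Quadratic extensions of finite fields -/

section Quadratic

variable {k k₂ : Type*} [Field k] [Field k₂] [Algebra k k₂] [Algebra.IsQuadraticExtension k k₂]

variable (k k₂) in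
theorem finiteDimensional_of_isQuadraticExtension : FiniteDimensional k k₂ :=
  Module.finite_of_finrank_pos
    (by rw [Algebra.IsQuadraticExtension.finrank_eq_two k k₂]; norm_num)

variable (k k₂) in
theorem finite_of_isQuadraticExtension [Finite k] : Finite k₂ :=
  have := finiteDimensional_of_isQuadraticExtension k k₂
  Module.finite_of_finite k

variable {ζ : k₂} (hζ : IntermediateField.adjoin k {ζ} = ⊤)

include hζ

theorem existsUnique_add_mul (s : k₂) :
    ∃! ab : k × k, s = algebraMap k k₂ ab.1 * 1 + algebraMap k k₂ ab.2 * ζ := by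
  have := finiteDimensional_of_isQuadraticExtension k k₂
  obtain ⟨c, hc, hu⟩ := existsUnique_sum_smul_pow hζ
    (Algebra.IsQuadraticExtension.finrank_eq_two k k₂) s
  simp only [Fin.sum_univ_two, Fin.val_zero, Fin.val_one, pow_zero, pow_one] at hc hu
  refine ⟨(c 0, c 1), hc, fun ab hab => ?_⟩
  have := hu ![ab.1, ab.2] (by simpa using hab)
  rw [← this]
  simp

variable [Fintype k]

local notation "φ" => FiniteField.frobeniusAlgHom k k₂

/-- Otherwise Frobenius, fixing k and the generator ζ, would be the identity, but its order is 2. -/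
theorem frobenius_ne : φ ζ ≠ ζ := by
  intro h
  have := finite_of_isQuadraticExtension k k₂
  have h1 : φ = 1 := by
    ext s
    obtain ⟨ab, hab, -⟩ := existsUnique_add_mul hζ s
    rw [hab]
    simp only [map_add, map_mul, AlgHom.commutes, h, map_one, AlgHom.one_apply]
  have h2 := FiniteField.orderOf_frobeniusAlgHom k k₂
  rw [h1, orderOf_one, Algebra.IsQuadraticExtension.finrank_eq_two k k₂] at h2
  norm_num at h2

theorem exists_algebraMap_eq {s : k₂} (hs : φ s = s) : ∃ a : k, algebraMap k k₂ a = s := by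
  obtain ⟨⟨a, b⟩, hab, -⟩ := existsUnique_add_mul hζ s
  refine ⟨a, ?_⟩
  rw [hab] at hs
  simp only [map_add, map_mul, AlgHom.commutes, map_one] at hs
  have h1 : algebraMap k k₂ b * (φ ζ - ζ) = 0 := by linear_combination hs
  rcases mul_eq_zero.1 h1 with h | h
  · rw [hab]
    simp [h]
  · exact absurd (sub_eq_zero.1 h) (frobenius_ne hζ)

/-- For s = a + bζ the condition reads 2a + b(ζ + φζ) = 0, so s = (b/2)(ζ - φζ). -/
theorem existsUnique_mul_sub (h2 : (2 : k₂) ≠ 0) {s : k₂} (hs : φ s = -s) :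
    ∃! a : k, s = algebraMap k k₂ a * (ζ - φ ζ) := by
  have hne : ζ - φ ζ ≠ 0 := sub_ne_zero.2 (frobenius_ne hζ).symm
  obtain ⟨⟨a, b⟩, hab, -⟩ := existsUnique_add_mul hζ s
  have h3 := hs
  rw [hab] at h3
  simp only [map_add, map_mul, AlgHom.commutes, map_one] at h3
  refine ⟨b / 2, ?_, fun c hc => ?_⟩
  · simp only [map_div₀, map_ofNat]
    field_simp
    rw [hab]
    linear_combination h3
  · apply (algebraMap k k₂).injective
    have h4 : s = algebraMap k k₂ (b / 2) * (ζ - φ ζ) := by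
      simp only [map_div₀, map_ofNat]
      field_simp
      rw [hab]
      linear_combination h3
    exact mul_right_cancel₀ hne (hc.symm.trans h4)

end Quadratic

/-- Hensel's lemma for X² - m at the approximate root 1, where the derivative is the unit 2. -/
theorem HenselianRing.exists_mul_self_eq {R : Type*} [CommRing R] {I : Ideal R}
    [HenselianRing R I] (h2 : IsUnit (2 : R)) {m : R} (hm : m - 1 ∈ I) :
    ∃ s, s * s = m ∧ s - 1 ∈ I := by
  obtain ⟨s, hs, hs1⟩ := HenselianRing.is_henselian (I := I)
    (Polynomial.X ^ 2 - Polynomial.C m) (Polynomial.monic_X_pow_sub_C m two_ne_zero) 1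
    (by simpa using neg_mem hm)
    (by
      have : ((Polynomial.X ^ 2 - Polynomial.C m).derivative.eval 1 : R) = 2 := by
        simp [one_add_one_eq_two]
      rw [this]
      exact h2.map _)
  refine ⟨s, ?_, hs1⟩
  have h : s ^ 2 - m = 0 := by simpa [Polynomial.IsRoot] using hs
  linear_combination h

namespace WittVector

variable {p : ℕ} [Fact p.Prime] {k : Type*} [Field k] [CharP k p]

theorem natCast_pow_dvd_iff_coeff [PerfectRing k p] (x : WittVector p k) (n : ℕ) :
    (p : WittVector p k) ^ n ∣ x ↔ ∀ m < n, x.coeff m = 0 := by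
  rw [← Ideal.mem_span_singleton, mem_span_p_pow_iff_le_coeff_eq_zero]

theorem natCast_pow_dvd_sub_iff [PerfectRing k p] (x y : WittVector p k) (n : ℕ) :
    (p : WittVector p k) ^ n ∣ x - y ↔ ∀ m < n, x.coeff m = y.coeff m := by
  rw [natCast_pow_dvd_iff_coeff, ← le_coeff_eq_iff_le_sub_coeff_eq_zero]

theorem isUnit_two [PerfectRing k p] (hp : 2 < p) : IsUnit (2 : WittVector p k) := by
  apply isUnit_of_coeff_zero_ne_zero
  change constantCoeff (2 : WittVector p k) ≠ 0
  rw [map_ofNat, ← Nat.cast_ofNat, Ne, CharP.cast_eq_zero_iff k p]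
  exact fun h => absurd (Nat.le_of_dvd (by norm_num) h) (by omega)

/-- Principal units are squares. -/
theorem exists_mul_self_eq [PerfectRing k p] (hp : 2 < p) {m : WittVector p k}
    (hm : (p : WittVector p k) ∣ m - 1) :
    ∃ s : WittVector p k, s * s = m ∧ (p : WittVector p k) ∣ s - 1 := by
  obtain ⟨s, hs, hs1⟩ := HenselianRing.exists_mul_self_eq
    (I := Ideal.span {(p : WittVector p k)}) (isUnit_two hp) (Ideal.mem_span_singleton.2 hm)
  exact ⟨s, hs, Ideal.mem_span_singleton.1 hs1⟩

end WittVector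

/-! ### The quaternion unit group as a twisted unit group -/

namespace QuaternionOrder

variable {p : ℕ} [Fact p.Prime] {k k₂ : Type*} [Field k] [Fintype k] [Field k₂]
  [Algebra k k₂]

local notation "OD" => QuaternionOrder p k k₂
local notation "W" => WittVector p k
local notation "W₂" => WittVector p k₂
local notation "ι" => WittVector.map (p := p) (algebraMap k k₂)
local notation "σ" => wittSigma p k k₂

theorem constantCoeff_wittSigma (r : W₂) : WittVector.constantCoeff (σ r) =
    FiniteField.frobeniusAlgHom k k₂ (WittVector.constantCoeff r) := by
  simp [wittSigma, WittVector.map_coeff]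

omit [Fintype k] in
theorem constantCoeff_map (r : W) : WittVector.constantCoeff (ι r) =
    algebraMap k k₂ (WittVector.constantCoeff r) := by
  simp [WittVector.map_coeff]

variable [Algebra.IsQuadraticExtension k k₂]

@[simp] theorem sub_fst (x y : OD) : (x - y).fst = x.fst - y.fst := by
  rw [sub_eq_add_neg, add_fst, neg_fst, ← sub_eq_add_neg]

@[simp] theorem sub_snd (x y : OD) : (x - y).snd = x.snd - y.snd := by
  rw [sub_eq_add_neg, add_snd, neg_snd, ← sub_eq_add_neg]

@[simp] theorem natCast_fst (n : ℕ) : (n : OD).fst = n := by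
  rw [← map_natCast (incl p k k₂), incl_fst]

@[simp] theorem natCast_snd (n : ℕ) : (n : OD).snd = 0 := by
  rw [← map_natCast (incl p k k₂), incl_snd]

@[simp] theorem inclK_fst (a : W) : (inclK p k k₂ a).fst = ι a := rfl

@[simp] theorem inclK_snd (a : W) : (inclK p k k₂ a).snd = 0 := rfl

/-- The first coordinate of an element of `U₁`. -/
def fstPart (u : U₁ p k k₂) : W₂ := (u.1 : OD).fst

/-- The second coordinate of an element of `U₁`. -/
def sndPart (u : U₁ p k k₂) : W₂ := (u.1 : OD).snd

theorem dvd_fstPart (u : U₁ p k k₂) : (p : W₂) ∣ fstPart u - 1 := by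
  obtain ⟨x, hx⟩ := u.2
  refine ⟨σ x.snd, ?_⟩
  simp [fstPart, hx]

theorem Pi_dvd_iff (x : OD) : Pi p k k₂ ∣ x ↔ (p : W₂) ∣ x.fst := by
  constructor
  · rintro ⟨y, rfl⟩
    exact ⟨σ y.snd, by simp⟩
  · rintro ⟨r, hr⟩
    refine ⟨⟨σ x.snd, σ r⟩, ?_⟩
    ext1 <;> simp [hr, wittSigma_wittSigma]

theorem natCast_mul_fst (x : OD) : ((p : OD) * x).fst = p * x.fst := by simp

theorem natCast_mul_snd (x : OD) : ((p : OD) * x).snd = p * x.snd := by simp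

theorem Pi_sq_dvd_iff (x : OD) : Pi p k k₂ ^ 2 ∣ x ↔ (p : W₂) ∣ x.fst ∧ (p : W₂) ∣ x.snd := by
  rw [pow_two, Pi_mul_Pi]
  constructor
  · rintro ⟨y, rfl⟩
    exact ⟨⟨_, natCast_mul_fst y⟩, ⟨_, natCast_mul_snd y⟩⟩
  · rintro ⟨⟨a, ha⟩, ⟨b, hb⟩⟩
    exact ⟨⟨a, b⟩, by ext1 <;> simp [ha, hb]⟩

theorem dvd_of_Pi_pow_three_dvd {x : OD} (h : Pi p k k₂ ^ 3 ∣ x) : (p : W₂) ^ 2 ∣ x.fst := by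
  rw [pow_succ, pow_two, Pi_mul_Pi] at h
  obtain ⟨y, rfl⟩ := h
  exact ⟨σ y.snd, by simp; ring⟩

section CharP

variable [CharP k₂ p]

variable (p k k₂) in
theorem isTwistedUnitGroup :
    IsTwistedUnitGroup p (wittSigma p k k₂) (fstPart (p := p) (k := k) (k₂ := k₂)) sndPart where
  X_mul _ _ := rfl
  Y_mul _ _ := rfl
  X_one := rfl
  Y_one := rfl
  dvd_X := dvd_fstPart
  σ_σ := wittSigma_wittSigma
  reg _ hr := (mul_eq_zero.1 hr).resolve_left WittVector.natCast_ne_zero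
  unit _ := WittVector.isUnit_one_add_mul _

omit [CharP k₂ p] in
theorem fstPart_of_mem_Z₁ {z : U₁ p k k₂} (hz : z ∈ Z₁ p k k₂) :
    wittSigma p k k₂ (fstPart z) = fstPart z ∧ sndPart z = 0 := by
  obtain ⟨c, hc⟩ := hz
  have hz : (z.1 : OD) = inclK p k k₂ c := congrArg Units.val hc.symm
  simp [fstPart, sndPart, hz, wittSigma_map_algebraMap]

omit [CharP k₂ p] in
theorem topology_eq : (inferInstance : TopologicalSpace (U₁ p k k₂)) =
    ⨅ i : Bool × Bool, TopologicalSpace.induced (fun u : U₁ p k k₂ =>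
      bif i.2 then fstPart (bif i.1 then u else u⁻¹) else sndPart (bif i.1 then u else u⁻¹))
      inferInstance := by
  have h1 : (inferInstance : TopologicalSpace (U₁ p k k₂)) = TopologicalSpace.induced Subtype.val
    (inferInstance : TopologicalSpace (OD)ˣ) := rfl
  have h2 : (inferInstance : TopologicalSpace OD) =
    TopologicalSpace.induced (fun x => (x.fst, x.snd)) (TopologicalSpace.induced Prod.fst
      inferInstance ⊓ TopologicalSpace.induced Prod.snd inferInstance) := rfl
  have h3 := Units.topology_eq_inf (M := OD)
  have h2' : (instTopologicalSpace : TopologicalSpace OD) = _ := h2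
  rw [h2'] at h3
  rw [h1]
  refine (congrArg _ h3).trans ?_
  simp only [induced_inf, induced_compose, iInf_prod, iInf_bool_eq]
  rfl

omit [CharP k₂ p] in
theorem mem_nhds_iff (u : U₁ p k k₂) (V : Set (U₁ p k k₂)) : V ∈ nhds u ↔ ∃ n : ℕ, ∀ v,
    (p : W₂) ^ n ∣ fstPart v - fstPart u → (p : W₂) ^ n ∣ sndPart v - sndPart u →
    (p : W₂) ^ n ∣ fstPart v⁻¹ - fstPart u⁻¹ →
    (p : W₂) ^ n ∣ sndPart v⁻¹ - sndPart u⁻¹ → v ∈ V := by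
  have h := WittVector.mem_nhds_iff (p := p) (k := k₂)
    (fun (i : Bool × Bool) (u : U₁ p k k₂) =>
      bif i.2 then fstPart (bif i.1 then u else u⁻¹) else sndPart (bif i.1 then u else u⁻¹)) u V
  rw [← topology_eq] at h
  refine Iff.trans h (exists_congr fun n => forall_congr' fun v => ?_)
  simp only [Prod.forall, Bool.forall_bool, cond_true, cond_false]
  tauto

end CharP

section Fixed

variable [CharP k p] [CharP k₂ p] {ζ : k₂} (hζ : IntermediateField.adjoin k {ζ} = ⊤)

include hζ

omit [CharP k p] in
/-- Witt vectors that are fixed modulo `p ^ n` come from `W(k)` modulo `p ^ n`. -/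
theorem exists_map_sub [PerfectRing k₂ p] {n : ℕ} {r : W₂} (h : (p : W₂) ^ n ∣ r - σ r) :
    ∃ s : W, (p : W₂) ^ n ∣ r - ι s := by
  -- Modulo p^n only the first n Witt coordinates count, and σ acts on each by Frobenius, so the
  -- fixed ones lie in k.
  simp only [WittVector.natCast_pow_dvd_sub_iff] at h ⊢
  have h1 : ∀ m, ∃ a : k, m < n → algebraMap k k₂ a = r.coeff m := fun m => by
    by_cases hm : m < n
    · obtain ⟨a, ha⟩ := exists_algebraMap_eq hζ (s := r.coeff m) (h m hm).symm
      exact ⟨a, fun _ => ha⟩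
    · exact ⟨0, fun h => absurd h hm⟩
  choose a ha using h1
  exact ⟨WittVector.mk p a, fun m hm => by rw [WittVector.map_coeff]; exact (ha m hm).symm⟩

omit [CharP k p] [CharP k₂ p] in
theorem exists_map_eq {r : W₂} (h : σ r = r) : ∃ s : W, ι s = r := by
  have h1 : ∀ m, ∃ a : k, algebraMap k k₂ a = r.coeff m := fun m =>
    exists_algebraMap_eq hζ (congrArg (fun x => WittVector.coeff x m) h)
  choose a ha using h1
  refine ⟨WittVector.mk p a, ?_⟩
  ext m
  rw [WittVector.map_coeff]
  exact ha m

omit hζ [Fintype k] [Algebra.IsQuadraticExtension k k₂] in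
theorem natCast_dvd_map_iff [PerfectRing k₂ p] [PerfectRing k p] (r : W) :
    (p : W₂) ∣ ι r ↔ (p : W) ∣ r := by
  rw [WittVector.natCast_dvd_iff, WittVector.natCast_dvd_iff, constantCoeff_map,
    map_eq_zero_iff _ (algebraMap k k₂).injective]

omit hζ [CharP k₂ p] in
/-- The element of `Z₁` attached to a principal unit of `W(k)`. -/
theorem exists_mem_Z₁_inclK {s : W} (hs : (p : W) ∣ s - 1) :
    ∃ z ∈ Z₁ p k k₂, (z.1 : OD) = inclK p k k₂ s := by
  obtain ⟨r, hr⟩ := hs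
  have hu : IsUnit s := WittVector.isUnit_of_eq_one_add ⟨r, by linear_combination hr⟩
  refine ⟨⟨Units.map (inclK p k k₂).toMonoidHom hu.unit, ?_⟩, ⟨hu.unit, rfl⟩, rfl⟩
  refine ⟨Pi p k k₂ * inclK p k k₂ r, ?_⟩
  rw [← mul_assoc, Pi_mul_Pi, ← map_natCast (inclK p k k₂), ← map_mul, ← hr, map_sub, map_one]
  simp

theorem exists_mem_Z₁ [PerfectRing k₂ p] [PerfectRing k p] {n : ℕ} (hn : 1 ≤ n) {u : U₁ p k k₂}
    (h : (p : W₂) ^ n ∣ fstPart u - σ (fstPart u)) :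
    ∃ z ∈ Z₁ p k k₂, (p : W₂) ^ n ∣ fstPart u - fstPart z := by
  obtain ⟨s, hs⟩ := exists_map_sub hζ h
  have h1 : (p : W) ∣ s - 1 := by
    rw [← natCast_dvd_map_iff (k₂ := k₂), map_sub, map_one]
    have := (dvd_fstPart u).sub ((dvd_pow_self (p : W₂) (by omega)).trans hs)
    convert this using 1
    ring
  obtain ⟨z, hz, hzs⟩ := exists_mem_Z₁_inclK (k₂ := k₂) h1
  exact ⟨z, hz, by simpa [fstPart, hzs] using hs⟩

end Fixed

end QuaternionOrder

/-! ### Generators of the quaternion unit group and their valuations -/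

namespace QuaternionOrder

variable {p : ℕ} [Fact p.Prime] {k k₂ : Type*} [Field k] [Fintype k] [Field k₂]
  [Algebra k k₂] [Algebra.IsQuadraticExtension k k₂] [CharP k₂ p]

local notation "OD" => QuaternionOrder p k k₂
local notation "W" => WittVector p k
local notation "W₂" => WittVector p k₂
local notation "ι" => WittVector.map (p := p) (algebraMap k k₂)
local notation "σ" => wittSigma p k k₂
local notation "T" => WittVector.teichmuller p

/-- A lift of `mkG y h`. -/
def mkU (y : OD) (h : ∃ x, y = 1 + Pi p k k₂ * x) : U₁ p k k₂ :=
  ⟨(isUnit_one_add_Pi_mul h).unit, h⟩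

theorem coe_mkU (y : OD) (h : ∃ x, y = 1 + Pi p k k₂ * x) : ((mkU y h).1 : OD) = y := rfl

/-- A lift of `A a`. -/
def liftA (a : k) : U₁ p k k₂ :=
  mkU (1 + inclK p k k₂ (T a) * Pi p k k₂) ⟨inclK p k k₂ (T a), by rw [inclK_comm]⟩

/-- A lift of `B ζ a`. -/
def liftB (ζ : k₂) (a : k) : U₁ p k k₂ :=
  mkU (1 + inclK p k k₂ (T a) * incl p k k₂ (T ζ) * Pi p k k₂)
    ⟨inclK p k k₂ (T a) * incl p k k₂ (σ (T ζ)), by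
        rw [← mul_assoc, ← inclK_comm, mul_assoc, mul_assoc, Pi_mul_incl, wittSigma_wittSigma]⟩

/-- A lift of `C ζ a`. -/
def liftC (ζ : k₂) (a : k) : U₁ p k k₂ :=
  mkU (1 + inclK p k k₂ (T a) * incl p k k₂ (T ζ) * (p : OD))
    ⟨Pi p k k₂ * (inclK p k k₂ (T a) * incl p k k₂ (T ζ)), by
        rw [← (Nat.cast_commute p _).eq, ← Pi_mul_Pi, mul_assoc]⟩

theorem fstPart_liftA (a : k) : fstPart (liftA (p := p) (k₂ := k₂) a) = 1 := by
  simp [fstPart, liftA, coe_mkU]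

theorem sndPart_liftA (a : k) : sndPart (liftA (p := p) (k₂ := k₂) a) = ι (T a) := by
  simp [sndPart, liftA, coe_mkU]

theorem fstPart_liftB (ζ : k₂) (a : k) : fstPart (liftB (p := p) ζ a) = 1 := by
  simp [fstPart, liftB, coe_mkU]

theorem sndPart_liftB (ζ : k₂) (a : k) : sndPart (liftB (p := p) ζ a) = ι (T a) * T ζ := by
  simp [sndPart, liftB, coe_mkU]

theorem fstPart_liftC (ζ : k₂) (a : k) :
    fstPart (liftC (p := p) ζ a) = 1 + p * (ι (T a) * T ζ) := by
  simp [fstPart, liftC, coe_mkU, mul_comm]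

theorem sndPart_liftC (ζ : k₂) (a : k) : sndPart (liftC (p := p) ζ a) = 0 := by
  simp [sndPart, liftC, coe_mkU]

variable (p) in
/-- Lifts of the elements of the basis. -/
def basisLift (f : ℕ) (α : k) (ζ : k₂) : Fin (f + f + f) → U₁ p k k₂ :=
  Fin.append (Fin.append (fun i : Fin f => liftA (α ^ (i : ℕ)))
    (fun i : Fin f => liftB ζ (α ^ (i : ℕ)))) (fun i : Fin f => liftC ζ (α ^ (i : ℕ)))

variable (p) in
omit [Fintype k] [Algebra.IsQuadraticExtension k k₂] [CharP k₂ p] in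
/-- The leading coefficients of the elements of the basis. -/
def basisCoeff (f : ℕ) (α : k) (ζ : k₂) : Fin (f + f + f) → W₂ :=
  Fin.append (Fin.append (fun i : Fin f => ι (T (α ^ (i : ℕ))))
    (fun i : Fin f => ι (T (α ^ (i : ℕ))) * T ζ)) (fun i : Fin f => ι (T (α ^ (i : ℕ))) * T ζ)

theorem mk_basisLift (f : ℕ) (α : k) (ζ : k₂) (i : Fin (f + f + f)) :
    basis (p := p) f α ζ i = QuotientGroup.mk (basisLift p f α ζ i) := by
  revert i
  rw [forall_append]
  refine ⟨fun i => ?_, fun i => ?_, fun i => ?_⟩ <;>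
    simp only [basis, basisLift, Fin.append_left, Fin.append_right] <;> rfl

omit [CharP k₂ p] in
theorem nrd_mul_inclK (x : OD) (s : W) : nrd (x * inclK p k k₂ s) = nrd x * ι (s * s) := by
  simp only [nrd, mul_fst, mul_snd, inclK_fst, inclK_snd, map_zero, mul_zero, add_zero, zero_add,
    map_mul, wittSigma_map_algebraMap]
  ring

theorem eq_of_mk_eq [CharP k p] (hp : 2 < p) {u v : U₁ p k k₂}
    (h : (QuotientGroup.mk u : G p k k₂) = QuotientGroup.mk v)
    (hu : nrd (u.1 : OD) = 1) (hv : nrd (v.1 : OD) = 1) : u = v := by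
  have := finite_of_isQuadraticExtension k k₂
  have hz : u⁻¹ * v ∈ Z₁ p k k₂ := QuotientGroup.eq.1 h
  have hd := dvd_fstPart (u⁻¹ * v)
  obtain ⟨c, hc⟩ := hz
  have hc' : ((u⁻¹ * v).1 : OD) = inclK p k k₂ c := congrArg Units.val hc.symm
  have hone : (c : W) = 1 := by
    refine WittVector.eq_one_of_mul_self hp ?_ ?_
    · rw [fstPart, hc', inclK_fst, ← map_one ι, ← map_sub, natCast_dvd_map_iff] at hd
      exact hd
    · have h1 := nrd_mul_inclK (u.1 : OD) (c : W)
      rw [← hc', ← Units.val_mul, ← Subgroup.coe_mul, mul_inv_cancel_left, hu, hv, one_mul,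
        ← map_one ι] at h1
      exact (WittVector.map_injective _ (algebraMap k k₂).injective h1).symm
  have : u⁻¹ * v = 1 := by
    apply Subtype.ext
    apply Units.ext
    rw [hc', hone, map_one]
    rfl
  exact inv_mul_eq_one.1 this

/-- The `p`-valuation of the class of `u` is read off from a central multiple of `u`. -/
theorem exists_omega_mk [CharP k p] (hp : 2 < p) {ζ : k₂}
    (hζ : IntermediateField.adjoin k {ζ} = ⊤) (u : U₁ p k k₂) :
    ∃ s : W, (p : W) ∣ s - 1 ∧ omega (QuotientGroup.mk u) =
      vp p k k₂ (⟨fstPart u * ι s - 1, sndPart u * ι s⟩ : OD) := by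
  have := finite_of_isQuadraticExtension k k₂
  obtain ⟨n, hn⟩ := exists_map_eq hζ (r := nrd (u.1 : OD)) (by
    simp only [nrd, map_sub, map_mul, map_natCast, wittSigma_wittSigma]
    ring)
  have hn1 : (p : W) ∣ n - 1 := by
    rw [← natCast_dvd_map_iff (k₂ := k₂), map_sub, map_one, hn]
    obtain ⟨r, hr⟩ := (isTwistedUnitGroup p k k₂).norm_eq u
    exact ⟨r, sub_eq_iff_eq_add'.2 hr⟩
  have hunit : IsUnit n := by
    obtain ⟨r, hr⟩ := hn1
    exact WittVector.isUnit_of_eq_one_add ⟨r, by linear_combination hr⟩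
  obtain ⟨m, hm⟩ := hunit.exists_right_inv
  -- A central factor s multiplies the reduced norm by s², so s is taken to be a square root of the
  -- inverse norm.
  obtain ⟨s, hs, hs1⟩ := WittVector.exists_mul_self_eq hp (m := m) (by
    have := hn1.neg_right.mul_right m
    convert this using 1
    linear_combination hm)
  obtain ⟨z, hz, hzs⟩ := exists_mem_Z₁_inclK (k₂ := k₂) hs1
  refine ⟨s, hs1, ?_⟩
  have hmk : (QuotientGroup.mk (u * z) : G p k k₂) = QuotientGroup.mk u :=
    QuotientGroup.mk_mul_of_mem u hz
  have hnrd : nrd ((u * z).1 : OD) = 1 := by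
    rw [Subgroup.coe_mul, Units.val_mul, hzs, nrd_mul_inclK, hs, ← hn, ← map_mul, hm, map_one]
  have hval : ((u * z).1 : OD) - 1 = ⟨fstPart u * ι s - 1, sndPart u * ι s⟩ := by
    rw [Subgroup.coe_mul, Units.val_mul, hzs]
    ext1 <;> simp [fstPart, sndPart, wittSigma_map_algebraMap]
  rw [← hval]
  refine le_antisymm (iSup_le fun v => iSup_le fun hv => iSup_le fun hd => ?_)
    (le_iSup_of_le (u * z) (le_iSup_of_le hmk (le_iSup_of_le hnrd le_rfl)))
  rw [eq_of_mk_eq hp (hv.trans hmk.symm) hd hnrd]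

omit [Algebra.IsQuadraticExtension k k₂] [CharP k₂ p] in
theorem constantCoeff_map_eq_one [CharP k p] {s : W} (hs : (p : W) ∣ s - 1) :
    WittVector.constantCoeff (ι s) = 1 := by
  rw [WittVector.natCast_dvd_iff, map_sub, map_one, sub_eq_zero] at hs
  rw [constantCoeff_map, hs, map_one]

/-- The central correction is 1 modulo p, so it does not change the leading coefficient at Π. -/
theorem two_mul_omega_of_fstPart_eq_one [CharP k p] (hp : 2 < p) {ζ : k₂}
    (hζ : IntermediateField.adjoin k {ζ} = ⊤) {u : U₁ p k k₂} (h1 : fstPart u = 1)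
    (h2 : WittVector.constantCoeff (sndPart u) ≠ 0) : 2 * omega (QuotientGroup.mk u) = 1 := by
  have := finite_of_isQuadraticExtension k k₂
  obtain ⟨s, hs, hw⟩ := exists_omega_mk hp hζ u
  have hs1 := constantCoeff_map_eq_one (k₂ := k₂) hs
  have : emultiplicity (Pi p k k₂) (⟨fstPart u * ι s - 1, sndPart u * ι s⟩ : OD) = (1 : ℕ) := by
    rw [emultiplicity_eq_coe, pow_one, Pi_dvd_iff, Pi_sq_dvd_iff]
    simp only [WittVector.natCast_dvd_iff, h1, one_mul, map_sub, map_mul, map_one, hs1, sub_self,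
      mul_one, true_and]
    exact h2
  rw [hw, vp, this]
  simpa using ENNReal.two_mul_half

theorem two_mul_omega_C [CharP k p] (hp : 2 < p) {ζ : k₂}
    (hζ : IntermediateField.adjoin k {ζ} = ⊤) {a : k} (ha : a ≠ 0) :
    2 * omega (QuotientGroup.mk (liftC (p := p) ζ a)) = 2 := by
  have := finite_of_isQuadraticExtension k k₂
  obtain ⟨s, hs, hw⟩ := exists_omega_mk hp hζ (liftC (p := p) ζ a)
  have hs1 := constantCoeff_map_eq_one (k₂ := k₂) hs
  rw [fstPart_liftC, sndPart_liftC, zero_mul] at hw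
  obtain ⟨r, hr⟩ := hs
  have hr' : ι s = 1 + p * ι r := by
    have := congrArg ι hr
    rw [map_sub, map_one, map_mul, map_natCast] at this
    linear_combination this
  have hfst : (1 + p * (ι (T a) * T ζ)) * ι s - 1 = p * (ι (T a) * T ζ * ι s + ι r) := by
    linear_combination hr'
  have : emultiplicity (Pi p k k₂) (⟨(1 + p * (ι (T a) * T ζ)) * ι s - 1, 0⟩ : OD) =
      (2 : ℕ) := by
    rw [emultiplicity_eq_coe, Pi_sq_dvd_iff]
    refine ⟨⟨⟨_, hfst⟩, dvd_zero _⟩, fun h => ?_⟩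
    have h1 := dvd_of_Pi_pow_three_dvd h
    simp only [hfst, pow_two] at h1
    rw [mul_dvd_mul_iff_left WittVector.natCast_ne_zero, WittVector.natCast_dvd_iff, map_add,
      map_mul, map_mul, hs1, constantCoeff_map, constantCoeff_map,
      WittVector.constantCoeff_teichmuller, WittVector.constantCoeff_teichmuller] at h1
    -- The central correction contributes r ∈ W(k), which cannot cancel aζ modulo p because 1 and ζ
    -- are independent over k.
    have h2 := (existsUnique_add_mul hζ 0).unique (y₁ := (WittVector.constantCoeff r, a))
      (y₂ := (0, 0)) (by linear_combination -h1) (by simp)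
    exact ha (congrArg Prod.snd h2)
  rw [hw, vp, this]
  rw [mul_comm]
  exact ENNReal.div_mul_cancel (by norm_num) (by norm_num)

theorem ne_zero_of_adjoin {ζ : k₂} (hζ : IntermediateField.adjoin k {ζ} = ⊤) : ζ ≠ 0 := by
  rintro rfl
  exact frobenius_ne hζ (map_zero _)

theorem two_mul_omega_basis [CharP k p] (hp : 2 < p) {f : ℕ}
    (hk : Fintype.card k = p ^ f) {α : k} (hα : Subfield.closure {α} = ⊤) {ζ : k₂}
    (hζ : IntermediateField.adjoin k {ζ} = ⊤) (i : Fin (f + f + f)) :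
    2 * omega (basis (p := p) f α ζ i) = genWeight f i := by
  rw [mk_basisLift]
  revert i
  rw [forall_append]
  simp only [genWeight_A, genWeight_B, genWeight_C, basisLift, Fin.append_left, Fin.append_right]
  have hne : ∀ i : Fin f, algebraMap k k₂ (α ^ (i : ℕ)) ≠ 0 := fun i =>
    (map_ne_zero _).2 (pow_ne_zero_of_closure hk hα i)
  refine ⟨fun i => ?_, fun i => ?_, fun i => ?_⟩
  · rw [two_mul_omega_of_fstPart_eq_one hp hζ (fstPart_liftA _), Nat.cast_one]
    rw [sndPart_liftA, constantCoeff_map, WittVector.constantCoeff_teichmuller]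
    exact hne i
  · rw [two_mul_omega_of_fstPart_eq_one hp hζ (fstPart_liftB _ _), Nat.cast_one]
    rw [sndPart_liftB, map_mul, constantCoeff_map, WittVector.constantCoeff_teichmuller,
      WittVector.constantCoeff_teichmuller]
    exact mul_ne_zero (hne i) (ne_zero_of_adjoin hζ)
  · rw [two_mul_omega_C hp hζ (pow_ne_zero_of_closure hk hα i)]
    rfl

theorem isTwistedBasis [CharP k p] (hp : 2 < p) {f : ℕ}
    (hk : Fintype.card k = p ^ f) {α : k} (hα : Subfield.closure {α} = ⊤) {ζ : k₂}
    (hζ : IntermediateField.adjoin k {ζ} = ⊤) :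
    IsTwistedBasis p σ fstPart sndPart (basisLift p f α ζ) (genWeight f) (basisCoeff p f α ζ) :=
  have := finite_of_isQuadraticExtension k k₂
  have h2 : (2 : k₂) ≠ 0 := by
    rw [← Nat.cast_ofNat, Ne, CharP.cast_eq_zero_iff k₂ p]
    exact fun h => absurd (Nat.le_of_dvd (by norm_num) h) (by omega)
  { isTwistedUnitGroup p k k₂ with
    weight := genWeight_eq
    X_gen_one := by
      rw [forall_append]
      simp only [genWeight_C, basisLift, Fin.append_left, Fin.append_right, fstPart_liftA,
        fstPart_liftB]
      exact ⟨fun i _ => trivial, fun i _ => trivial, fun i h => by norm_num at h⟩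
    Y_gen_one := by
      rw [forall_append]
      simp only [genWeight_C, basisLift, basisCoeff, Fin.append_left, Fin.append_right,
        sndPart_liftA, sndPart_liftB]
      exact ⟨fun i _ => trivial, fun i _ => trivial, fun i h => by norm_num at h⟩
    X_gen_two := by
      rw [forall_append]
      simp only [genWeight_A, genWeight_B, basisLift, basisCoeff, Fin.append_left,
        Fin.append_right, fstPart_liftC]
      exact ⟨fun i h => by norm_num at h, fun i h => by norm_num at h, fun i _ => trivial⟩
    Y_gen_two := by
      rw [forall_append]
      simp only [genWeight_A, genWeight_B, basisLift, Fin.append_left,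
        Fin.append_right, sndPart_liftC]
      exact ⟨fun i h => by norm_num at h, fun i h => by norm_num at h, fun i _ => trivial⟩
    digits_one := fun r => by
      simp only [natCast_dvd_sub_sum_iff (ρ := WittVector.constantCoeff)
        WittVector.natCast_dvd_iff]
      refine existsUnique_digits_one hk hα (algebraMap k k₂) (existsUnique_add_mul hζ)
        (fun i => ?_) (fun i => ?_) _
      · simp only [basisCoeff, Fin.append_left]
        rw [constantCoeff_map, WittVector.constantCoeff_teichmuller, mul_one]
      · simp only [basisCoeff, Fin.append_left, Fin.append_right]
        rw [map_mul, constantCoeff_map, WittVector.constantCoeff_teichmuller,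
          WittVector.constantCoeff_teichmuller]
    digits_two := fun r hr => by
      simp only [natCast_dvd_sub_sum_iff (ρ := WittVector.constantCoeff)
        WittVector.natCast_dvd_iff]
      refine existsUnique_digits_two hk hα (algebraMap k k₂)
        (existsUnique_mul_sub hζ h2 ?_) (fun i => ?_)
      · rw [← constantCoeff_wittSigma, hr, map_neg]
      · simp only [basisCoeff, Fin.append_right]
        rw [map_sub, constantCoeff_wittSigma, map_mul, constantCoeff_map,
          WittVector.constantCoeff_teichmuller, WittVector.constantCoeff_teichmuller, map_mul,
          AlgHom.commutes, mul_sub]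
    lift := fun r => by
      refine ⟨mkU ⟨1, r⟩ ⟨⟨σ r, 0⟩, ?_⟩, rfl, rfl⟩
      ext1 <;> simp [wittSigma_wittSigma]
    comm := by
      rw [forall_append]
      simp only [genWeight_A, genWeight_B, basisCoeff, Fin.append_right]
      -- For c in k one has 2(cφ(ζ) - ζc) = -2c(ζ - φ(ζ)), whence c = -α^i/2.
      refine ⟨fun i h => by norm_num at h, fun i h => by norm_num at h,
        fun i _ => ⟨ι (T (-(α ^ (i : ℕ)) / 2)), T ζ, ?_⟩⟩
      rw [WittVector.natCast_dvd_iff]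
      simp only [map_sub, map_mul, constantCoeff_wittSigma, constantCoeff_map, map_ofNat,
        WittVector.constantCoeff_teichmuller, AlgHom.commutes, map_div₀, map_neg]
      field_simp
      ring }

theorem completedGroupRing [CharP k p] (hp : 3 < p) {f : ℕ} (hk : Fintype.card k = p ^ f) {α : k}
    (hα : Subfield.closure {α} = ⊤) {ζ : k₂} (hζ : IntermediateField.adjoin k {ζ} = ⊤)
    (F : Type*) [Field F] [Finite F] [CharP F p] :
    (∀ y : CompletedGroupRing F (QuaternionOrder.G p k k₂), ∃! c : (Fin (f + f + f) → ℕ) → F,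
        CompletedGroupRing.IsExpansion (QuaternionOrder.basis f α ζ) c y) ∧
      ∃ 𝔪 : Ideal (CompletedGroupRing F (QuaternionOrder.G p k k₂)),
        𝔪.IsTwoSided ∧
        (∀ I : Ideal (CompletedGroupRing F (QuaternionOrder.G p k k₂)), I.IsMaximal ↔ I = 𝔪) ∧
        ∀ j : ℕ, ((𝔪 ^ j : Ideal (CompletedGroupRing F (QuaternionOrder.G p k k₂))) :
            Set (CompletedGroupRing F (QuaternionOrder.G p k k₂))) =
          {y | (j : ℝ≥0∞) ≤
            CompletedGroupRing.nu QuaternionOrder.omega (QuaternionOrder.basis f α ζ) y} :=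
  have := finite_of_isQuadraticExtension k k₂
  have hT := isTwistedBasis (by omega) hk hα hζ
  hT.completedGroupRing (Z₁ p k k₂) (fun _ => fstPart_of_mem_Z₁) hp
    (hT.isOpen_congr mem_nhds_iff)
    (fun _ hV hle => hT.exists_congr_le mem_nhds_iff (fun _ => fstPart_of_mem_Z₁)
      (fun _ hn _ h => exists_mem_Z₁ hζ hn h) hV hle)
    (mk_basisLift f α ζ) (two_mul_omega_basis (by omega) hk hα hζ)

end QuaternionOrder

end

theorem mainTheorem4 (p : ℕ) [Fact p.Prime] (hp : 3 < p) (f : ℕ) (hf : 1 ≤ f)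
    (k : Type*) [Field k] [Fintype k] [CharP k p] (hk : Fintype.card k = p ^ f)
    (k₂ : Type*) [Field k₂] [CharP k₂ p] [Algebra k k₂] [Algebra.IsQuadraticExtension k k₂]
    (F : Type*) [Field F] [Finite F] [Algebra k F]
    (α : k) (hα : Subfield.closure {α} = ⊤)
    (ζ : k₂) (hζ : IntermediateField.adjoin k {ζ} = ⊤) :
    ((∀ y : CompletedGroupRing F (Iwahori.G p k), ∃! c : (Fin (f + f + f) → ℕ) → F,
        CompletedGroupRing.IsExpansion (Iwahori.basis f α) c y) ∧
      ∃ 𝔪 : Ideal (CompletedGroupRing F (Iwahori.G p k)),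
        𝔪.IsTwoSided ∧ (∀ I : Ideal (CompletedGroupRing F (Iwahori.G p k)), I.IsMaximal ↔ I = 𝔪) ∧
        ∀ j : ℕ, ((𝔪 ^ j : Ideal (CompletedGroupRing F (Iwahori.G p k))) :
            Set (CompletedGroupRing F (Iwahori.G p k))) =
          {y | (j : ℝ≥0∞) ≤ CompletedGroupRing.nu Iwahori.omega (Iwahori.basis f α) y}) ∧
    ((∀ y : CompletedGroupRing F (QuaternionOrder.G p k k₂), ∃! c : (Fin (f + f + f) → ℕ) → F,
        CompletedGroupRing.IsExpansion (QuaternionOrder.basis f α ζ) c y) ∧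
      ∃ 𝔪 : Ideal (CompletedGroupRing F (QuaternionOrder.G p k k₂)),
        𝔪.IsTwoSided ∧
        (∀ I : Ideal (CompletedGroupRing F (QuaternionOrder.G p k k₂)), I.IsMaximal ↔ I = 𝔪) ∧
        ∀ j : ℕ, ((𝔪 ^ j : Ideal (CompletedGroupRing F (QuaternionOrder.G p k k₂))) :
            Set (CompletedGroupRing F (QuaternionOrder.G p k k₂))) =
          {y | (j : ℝ≥0∞) ≤
            CompletedGroupRing.nu QuaternionOrder.omega (QuaternionOrder.basis f α ζ) y}) := by
  have : CharP F p := charP_of_injective_algebraMap (algebraMap k F).injective p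
  exact ⟨Iwahori.completedGroupRing hp hk hα F, QuaternionOrder.completedGroupRing hp hk hα hζ F⟩
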